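/- Let $B$ be the closed unit ball and $S$ the unit sphere of $\mathbb R^3$, and let $q_1,q_2$ be smooth real-valued functions on $\mathbb R^3$ supported in $B$. For $i=1,2$ and $\omega\in S$ let $U_i(x,t,\omega)$ be the distribution solution of \[ \partial_t^2U_i-\Delta U_i+q_iU_i=0\ \text{ on }\mathbb R^3\times\mathbb R,\qquad U_i=\delta(t-x\cdot\omega)\ \text{ for } t<-1 . \] Then $U_i=\delta(t-x\cdot\omega)+u_i(x,t,\omega)$, where $u_i(\cdot,\cdot,\omega)$ is a function that vanishes for $t<x\cdot\omega$ and is smooth up to the boundary on $t\ge x\cdot\omega$. The backscattering data, that is, the far field pattern \[ \alpha_i(\theta,\omega,s)=-\frac1{2\pi}\int_{x\cdot\theta=1}(\theta\cdot\nabla u_i)(x,1-s,\omega)\,dS_x\qquad\text{at }\theta=-\omega , \] are well defined for all $\omega\in S$, $s\in\mathbb R$: the integrand is a classical derivative at every point of the plane and is integrable over the plane. Put $p=q_2-q_1$ and $\alpha=\alpha_1-\alpha_2$. Then for all $\tau\in\mathbb R$ and all $\omega\in S$ \[ 8\pi\,\alpha(-\omega,\omega,-2\tau)=\int_{x\cdot\omega=\tau}p(x)\,dS_x+\int_{-1}^{\tau}\int_{x\cdot\omega=t}k(x,\omega,\tau)\,p(x)\,dS_x\,dt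 , \] where \[ k(x,\omega,\tau)=2(u_1+u_2)(x,2\tau-x\cdot\omega,\omega)+2\int_{x\cdot\omega}^{2\tau-x\cdot\omega}u_1(x,s,\omega)\,u_2(x,2\tau-s,\omega)\,ds , \] and $k$ is smooth, jointly in $(x,\omega,\tau)$, on the region $\{(x,\omega,\tau)\in\mathbb R^3\times S\times\mathbb R:\ -1\le x\cdot\omega\le\tau\}$. -/

import Mathlib

open MeasureTheory TopologicalSpace
open scoped Distributions InnerProductSpace Laplacian

noncomputable section

/-- Three-dimensional Euclidean space. -/
abbrev E3 : Type := EuclideanSpace ℝ (Fin 3)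

/-- Real-valued distributions on space-time `ℝ³ × ℝ`. -/
abbrev SpaceTimeDistribution : Type := 𝓓'((⊤ : Opens (E3 × ℝ)), ℝ)

/-- Smooth compactly supported test functions on space-time `ℝ³ × ℝ`. -/
abbrev SpaceTimeTest : Type := 𝓓((⊤ : Opens (E3 × ℝ)), ℝ)

/-- The wave operator with potential, `φ_tt - Δ_x φ + q φ`. -/
def waveOp (q : E3 → ℝ) (φ : E3 × ℝ → ℝ) (z : E3 × ℝ) : ℝ :=
  iteratedDeriv 2 (fun s : ℝ => φ (z.1, s)) z.2
    - (Δ (fun y : E3 => φ (y, z.2))) z.1 + q z.1 * φ z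

/-- The value of the incoming plane wave `δ(t - x · ω)` on a test function. -/
def planeWave (ω : E3) (φ : E3 × ℝ → ℝ) : ℝ :=
  ∫ x : E3, φ (x, ⟪x, ω⟫_ℝ)

/-- The distribution `U` solves the initial value problem
`U_tt - Δ U + q U = 0` on `ℝ³ × ℝ`, `U = δ(t - x · ω)` for `t < -1`.
The wave operator is formally self-adjoint, so it is moved to the test function as it stands. -/
structure IsPlaneWaveSolution (q : E3 → ℝ) (ω : E3) (U : SpaceTimeDistribution) : Prop where
  pde : ∀ φ ψ : SpaceTimeTest, (∀ z, ψ z = waveOp q φ z) → U ψ = 0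
  init : ∀ φ : SpaceTimeTest, tsupport φ ⊆ {z : E3 × ℝ | z.2 < -1} → U φ = planeWave ω φ

/-- `U = δ(t - x · ω) + u`, where `u` is the function that vanishes for `t < x · ω` and is smooth
up to the boundary on `t ≥ x · ω`. These conditions determine `u` at every point. -/
structure IsScatteredWave (ω : E3) (U : SpaceTimeDistribution) (u : E3 → ℝ → ℝ) : Prop where
  eq_zero : ∀ x t, t < ⟪x, ω⟫_ℝ → u x t = 0
  smooth : ContDiffOn ℝ (⊤ : ℕ∞) (fun z : E3 × ℝ => u z.1 z.2) {z : E3 × ℝ | ⟪z.1, ω⟫_ℝ ≤ z.2}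
  repr : ∀ φ : SpaceTimeTest, U φ = planeWave ω φ + ∫ z : E3 × ℝ, u z.1 z.2 * φ z

/-- The integral of `f` over the plane `x · ω = τ` (`‖ω‖ = 1`) with respect to surface measure. -/
def planeIntegral (ω : E3) (τ : ℝ) (f : E3 → ℝ) : ℝ :=
  ∫ x in {x : E3 | ⟪x, ω⟫_ℝ = τ}, f x ∂μHE[2]

/-- The directional derivative `(θ · ∇u)(x, t)` in the space variable. -/
def spaceDeriv (u : E3 → ℝ → ℝ) (θ x : E3) (t : ℝ) : ℝ :=
  fderiv ℝ (fun y : E3 => u y t) x θ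

/-- The backscattering data `α(-ω, ω, s)`: the far field pattern
`-1/(2π) ∫_{x · θ = 1} (θ · ∇u)(x, 1 - s) dS_x` of the scattered wave `u` produced by the incoming
direction `ω`, in the direction `θ = -ω`. -/
def backscattering (u : E3 → ℝ → ℝ) (ω : E3) (s : ℝ) : ℝ :=
  -(1 / (2 * Real.pi)) * planeIntegral (-ω) 1 (fun x => spaceDeriv u (-ω) x (1 - s))

/-- The integral defining the backscattering data makes sense: the integrand is a classical
derivative at every point of the plane, and it is integrable over the plane. -/
def BackscatteringDefined (u : E3 → ℝ → ℝ) (ω : E3) (s : ℝ) : Prop :=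
  (∀ x : E3, ⟪x, -ω⟫_ℝ = 1 → DifferentiableAt ℝ (fun y : E3 => u y (1 - s)) x) ∧
  IntegrableOn (fun x => spaceDeriv u (-ω) x (1 - s)) {x : E3 | ⟪x, -ω⟫_ℝ = 1} μHE[2]

/-- The kernel `k(x, ω, τ) = 2 (u₁ + u₂)(x, 2τ - x·ω, ω)
+ 2 ∫_{x·ω}^{2τ - x·ω} u₁(x, s, ω) u₂(x, 2τ - s, ω) ds`, where `u₁ ω x t` is `u₁(x, t, ω)`. -/
def identityKernel (u₁ u₂ : E3 → E3 → ℝ → ℝ) (x ω : E3) (τ : ℝ) : ℝ :=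
  2 * (u₁ ω x (2 * τ - ⟪x, ω⟫_ℝ) + u₂ ω x (2 * τ - ⟪x, ω⟫_ℝ))
    + 2 * ∫ s in ⟪x, ω⟫_ℝ..(2 * τ - ⟪x, ω⟫_ℝ), u₁ ω x s * u₂ ω x (2 * τ - s)

/-- The region `-1 ≤ x · ω ≤ τ` in the set of all `(x, ω, τ)` with `x ∈ ℝ³`, `‖ω‖ = 1`, `τ ∈ ℝ`. -/
def kernelRegion : Set (E3 × E3 × ℝ) :=
  {z | ‖z.2.1‖ = 1 ∧ -1 ≤ ⟪z.1, z.2.1⟫_ℝ ∧ ⟪z.1, z.2.1⟫_ℝ ≤ z.2.2}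

end

/-!
For a unit vector `ω` the solution is built behind the front `t = x · ω` in the variable
`s = √(t - x · ω)`. The Lippmann–Schwinger equation for the scattered wave `u` integrates `q` and
`q u` over paraboloids with focus `x` and axis `ω`; after the substitution `a = s² sin² θ` for their
parameter it becomes an equation for a function `V (x, ω, s)` with smooth coefficients and of
Volterra type, since an exponential weight in `s²` makes the integral operator a contraction on all
compact sets. Hence it has a smooth solution, which is moreover even in `s` (`exists_isProfile`). A
smooth even function of `s` is a smooth function of `s²`, and `u (x, t, ω) = V (x, ω, √(t - x · ω))`
is smooth up to the front (`contDiffOn_comp_sqrt`). The same fact gives the smoothness of the kernel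
`k`: the substitution `s = x · ω + m² sin² θ` turns its inner integral into a smooth even function
of `m = √(2 (τ - x · ω))` (`identityKernel_wave`).

The advanced potential `f ↦ ∫ f (x + z, t + |z|) dz / (4π |z|)` inverts the d'Alembert operator on
functions of bounded support (`conePot_box`), so the Lippmann–Schwinger equation, integrated by
Fubini against test functions, says that `δ (t - x · ω) + u` is a distribution solution
(`IsProfile.weak_solution`). It is the only one by duality: every test function is `∂ₜ² f - Δf + q f`
for a smooth `f` that vanishes for late times, again by solving a Volterra equation
(`exists_backward`). Up to a part at times `t < -1`, where the distribution is prescribed, `f` is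
itself a test function, which determines the distribution (`IsProfile.repr`).

Over the planes `x · θ = const` in front of the support of `q`, with `θ = -ω`, the integral of the
retarded potential of a source is explicit: the spherical waves add up to plane waves. So
the Lippmann–Schwinger equation gives a closed form of the backscattering data
(`IsProfile.backscattering_eq`),
`8π α (-ω, ω, -2τ) = -∫_{x · ω = τ} q dS - 2 ∫ q(y) u (y, 2τ - y · ω) dy`.
In the difference for two potentials the first terms give the plane integral of `p = q₂ - q₁`. The
second terms carry `q₁ u₁` and `q₂ u₂`, and have to be rewritten as an integral against `p`. This
is done by `reciprocity`: writing `⟨f, g⟩ = ∫∫ f(y, t) g(y, 2τ - t) dy dt`, one has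
`⟨q₂ u₁, δ + u₂⟩ = ⟨q₁ u₂, δ + u₁⟩`, as the retarded potential is symmetric for this pairing (the
measure `dz / |z|` is invariant under `z ↦ -z`). So `⟨q₂ u₂, δ⟩ - ⟨q₁ u₁, δ⟩` equals
`⟨p, u₁ δ + u₂ δ + u₁ u₂⟩`, where the products pair times that add up to `2τ`; sliced into planes,
this is the integral of `k p`.
-/

section

open Set Filter Topology

set_option linter.unusedSectionVars false

noncomputable section

/-! ### Integrals with compactly supported fibres, depending on a parameter -/

section Parametric

variable {X Z F : Type} [NormedAddCommGroup X] [NormedSpace ℝ X] [FiniteDimensional ℝ X]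
  [NormedAddCommGroup Z] [NormedSpace ℝ Z] [FiniteDimensional ℝ Z] [MeasurableSpace Z]
  [BorelSpace Z] {μ : Measure Z} [IsFiniteMeasureOnCompacts μ]
  [NormedAddCommGroup F] [NormedSpace ℝ F]

/-- Locally uniformly in the parameter `P`, the section `f (P, ·)` vanishes outside a compact set,
up to a `μ`-null set of points that does not depend on `P`. -/
def FiberCompact (μ : Measure Z) (f : X × Z → F) : Prop :=
  ∀ P₀ : X, ∃ U ∈ 𝓝 P₀, ∃ C : Set Z, IsCompact C ∧ ∀ᵐ z ∂μ, ∀ P ∈ U, z ∉ C → f (P, z) = 0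

/-- The derivative of `f (P, z)` in the variable `P`. -/
def fiberDeriv (f : X × Z → F) (p : X × Z) : X →L[ℝ] F :=
  (fderiv ℝ f p).comp (ContinuousLinearMap.inl ℝ X Z)

theorem FiberCompact.mono {G : Type} [NormedAddCommGroup G] {f : X × Z → F} {g : X × Z → G}
    (hf : FiberCompact μ f) (h : ∀ z, f z = 0 → g z = 0) : FiberCompact μ g := by
  intro P₀
  obtain ⟨U, hU, C, hC, H⟩ := hf P₀
  exact ⟨U, hU, C, hC, H.mono fun z hz P hP hzC => h _ (hz P hP hzC)⟩

theorem hasFDerivAt_fiberDeriv {f : X × Z → F} (hf : Differentiable ℝ f) (P : X) (z : Z) :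
    HasFDerivAt (fun P' => f (P', z)) (fiberDeriv f (P, z)) P :=
  (hf (P, z)).hasFDerivAt.comp P (hasFDerivAt_prodMk_left P z)

theorem ContDiff.fiberDeriv {f : X × Z → F} {n m : WithTop ℕ∞} (hf : ContDiff ℝ n f)
    (h : m + 1 ≤ n) : ContDiff ℝ m (fiberDeriv f) :=
  (hf.fderiv_right h).clm_comp contDiff_const

theorem FiberCompact.fiberDeriv {f : X × Z → F} (hd : Differentiable ℝ f)
    (hf : FiberCompact μ f) : FiberCompact μ (fiberDeriv f) := by
  intro P₀
  obtain ⟨U, hU, C, hC, H⟩ := hf P₀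
  refine ⟨interior U, interior_mem_nhds.2 hU, C, hC, H.mono fun z hz P hP hzC => ?_⟩
  have h1 : (fun P' => f (P', z)) =ᶠ[𝓝 P] fun _ => (0 : F) := by
    filter_upwards [isOpen_interior.mem_nhds hP] with P' hP'
    exact hz P' (interior_subset hP') hzC
  exact (hasFDerivAt_fiberDeriv hd P z).unique
    ((hasFDerivAt_const (0 : F) P).congr_of_eventuallyEq h1)

theorem FiberCompact.integrable {f : X × Z → F} (hc : Continuous f) (hf : FiberCompact μ f)
    (P : X) : Integrable (fun z => f (P, z)) μ := by
  obtain ⟨U, hU, C, hC, H⟩ := hf P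
  have h1 : IntegrableOn (fun z => f (P, z)) C μ :=
    (hc.comp (by fun_prop : Continuous fun z : Z => (P, z))).continuousOn.integrableOn_compact hC
  refine (h1.integrable_indicator hC.measurableSet).congr ?_
  filter_upwards [H] with z hz
  by_cases hzC : z ∈ C
  · simp [hzC]
  · simp [hzC, hz P (mem_of_mem_nhds hU) hzC]

theorem FiberCompact.continuous_integral {f : X × Z → F} (hc : Continuous f)
    (hf : FiberCompact μ f) : Continuous fun P => ∫ z, f (P, z) ∂μ := by
  rw [continuous_iff_continuousAt]
  intro P₀
  obtain ⟨U, hU, C, hC, H⟩ := hf P₀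
  have h1 : Continuous fun P => ∫ z in C, f (P, z) ∂μ :=
    continuous_parametric_integral_of_continuous (f := fun P z => f (P, z)) hc hC
  refine h1.continuousAt.congr ?_
  filter_upwards [hU] with P hP
  refine setIntegral_eq_integral_of_ae_compl_eq_zero ?_
  filter_upwards [H] with z hz hzC using hz P hP hzC

theorem FiberCompact.hasFDerivAt_integral {f : X × Z → F} (hd : ContDiff ℝ 1 f)
    (hf : FiberCompact μ f) (P₀ : X) :
    HasFDerivAt (fun P => ∫ z, f (P, z) ∂μ) (∫ z, _root_.fiberDeriv f (P₀, z) ∂μ) P₀ := by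
  have hd1 : Differentiable ℝ f := hd.differentiable one_ne_zero
  have hdc : Continuous (_root_.fiberDeriv f) :=
    (ContDiff.fiberDeriv hd (m := 0) (by simp)).continuous
  obtain ⟨U, hU, C, hC, H⟩ := FiberCompact.fiberDeriv hd1 hf P₀
  obtain ⟨K, hK, hKU, hKc⟩ := local_compact_nhds hU
  obtain ⟨M, hM⟩ := (hKc.prod hC).exists_bound_of_continuousOn hdc.continuousOn
  refine hasFDerivAt_integral_of_dominated_of_fderiv_le (s := K)
    (F' := fun P z => _root_.fiberDeriv f (P, z)) (bound := C.indicator fun _ => M) hK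
    (Eventually.of_forall fun P => (hf.integrable hd.continuous P).aestronglyMeasurable)
    (hf.integrable hd.continuous P₀)
    ((FiberCompact.fiberDeriv hd1 hf).integrable hdc P₀).aestronglyMeasurable ?_ ?_ ?_
  · filter_upwards [H] with z hz P hP
    by_cases hzC : z ∈ C
    · simpa [hzC] using hM (P, z) ⟨hP, hzC⟩
    · simp [hzC, hz P (hKU hP) hzC]
  · exact (integrable_indicator_iff hC.measurableSet).2
      (integrableOn_const (hC.measure_lt_top.ne))
  · exact Eventually.of_forall fun z P _ => hasFDerivAt_fiberDeriv hd1 P z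

/-- A parameter integral of a `C^n` integrand with locally uniformly compact support is `C^n`. -/
theorem FiberCompact.contDiff_integral_nat {f : X × Z → F} (n : ℕ) (hd : ContDiff ℝ n f)
    (hf : FiberCompact μ f) : ContDiff ℝ n fun P => ∫ z, f (P, z) ∂μ := by
  induction n generalizing F with
  | zero => exact contDiff_zero.2 (hf.continuous_integral hd.continuous)
  | succ n ih =>
    have h1 : ContDiff ℝ 1 f := hd.of_le (by exact_mod_cast Nat.le_add_left 1 n)
    have key := fun P => hf.hasFDerivAt_integral h1 P
    push_cast
    refine contDiff_succ_iff_fderiv.2 ⟨fun P => (key P).differentiableAt, by simp, ?_⟩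
    rw [show fderiv ℝ (fun P => ∫ z, f (P, z) ∂μ) = fun P => ∫ z, _root_.fiberDeriv f (P, z) ∂μ
      from funext fun P => (key P).fderiv]
    exact ih (ContDiff.fiberDeriv hd (by simp))
      (FiberCompact.fiberDeriv (h1.differentiable one_ne_zero) hf)

/-- A parameter integral with compactly supported fibres inherits the smoothness of its
integrand. -/
theorem FiberCompact.contDiff_integral {f : X × Z → F} (hd : ContDiff ℝ (⊤ : ℕ∞) f)
    (hf : FiberCompact μ f) : ContDiff ℝ (⊤ : ℕ∞) fun P => ∫ z, f (P, z) ∂μ :=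
  contDiff_infty.2 fun n => hf.contDiff_integral_nat n (contDiff_infty.1 hd n)

end Parametric

/-! ### Linear integral equations of Volterra type -/

section Volterra

variable {X Z F : Type} [NormedAddCommGroup X] [NormedSpace ℝ X] [FiniteDimensional ℝ X]
  [NormedAddCommGroup Z] [NormedSpace ℝ Z] [FiniteDimensional ℝ Z] [MeasurableSpace Z]
  [BorelSpace Z] {μ : Measure Z} [IsFiniteMeasureOnCompacts μ]
  [NormedAddCommGroup F] [NormedSpace ℝ F]

/-- The integral operator `f ↦ ∫ A (P, z) (f (Φ (P, z))) dμ(z)`. -/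
def volterraOp (μ : Measure Z) (A : X × Z → F →L[ℝ] F) (Φ : X × Z → X) (f : X → F) (P : X) : F :=
  ∫ z, A (P, z) (f (Φ (P, z))) ∂μ

/-- Locally, the operator `volterraOp μ A Φ` acts on functions on a compact set and can be made a
contraction, with any prescribed factor, by a change of weight. -/
def IsVolterra (μ : Measure Z) (A : X × Z → F →L[ℝ] F) (Φ : X × Z → X) : Prop :=
  ∀ P₀ : X, ∃ K ∈ 𝓝 P₀, IsCompact K ∧
    (∃ C : Set Z, IsCompact C ∧
      ∀ᵐ z ∂μ, ∀ P ∈ K, (P, z) ∈ tsupport A → z ∈ C ∧ Φ (P, z) ∈ K) ∧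
    ∀ c : ℝ, 0 ≤ c → ∃ w : X → ℝ, Continuous w ∧ (∀ P, 0 < w P) ∧
      ∀ P ∈ K, c * ∫ z, ‖A (P, z)‖ * w (Φ (P, z)) ∂μ ≤ 1 / 2 * w P

theorem IsVolterra.fiberCompact {A : X × Z → F →L[ℝ] F} {Φ : X × Z → X}
    (h : IsVolterra μ A Φ) : FiberCompact μ A := by
  intro P₀
  obtain ⟨K, hK, -, ⟨C, hC, H⟩, -⟩ := h P₀
  refine ⟨K, hK, C, hC, H.mono fun z hz P hP hzC => ?_⟩
  by_contra h0
  exact hzC (hz P hP (subset_tsupport _ h0)).1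

theorem IsVolterra.fiberCompact_apply {A : X × Z → F →L[ℝ] F} {Φ : X × Z → X}
    (h : IsVolterra μ A Φ) (f : X → F) : FiberCompact μ fun p => A p (f (Φ p)) :=
  h.fiberCompact.mono fun p hp => by simp [hp]

theorem fiberDeriv_eq_zero {A : X × Z → F} {p : X × Z} (h : p ∉ tsupport A) :
    fiberDeriv A p = 0 := by
  have : fderiv ℝ A p = 0 := by
    by_contra h0
    exact h (support_fderiv_subset ℝ h0)
  simp [fiberDeriv, this]

/-- The weighted sup-norm estimate behind the contraction property. -/
theorem norm_integral_apply_le {A : X × Z → F →L[ℝ] F} {Φ : X × Z → X} (hA : Continuous A)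
    (hΦ : Continuous Φ) (hfc : FiberCompact μ A) {K : Set X}
    (hK : ∀ᵐ z ∂μ, ∀ P ∈ K, (P, z) ∈ tsupport A → Φ (P, z) ∈ K)
    {w : X → ℝ} (hw : Continuous w) {f : X → F} {e b : ℝ} (he : 0 ≤ e)
    (hfe : ∀ P ∈ K, ‖f P‖ ≤ e * w P) {P : X} (hP : P ∈ K)
    (hwb : ∫ z, ‖A (P, z)‖ * w (Φ (P, z)) ∂μ ≤ b) :
    ‖volterraOp μ A Φ f P‖ ≤ e * b := by
  have hi : Integrable (fun z => ‖A (P, z)‖ * w (Φ (P, z))) μ :=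
    FiberCompact.integrable (f := fun p => ‖A p‖ * w (Φ p)) (hA.norm.mul (hw.comp hΦ))
      (hfc.mono fun p hp => by simp [hp]) P
  calc ‖volterraOp μ A Φ f P‖ ≤ ∫ z, e * (‖A (P, z)‖ * w (Φ (P, z))) ∂μ := by
        refine norm_integral_le_of_norm_le (hi.const_mul e) ?_
        filter_upwards [hK] with z hz
        by_cases h0 : (P, z) ∈ tsupport A
        · calc _ ≤ ‖A (P, z)‖ * ‖f (Φ (P, z))‖ := (A (P, z)).le_opNorm _
            _ ≤ ‖A (P, z)‖ * (e * w (Φ (P, z))) := by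
              gcongr; exact hfe _ (hz P hP h0)
            _ = _ := by ring
        · simp [image_eq_zero_of_notMem_tsupport h0]
    _ = e * ∫ z, ‖A (P, z)‖ * w (Φ (P, z)) ∂μ := integral_const_mul _ _
    _ ≤ e * b := by gcongr

theorem volterraOp_sub {A : X × Z → F →L[ℝ] F} {Φ : X × Z → X} (hA : Continuous A)
    (hΦ : Continuous Φ) (h : IsVolterra μ A Φ) {f g : X → F} (hf : Continuous f)
    (hg : Continuous g) (P : X) :
    volterraOp μ A Φ (fun Q => f Q - g Q) P = volterraOp μ A Φ f P - volterraOp μ A Φ g P := by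
  unfold volterraOp
  rw [← integral_sub]
  · simp
  · exact (h.fiberCompact_apply f).integrable (hA.clm_apply (hf.comp hΦ)) P
  · exact (h.fiberCompact_apply g).integrable (hA.clm_apply (hg.comp hΦ)) P

theorem continuous_volterraOp {A : X × Z → F →L[ℝ] F} {Φ : X × Z → X} (hA : Continuous A)
    (hΦ : Continuous Φ) (h : IsVolterra μ A Φ) {f : X → F} (hf : Continuous f) :
    Continuous (volterraOp μ A Φ f) :=
  (h.fiberCompact_apply f).continuous_integral (hA.clm_apply (hf.comp hΦ))

theorem exists_weight_bound {G : Type} [NormedAddCommGroup G] {K : Set X} (hK : IsCompact K)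
    {w : X → ℝ} (hw : Continuous w) (hw0 : ∀ P, 0 < w P) {f : X → G} (hf : Continuous f) :
    ∃ e, 0 ≤ e ∧ ∀ P ∈ K, ‖f P‖ ≤ e * w P := by
  have hc : Continuous fun P => ‖f P‖ / w P := hf.norm.div hw fun P => (hw0 P).ne'
  obtain ⟨M, hM⟩ := hK.exists_bound_of_continuousOn hc.continuousOn
  refine ⟨max M 0, le_max_right _ _, fun P hP => ?_⟩
  have := hM P hP
  simp only [norm_div, Real.norm_eq_abs, abs_of_pos (hw0 P)] at this
  rw [div_le_iff₀ (hw0 P)] at this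
  exact ((le_abs_self _).trans this).trans
    (mul_le_mul_of_nonneg_right (le_max_left _ _) (hw0 P).le)

/-- Iterating the operator gains a factor `1/2` at each step, in the weighted norm. -/
theorem volterra_iterate_bound {A : X × Z → F →L[ℝ] F} {Φ : X × Z → X} (hA : Continuous A)
    (hΦ : Continuous Φ) (h : IsVolterra μ A Φ) {K : Set X}
    (hK : ∀ᵐ z ∂μ, ∀ P ∈ K, (P, z) ∈ tsupport A → Φ (P, z) ∈ K)
    {w : X → ℝ} (hw : Continuous w)
    (hwK : ∀ P ∈ K, ∫ z, ‖A (P, z)‖ * w (Φ (P, z)) ∂μ ≤ 1 / 2 * w P) {f : ℕ → X → F}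
    (hf : ∀ j, ∀ P ∈ K, f (j + 1) P = volterraOp μ A Φ (f j) P) {e : ℝ} (he : 0 ≤ e)
    (hfe : ∀ P ∈ K, ‖f 0 P‖ ≤ e * w P) (j : ℕ) :
    ∀ P ∈ K, ‖f j P‖ ≤ e * (1 / 2) ^ j * w P := by
  induction j with
  | zero => simpa using hfe
  | succ j ih =>
    intro P hP
    rw [hf j P hP]
    refine (norm_integral_apply_le hA hΦ h.fiberCompact hK hw (by positivity) ih hP
      (hwK P hP)).trans (le_of_eq ?_)
    ring

theorem IsVolterra.exists_local {A : X × Z → F →L[ℝ] F} {Φ : X × Z → X} (h : IsVolterra μ A Φ)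
    (P₀ : X) : ∃ K ∈ 𝓝 P₀, IsCompact K ∧
      (∀ᵐ z ∂μ, ∀ P ∈ K, (P, z) ∈ tsupport A → Φ (P, z) ∈ K) ∧
      ∃ w : X → ℝ, Continuous w ∧ (∀ P, 0 < w P) ∧
        ∀ P ∈ K, ∫ z, ‖A (P, z)‖ * w (Φ (P, z)) ∂μ ≤ 1 / 2 * w P := by
  obtain ⟨K, hK, hKc, ⟨C, hC, H⟩, hw⟩ := h P₀
  obtain ⟨w, hw1, hw2, hw3⟩ := hw 1 zero_le_one
  exact ⟨K, hK, hKc, H.mono fun z hz P hP h0 => (hz P hP h0).2, w, hw1, hw2,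
    by simpa using hw3⟩

/-- The Picard iterates of the equation `V = V₀ + volterraOp μ A Φ V`. -/
def picard (μ : Measure Z) (A : X × Z → F →L[ℝ] F) (Φ : X × Z → X) (V₀ : X → F) : ℕ → X → F
  | 0 => V₀
  | j + 1 => fun P => V₀ P + volterraOp μ A Φ (picard μ A Φ V₀ j) P

theorem continuous_picard {A : X × Z → F →L[ℝ] F} {Φ : X × Z → X} (hA : Continuous A)
    (hΦ : Continuous Φ) (h : IsVolterra μ A Φ) {V₀ : X → F} (hV₀ : Continuous V₀) (j : ℕ) :
    Continuous (picard μ A Φ V₀ j) := by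
  induction j with
  | zero => exact hV₀
  | succ j ih => exact hV₀.add (continuous_volterraOp hA hΦ h ih)

/-- The Picard iterates converge to any continuous solution, geometrically on compact sets. -/
theorem picard_bound {A : X × Z → F →L[ℝ] F} {Φ : X × Z → X} (hA : Continuous A)
    (hΦ : Continuous Φ) (h : IsVolterra μ A Φ) {K : Set X} (hKc : IsCompact K)
    (hK : ∀ᵐ z ∂μ, ∀ P ∈ K, (P, z) ∈ tsupport A → Φ (P, z) ∈ K)
    {w : X → ℝ} (hw : Continuous w) (hw0 : ∀ P, 0 < w P)
    (hwK : ∀ P ∈ K, ∫ z, ‖A (P, z)‖ * w (Φ (P, z)) ∂μ ≤ 1 / 2 * w P) {V₀ V : X → F}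
    (hV₀ : Continuous V₀) (hV : Continuous V) (hVeq : ∀ P, V P = V₀ P + volterraOp μ A Φ V P) :
    ∃ e, 0 ≤ e ∧ ∀ j, ∀ P ∈ K, ‖V P - picard μ A Φ V₀ j P‖ ≤ e * (1 / 2) ^ j * w P := by
  obtain ⟨e, he, hfe⟩ := exists_weight_bound hKc hw hw0 (hV.sub hV₀)
  refine ⟨e, he, fun j => volterra_iterate_bound hA hΦ h hK hw hwK
    (f := fun j P => V P - picard μ A Φ V₀ j P) (fun j P _ => ?_) he hfe j⟩
  rw [volterraOp_sub hA hΦ h hV (continuous_picard hA hΦ h hV₀ j), hVeq P]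
  simp [picard]

theorem tendsto_geometric (e : ℝ) : Tendsto (fun j : ℕ => e * (1 / 2 : ℝ) ^ j) atTop (𝓝 0) := by
  simpa using (tendsto_pow_atTop_nhds_zero_of_lt_one (r := (1 / 2 : ℝ)) (by norm_num)
    (by norm_num)).const_mul e

theorem tendsto_picard {A : X × Z → F →L[ℝ] F} {Φ : X × Z → X} (hA : Continuous A)
    (hΦ : Continuous Φ) (h : IsVolterra μ A Φ) {V₀ V : X → F}
    (hV₀ : Continuous V₀) (hV : Continuous V) (hVeq : ∀ P, V P = V₀ P + volterraOp μ A Φ V P)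
    (P : X) : Tendsto (fun j => picard μ A Φ V₀ j P) atTop (𝓝 (V P)) := by
  obtain ⟨K, hKn, hKc, hK, w, hw, hw0, hwK⟩ := h.exists_local P
  obtain ⟨e, he, hb⟩ := picard_bound hA hΦ h hKc hK hw hw0 hwK hV₀ hV hVeq
  rw [tendsto_iff_norm_sub_tendsto_zero]
  refine squeeze_zero (fun _ => norm_nonneg _)
    (fun j => (norm_sub_rev _ _).le.trans (hb j P (mem_of_mem_nhds hKn))) ?_
  simpa using (tendsto_geometric e).mul_const (w P)

theorem volterra_unique {A : X × Z → F →L[ℝ] F} {Φ : X × Z → X} (hA : Continuous A)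
    (hΦ : Continuous Φ) (h : IsVolterra μ A Φ) {V₀ V W : X → F}
    (hV₀ : Continuous V₀) (hV : Continuous V) (hVeq : ∀ P, V P = V₀ P + volterraOp μ A Φ V P)
    (hW : Continuous W) (hWeq : ∀ P, W P = V₀ P + volterraOp μ A Φ W P) : V = W :=
  funext fun P => tendsto_nhds_unique (tendsto_picard hA hΦ h hV₀ hV hVeq P)
    (tendsto_picard hA hΦ h hV₀ hW hWeq P)

/-- A solution vanishes on every set that its domain of dependence does not leave and on which the
inhomogeneity vanishes. -/
theorem volterra_eq_zero {A : X × Z → F →L[ℝ] F} {Φ : X × Z → X} (hA : Continuous A)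
    (hΦ : Continuous Φ) (h : IsVolterra μ A Φ) {V₀ V : X → F}
    (hV₀ : Continuous V₀) (hV : Continuous V) (hVeq : ∀ P, V P = V₀ P + volterraOp μ A Φ V P)
    {S : Set X} (hS : ∀ P ∈ S, ∀ z, Φ (P, z) ∈ S) (h0 : ∀ P ∈ S, V₀ P = 0) {P : X} (hP : P ∈ S) :
    V P = 0 := by
  have hj : ∀ j, ∀ P ∈ S, picard μ A Φ V₀ j P = 0 := by
    intro j
    induction j with
    | zero => exact h0
    | succ j ih =>
      intro P hP
      have : ∀ z, A (P, z) (picard μ A Φ V₀ j (Φ (P, z))) = 0 := fun z => by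
        rw [ih _ (hS P hP z), map_zero]
      simp [picard, h0 P hP, volterraOp, this]
  have h1 := tendsto_picard hA hΦ h hV₀ hV hVeq P
  simp only [hj _ P hP] at h1
  exact tendsto_nhds_unique h1 tendsto_const_nhds

/-- The Picard iterates converge locally uniformly, by the weighted contraction estimate. -/
theorem volterra_exists [CompleteSpace F] {A : X × Z → F →L[ℝ] F} {Φ : X × Z → X}
    (hA : Continuous A) (hΦ : Continuous Φ) (h : IsVolterra μ A Φ) {V₀ : X → F}
    (hV₀ : Continuous V₀) :
    ∃ V : X → F, Continuous V ∧ ∀ P, V P = V₀ P + volterraOp μ A Φ V P := by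
  set S := picard μ A Φ V₀ with hS
  have hSc := continuous_picard hA hΦ h hV₀
  have step : ∀ P₀, ∃ K ∈ 𝓝 P₀,
      (∀ᵐ z ∂μ, ∀ P ∈ K, (P, z) ∈ tsupport A → Φ (P, z) ∈ K) ∧
      ∃ w : X → ℝ, Continuous w ∧ (∀ P, 0 < w P) ∧
        (∀ P ∈ K, ∫ z, ‖A (P, z)‖ * w (Φ (P, z)) ∂μ ≤ 1 / 2 * w P) ∧
        (∃ M, ∀ P ∈ K, w P ≤ M) ∧
      ∃ e, 0 ≤ e ∧ ∀ j, ∀ P ∈ K, ‖S (j + 1) P - S j P‖ ≤ e * (1 / 2) ^ j * w P := by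
    intro P₀
    obtain ⟨K, hKn, hKc, hK, w, hw, hw0, hwK⟩ := h.exists_local P₀
    obtain ⟨M, hM⟩ := hKc.exists_bound_of_continuousOn hw.continuousOn
    obtain ⟨e, he, hfe⟩ := exists_weight_bound hKc hw hw0 ((hSc 1).sub (hSc 0))
    refine ⟨K, hKn, hK, w, hw, hw0, hwK, ⟨M, fun P hP => (le_abs_self _).trans (hM P hP)⟩, e, he,
      fun j => volterra_iterate_bound hA hΦ h hK hw hwK
      (f := fun j P => S (j + 1) P - S j P) (fun j P _ => ?_) he hfe j⟩
    rw [volterraOp_sub hA hΦ h (hSc _) (hSc _)]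
    simp [hS, picard]
  have hlim : ∀ P, ∃ v, Tendsto (fun j => S j P) atTop (𝓝 v) := by
    intro P
    obtain ⟨K, hKn, -, w, -, -, -, -, e, he, hb⟩ := step P
    refine cauchySeq_tendsto_of_complete (cauchySeq_of_le_geometric (1 / 2) (e * w P)
      (by norm_num) fun j => ?_)
    rw [dist_comm, dist_eq_norm]
    exact (hb j P (mem_of_mem_nhds hKn)).trans (le_of_eq (by ring))
  choose V hV using hlim
  have bound : ∀ P₀, ∃ K ∈ 𝓝 P₀,
      (∀ᵐ z ∂μ, ∀ P ∈ K, (P, z) ∈ tsupport A → Φ (P, z) ∈ K) ∧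
      ∃ w : X → ℝ, Continuous w ∧ (∀ P, 0 < w P) ∧
        (∀ P ∈ K, ∫ z, ‖A (P, z)‖ * w (Φ (P, z)) ∂μ ≤ 1 / 2 * w P) ∧
        (∃ M, ∀ P ∈ K, w P ≤ M) ∧
      ∃ e, 0 ≤ e ∧ ∀ j, ∀ P ∈ K, ‖V P - S j P‖ ≤ e * (1 / 2) ^ j * w P := by
    intro P₀
    obtain ⟨K, hKn, hK, w, hw, hw0, hwK, hM, e, he, hb⟩ := step P₀
    refine ⟨K, hKn, hK, w, hw, hw0, hwK, hM, 2 * e, by positivity, fun j P hP => ?_⟩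
    have := dist_le_of_le_geometric_of_tendsto (1 / 2) (e * w P) (by norm_num)
      (fun j => by
        rw [dist_comm, dist_eq_norm]
        exact (hb j P hP).trans (le_of_eq (by ring))) (hV P) j
    rw [dist_comm, dist_eq_norm] at this
    refine this.trans (le_of_eq ?_)
    ring
  have hVc : Continuous V := by
    refine TendstoLocallyUniformly.continuous (F := S) (p := atTop) ?_
      (Frequently.of_forall hSc)
    rw [Metric.tendstoLocallyUniformly_iff]
    intro ε hε P₀
    obtain ⟨K, hKn, -, w, -, hw0, -, ⟨M, hM⟩, e, he, hb⟩ := bound P₀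
    refine ⟨K, hKn, ?_⟩
    have := (tendsto_geometric e).mul_const M
    rw [zero_mul] at this
    filter_upwards [this.eventually_lt_const hε] with j hj P hP
    rw [dist_eq_norm]
    refine (hb j P hP).trans_lt (lt_of_le_of_lt ?_ hj)
    gcongr
    exact hM P hP
  refine ⟨V, hVc, fun P => ?_⟩
  obtain ⟨K, hKn, hK, w, hw, hw0, hwK, -, e, he, hb⟩ := bound P
  have h1 : Tendsto (fun j => volterraOp μ A Φ (S j) P) atTop (𝓝 (volterraOp μ A Φ V P)) := by
    have h0 := (tendsto_geometric e).mul_const (1 / 2 * w P)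
    rw [zero_mul] at h0
    rw [tendsto_iff_norm_sub_tendsto_zero]
    refine squeeze_zero (fun _ => norm_nonneg _) (fun j => ?_) h0
    rw [norm_sub_rev, ← volterraOp_sub hA hΦ h hVc (hSc j)]
    exact norm_integral_apply_le hA hΦ h.fiberCompact hK hw (by positivity) (hb j)
      (mem_of_mem_nhds hKn) (hwK P (mem_of_mem_nhds hKn))
  exact tendsto_nhds_unique ((hV P).comp (tendsto_add_atTop_nat 1)) (h1.const_add (V₀ P))

end Volterra

/-! ### Smooth dependence of the solution on the parameter -/

section VolterraSmooth

variable {X Z F : Type} [NormedAddCommGroup X] [NormedSpace ℝ X] [FiniteDimensional ℝ X]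
  [NormedAddCommGroup Z] [NormedSpace ℝ Z] [FiniteDimensional ℝ Z] [MeasurableSpace Z]
  [BorelSpace Z] {μ : Measure Z} [IsFiniteMeasureOnCompacts μ]
  [NormedAddCommGroup F] [NormedSpace ℝ F]

/-- The kernel of the integral equation satisfied by the derivative of a solution:
`L ↦ A ∘ L ∘ DΦ`. -/
def derivKernel (A : X × Z → F →L[ℝ] F) (Φ : X × Z → X) (p : X × Z) :
    (X →L[ℝ] F) →L[ℝ] (X →L[ℝ] F) :=
  (ContinuousLinearMap.compL ℝ X F F (A p)).comp
    ((ContinuousLinearMap.compL ℝ X X F).flip (fiberDeriv Φ p))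

theorem derivKernel_apply (A : X × Z → F →L[ℝ] F) (Φ : X × Z → X) (p : X × Z) (L : X →L[ℝ] F) :
    derivKernel A Φ p L = (A p).comp (L.comp (fiberDeriv Φ p)) := rfl

theorem norm_derivKernel_le (A : X × Z → F →L[ℝ] F) (Φ : X × Z → X) (p : X × Z) :
    ‖derivKernel A Φ p‖ ≤ ‖A p‖ * ‖fiberDeriv Φ p‖ := by
  refine ContinuousLinearMap.opNorm_le_bound _ (by positivity) fun L => ?_
  rw [derivKernel_apply]
  calc _ ≤ ‖A p‖ * (‖L‖ * ‖fiberDeriv Φ p‖) :=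
        ((A p).opNorm_comp_le _).trans (by gcongr; exact L.opNorm_comp_le _)
    _ = _ := by ring

theorem contDiff_derivKernel {A : X × Z → F →L[ℝ] F} {Φ : X × Z → X}
    (hA : ContDiff ℝ (⊤ : ℕ∞) A) (hΦ : ContDiff ℝ (⊤ : ℕ∞) Φ) :
    ContDiff ℝ (⊤ : ℕ∞) (derivKernel A Φ) :=
  ((ContinuousLinearMap.contDiff _).comp hA).clm_comp
    ((ContinuousLinearMap.contDiff _).comp (ContDiff.fiberDeriv hΦ (by simp)))

theorem tsupport_derivKernel (A : X × Z → F →L[ℝ] F) (Φ : X × Z → X) :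
    tsupport (derivKernel A Φ) ⊆ tsupport A := by
  refine closure_mono fun p hp h0 => hp ?_
  simp [derivKernel, h0]

theorem integral_norm_derivKernel_le {A : X × Z → F →L[ℝ] F} {Φ : X × Z → X}
    (hA : Continuous A) (hΦ : Continuous Φ) (hf : FiberCompact μ A) {w : X → ℝ}
    (hw : Continuous w) (hw0 : ∀ P, 0 < w P) {P : X} {M : ℝ}
    (hM : ∀ᵐ z ∂μ, (P, z) ∈ tsupport A → ‖fiberDeriv Φ (P, z)‖ ≤ M) :
    ∫ z, ‖derivKernel A Φ (P, z)‖ * w (Φ (P, z)) ∂μ ≤ M * ∫ z, ‖A (P, z)‖ * w (Φ (P, z)) ∂μ := by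
  rw [← integral_const_mul]
  have hi := FiberCompact.integrable (μ := μ) (f := fun p => M * (‖A p‖ * w (Φ p)))
    (continuous_const.mul (hA.norm.mul (hw.comp hΦ))) (hf.mono fun p hp => by simp [hp]) P
  refine integral_mono_of_nonneg (Eventually.of_forall fun z => ?_) hi ?_
  · have := (hw0 (Φ (P, z))).le
    positivity
  · filter_upwards [hM] with z hz
    by_cases h0 : (P, z) ∈ tsupport A
    · calc _ ≤ (‖A (P, z)‖ * ‖fiberDeriv Φ (P, z)‖) * w (Φ (P, z)) := by
            gcongr
            · exact (hw0 _).le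
            · exact norm_derivKernel_le A Φ _
        _ ≤ (‖A (P, z)‖ * M) * w (Φ (P, z)) := by
            gcongr
            · exact (hw0 _).le
            · exact hz h0
        _ = _ := by ring
    · have h1 : A (P, z) = 0 := image_eq_zero_of_notMem_tsupport h0
      calc _ ≤ (‖A (P, z)‖ * ‖fiberDeriv Φ (P, z)‖) * w (Φ (P, z)) := by
            gcongr
            · exact (hw0 _).le
            · exact norm_derivKernel_le A Φ _
        _ = _ := by simp [h1]

/-- The Volterra condition passes to the differentiated equation: `DΦ` is bounded on the compact set
in question, and the bound is absorbed in the factor `c`. -/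
theorem IsVolterra.derivKernel {A : X × Z → F →L[ℝ] F} {Φ : X × Z → X} (h : IsVolterra μ A Φ)
    (hA : ContDiff ℝ (⊤ : ℕ∞) A) (hΦ : ContDiff ℝ (⊤ : ℕ∞) Φ) :
    IsVolterra μ (derivKernel A Φ) Φ := by
  intro P₀
  obtain ⟨K, hK, hKc, ⟨C, hC, H⟩, hw⟩ := h P₀
  refine ⟨K, hK, hKc, ⟨C, hC, H.mono fun z hz P hP h0 =>
    hz P hP (tsupport_derivKernel A Φ h0)⟩, fun c hc => ?_⟩
  have hd : Continuous (fiberDeriv Φ) := (ContDiff.fiberDeriv hΦ (m := 0) (by simp)).continuous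
  obtain ⟨M, hM⟩ := (hKc.prod hC).exists_bound_of_continuousOn hd.continuousOn
  obtain ⟨w, hwc, hw0, hwb⟩ := hw (c * |M|) (by positivity)
  refine ⟨w, hwc, hw0, fun P hP => le_trans ?_ (hwb P hP)⟩
  rw [mul_assoc]
  gcongr
  exact integral_norm_derivKernel_le hA.continuous hΦ.continuous h.fiberCompact hwc hw0
    (H.mono fun z hz h0 => (hM (P, z) ⟨hP, (hz P hP h0).1⟩).trans (le_abs_self M))

/-- The part of the derivative of `volterraOp μ A Φ f` in which the kernel is differentiated. -/
def kernelDeriv (μ : Measure Z) (A : X × Z → F →L[ℝ] F) (Φ : X × Z → X) (f : X → F) (P : X) :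
    X →L[ℝ] F :=
  ∫ z, (fiberDeriv A (P, z)).flip (f (Φ (P, z))) ∂μ

theorem contDiff_flip_apply {A : X × Z → F →L[ℝ] F} {Φ : X × Z → X}
    (hA : ContDiff ℝ (⊤ : ℕ∞) A) (hΦ : ContDiff ℝ (⊤ : ℕ∞) Φ) {f : X → F} {n : ℕ}
    (hf : ContDiff ℝ n f) : ContDiff ℝ n fun p => (fiberDeriv A p).flip (f (Φ p)) := by
  have h1 : ContDiff ℝ (⊤ : ℕ∞) (fiberDeriv A) := ContDiff.fiberDeriv hA (by simp)
  have h2 : ContDiff ℝ n fun p => (fiberDeriv A p).flip :=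
    ContDiff.comp (g := fun T : X →L[ℝ] F →L[ℝ] F => T.flip)
      (IsLinearMap.with_bound ⟨fun _ _ => rfl, fun _ _ => rfl⟩ 1 fun T => by
        rw [ContinuousLinearMap.opNorm_flip, one_mul]).contDiff (contDiff_infty.1 h1 n)
  exact h2.clm_apply (hf.comp (contDiff_infty.1 hΦ n))

theorem fiberCompact_flip_apply {A : X × Z → F →L[ℝ] F} {Φ : X × Z → X}
    (hA : ContDiff ℝ (⊤ : ℕ∞) A) (h : FiberCompact μ A) (f : X → F) :
    FiberCompact μ fun p => (fiberDeriv A p).flip (f (Φ p)) :=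
  (FiberCompact.fiberDeriv (hA.differentiable (by simp)) h).mono fun p hp => by
    rw [hp]; ext; simp

theorem contDiff_kernelDeriv {A : X × Z → F →L[ℝ] F} {Φ : X × Z → X}
    (hA : ContDiff ℝ (⊤ : ℕ∞) A) (hΦ : ContDiff ℝ (⊤ : ℕ∞) Φ) (h : FiberCompact μ A)
    {f : X → F} {n : ℕ} (hf : ContDiff ℝ n f) : ContDiff ℝ n (kernelDeriv μ A Φ f) :=
  (fiberCompact_flip_apply hA h f).contDiff_integral_nat n (contDiff_flip_apply hA hΦ hf)

theorem hasFDerivAt_volterraOp {A : X × Z → F →L[ℝ] F} {Φ : X × Z → X}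
    (hA : ContDiff ℝ (⊤ : ℕ∞) A) (hΦ : ContDiff ℝ (⊤ : ℕ∞) Φ) (h : IsVolterra μ A Φ)
    {f : X → F} (hf : ContDiff ℝ 1 f) (P : X) :
    HasFDerivAt (volterraOp μ A Φ f)
      (kernelDeriv μ A Φ f P + volterraOp μ (derivKernel A Φ) Φ (fderiv ℝ f) P) P := by
  have hdA := hA.differentiable (by simp)
  have hdΦ := hΦ.differentiable (by simp)
  have hdf := hf.differentiable one_ne_zero
  have key : ∀ p : X × Z, fiberDeriv (fun p => A p (f (Φ p))) p =
      (fiberDeriv A p).flip (f (Φ p)) + derivKernel A Φ p (fderiv ℝ f (Φ p)) := by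
    rintro ⟨P, z⟩
    have hd : Differentiable ℝ fun p : X × Z => A p (f (Φ p)) :=
      hdA.clm_apply (hdf.comp hdΦ)
    refine (hasFDerivAt_fiberDeriv hd P z).unique ?_
    have h1 := (hasFDerivAt_fiberDeriv hdA P z).clm_apply
      ((hdf (Φ (P, z))).hasFDerivAt.comp P (hasFDerivAt_fiberDeriv hdΦ P z))
    refine h1.congr_fderiv ?_
    ext v
    simp [derivKernel_apply, add_comm]
  have hI := (h.fiberCompact_apply f).hasFDerivAt_integral
    (((hA.of_le (by simp)).clm_apply (hf.comp (hΦ.of_le (by simp)))) :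
      ContDiff ℝ 1 fun p => A p (f (Φ p))) P
  refine hI.congr_fderiv ?_
  simp_rw [key]
  rw [integral_add]
  · rfl
  · refine (fiberCompact_flip_apply hA h.fiberCompact f).integrable ?_ P
    exact (contDiff_flip_apply hA hΦ (n := 0) (hf.of_le (by simp))).continuous
  · refine ((h.derivKernel hA hΦ).fiberCompact_apply _).integrable ?_ P
    exact (contDiff_derivKernel hA hΦ).continuous.clm_apply
      ((hf.continuous_fderiv one_ne_zero).comp hΦ.continuous)

theorem contDiff_picard {A : X × Z → F →L[ℝ] F} {Φ : X × Z → X}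
    (hA : ContDiff ℝ (⊤ : ℕ∞) A) (hΦ : ContDiff ℝ (⊤ : ℕ∞) Φ) (h : IsVolterra μ A Φ)
    {V₀ : X → F} (hV₀ : ContDiff ℝ 1 V₀) (j : ℕ) : ContDiff ℝ 1 (picard μ A Φ V₀ j) := by
  induction j with
  | zero => exact hV₀
  | succ j ih =>
    exact hV₀.add ((h.fiberCompact_apply _).contDiff_integral_nat 1
      ((hA.of_le (by simp)).clm_apply (ih.comp (hΦ.of_le (by simp)))))

/-- The solution is differentiable, with derivative the solution `V'` of the formally
differentiated equation, because the derivatives of the Picard iterates converge to `V'`. -/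
theorem volterra_hasFDerivAt {A : X × Z → F →L[ℝ] F} {Φ : X × Z → X}
    (hA : ContDiff ℝ (⊤ : ℕ∞) A) (hΦ : ContDiff ℝ (⊤ : ℕ∞) Φ) (h : IsVolterra μ A Φ)
    {V₀ V : X → F} {V' : X → X →L[ℝ] F} (hV₀ : ContDiff ℝ 1 V₀) (hV : Continuous V)
    (hVeq : ∀ P, V P = V₀ P + volterraOp μ A Φ V P) (hV' : Continuous V')
    (hV'eq : ∀ P, V' P = (fderiv ℝ V₀ P + kernelDeriv μ A Φ V P) +
      volterraOp μ (derivKernel A Φ) Φ V' P) (P₀ : X) : HasFDerivAt V (V' P₀) P₀ := by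
  have hAc := hA.continuous
  have hΦc := hΦ.continuous
  have h' := h.derivKernel hA hΦ
  have hA'c := (contDiff_derivKernel hA hΦ).continuous
  set S := picard μ A Φ V₀ with hS
  have hSd : ∀ j, ContDiff ℝ 1 (S j) := contDiff_picard hA hΦ h hV₀
  have hSc := fun j => (hSd j).continuous
  have hSd' := fun j => (hSd j).continuous_fderiv one_ne_zero
  -- a weight that makes both the operator and its differentiated version contractions
  obtain ⟨K, hKn, hKc, ⟨C, hC, H⟩, hw⟩ := h P₀
  have hdΦ : Continuous (fiberDeriv Φ) := (ContDiff.fiberDeriv hΦ (m := 0) (by simp)).continuous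
  obtain ⟨M, hM⟩ := (hKc.prod hC).exists_bound_of_continuousOn hdΦ.continuousOn
  obtain ⟨w, hwc, hw0, hwb⟩ := hw (1 + |M|) (by positivity)
  have hKm : ∀ᵐ z ∂μ, ∀ P ∈ K, (P, z) ∈ tsupport A → Φ (P, z) ∈ K :=
    H.mono fun z hz P hP h0 => (hz P hP h0).2
  have hint0 : ∀ P, 0 ≤ ∫ z, ‖A (P, z)‖ * w (Φ (P, z)) ∂μ := fun P =>
    integral_nonneg fun z => mul_nonneg (norm_nonneg _) (hw0 _).le
  have hwA : ∀ P ∈ K, ∫ z, ‖A (P, z)‖ * w (Φ (P, z)) ∂μ ≤ 1 / 2 * w P := fun P hP =>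
    le_trans (by nlinarith [hint0 P, abs_nonneg M]) (hwb P hP)
  have hwA' : ∀ P ∈ K, ∫ z, ‖derivKernel A Φ (P, z)‖ * w (Φ (P, z)) ∂μ ≤ 1 / 2 * w P := by
    intro P hP
    refine le_trans ?_ (hwb P hP)
    exact integral_norm_derivKernel_le hAc hΦc h.fiberCompact hwc hw0
      (H.mono fun z hz h0 => (hM (P, z) ⟨hP, (hz P hP h0).1⟩).trans
        (by linarith [le_abs_self M]))
  obtain ⟨e, he, hb⟩ := picard_bound hAc hΦc h hKc hKm hwc hw0 hwA hV₀.continuous hV hVeq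
  -- the term in which the kernel is differentiated
  have hDc : Continuous (fiberDeriv A) := (ContDiff.fiberDeriv hA (m := 0) (by simp)).continuous
  have hDfc : FiberCompact μ (fiberDeriv A) :=
    FiberCompact.fiberDeriv (hA.differentiable (by simp)) h.fiberCompact
  have hcI : Continuous fun P => ∫ z, ‖fiberDeriv A (P, z)‖ * w (Φ (P, z)) ∂μ :=
    FiberCompact.continuous_integral (f := fun p => ‖fiberDeriv A p‖ * w (Φ p))
      (hDc.norm.mul (hwc.comp hΦc)) (hDfc.mono fun p hp => by simp [hp])
  obtain ⟨N, hN, hNb⟩ := exists_weight_bound hKc hwc hw0 hcI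
  have hkd : ∀ j, ∀ P ∈ K, ‖kernelDeriv μ A Φ V P - kernelDeriv μ A Φ (S j) P‖ ≤
      e * (1 / 2) ^ j * (N * w P) := by
    intro j P hP
    have hiV : ∀ f : X → F, Continuous f →
        Integrable (fun z => (fiberDeriv A (P, z)).flip (f (Φ (P, z)))) μ := fun f hf =>
      (fiberCompact_flip_apply hA h.fiberCompact f).integrable
        (contDiff_flip_apply hA hΦ (n := 0) (contDiff_zero.2 hf)).continuous P
    rw [kernelDeriv, kernelDeriv, ← integral_sub (hiV V hV) (hiV _ (hSc j))]
    have hi : Integrable (fun z => ‖fiberDeriv A (P, z)‖ * w (Φ (P, z))) μ :=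
      FiberCompact.integrable (f := fun p => ‖fiberDeriv A p‖ * w (Φ p))
        (hDc.norm.mul (hwc.comp hΦc)) (hDfc.mono fun p hp => by simp [hp]) P
    calc _ ≤ ∫ z, e * (1 / 2) ^ j * (‖fiberDeriv A (P, z)‖ * w (Φ (P, z))) ∂μ := by
          refine norm_integral_le_of_norm_le (hi.const_mul _) ?_
          filter_upwards [hKm] with z hz
          rw [← map_sub]
          by_cases h0 : (P, z) ∈ tsupport A
          · calc _ ≤ ‖(fiberDeriv A (P, z)).flip‖ * ‖V (Φ (P, z)) - S j (Φ (P, z))‖ :=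
                  ContinuousLinearMap.le_opNorm _ _
              _ ≤ ‖fiberDeriv A (P, z)‖ * (e * (1 / 2) ^ j * w (Φ (P, z))) := by
                  rw [ContinuousLinearMap.opNorm_flip]
                  gcongr
                  exact hb j _ (hz P hP h0)
              _ = _ := by ring
          · rw [fiberDeriv_eq_zero h0]
            simp
      _ = e * (1 / 2) ^ j * ∫ z, ‖fiberDeriv A (P, z)‖ * w (Φ (P, z)) ∂μ :=
          integral_const_mul _ _
      _ ≤ _ := by
          gcongr
          exact (le_abs_self _).trans (hNb P hP)
  have hfS : ∀ j P, fderiv ℝ (S (j + 1)) P = (fderiv ℝ V₀ P + kernelDeriv μ A Φ (S j) P) +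
      volterraOp μ (derivKernel A Φ) Φ (fderiv ℝ (S j)) P := by
    intro j P
    rw [add_assoc]
    exact ((hV₀.differentiable one_ne_zero P).hasFDerivAt.add
      (hasFDerivAt_volterraOp hA hΦ h (hSd j) P)).fderiv
  obtain ⟨e', he', hb0⟩ := exists_weight_bound hKc hwc hw0 (hV'.sub (hSd' 0))
  have hbd : ∀ j : ℕ, ∀ P ∈ K, ‖V' P - fderiv ℝ (S j) P‖ ≤
      (e' + 2 * j * (e * N)) * (1 / 2) ^ j * w P := by
    intro j
    induction j with
    | zero => simpa using hb0
    | succ j ih =>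
      intro P hP
      have h1 : V' P - fderiv ℝ (S (j + 1)) P =
          (kernelDeriv μ A Φ V P - kernelDeriv μ A Φ (S j) P) +
          volterraOp μ (derivKernel A Φ) Φ (fun Q => V' Q - fderiv ℝ (S j) Q) P := by
        rw [volterraOp_sub hA'c hΦc h' hV' (hSd' j), hV'eq P, hfS]
        abel
      rw [h1]
      refine (norm_add_le _ _).trans ((add_le_add (hkd j P hP)
        (norm_integral_apply_le hA'c hΦc h'.fiberCompact (hKm.mono fun z hz P hP h0 =>
          hz P hP (tsupport_derivKernel A Φ h0)) hwc (by positivity) ih hP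
          (hwA' P hP))).trans (le_of_eq ?_))
      push_cast
      ring
  obtain ⟨B, hB⟩ := hKc.exists_bound_of_continuousOn hwc.continuousOn
  have hlim : Tendsto (fun j : ℕ => (e' + 2 * j * (e * N)) * (1 / 2 : ℝ) ^ j * B) atTop
      (𝓝 0) := by
    have h1 := (tendsto_geometric e').mul_const B
    have h2 := (tendsto_self_mul_const_pow_of_lt_one (r := (1 / 2 : ℝ)) (by norm_num)
      (by norm_num)).mul_const (2 * (e * N) * B)
    rw [zero_mul] at h1 h2
    have h3 := h1.add h2
    rw [add_zero] at h3
    refine h3.congr fun j => ?_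
    ring
  refine hasFDerivAt_of_tendstoUniformlyOn (f := S) (l := atTop) isOpen_interior (s := interior K)
    (f' := fun j => fderiv ℝ (S j)) (g' := V') ?_
    (fun j P _ => ((hSd j).differentiable one_ne_zero P).hasFDerivAt) ?_
    (mem_interior_iff_mem_nhds.2 hKn)
  · rw [Metric.tendstoUniformlyOn_iff]
    intro ε hε
    filter_upwards [hlim.eventually_lt_const hε] with j hj P hP
    rw [dist_eq_norm]
    refine (hbd j P (interior_subset hP)).trans_lt (lt_of_le_of_lt ?_ hj)
    gcongr
    exact (le_abs_self _).trans (hB P (interior_subset hP))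
  · intro P hP
    rw [tendsto_iff_norm_sub_tendsto_zero]
    refine squeeze_zero (fun _ => norm_nonneg _)
      (fun j => (norm_sub_rev _ _).le.trans (hb j P (interior_subset hP))) ?_
    simpa using (tendsto_geometric e).mul_const (w P)

/-- Induction on `n`, for all target spaces at once: the derivative of a solution solves an equation
of the same type. -/
theorem volterra_contDiff_nat [CompleteSpace F] {A : X × Z → F →L[ℝ] F} {Φ : X × Z → X}
    (hA : ContDiff ℝ (⊤ : ℕ∞) A) (hΦ : ContDiff ℝ (⊤ : ℕ∞) Φ) (h : IsVolterra μ A Φ) (n : ℕ)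
    {V₀ V : X → F} (hV₀ : ContDiff ℝ n V₀) (hV : Continuous V)
    (hVeq : ∀ P, V P = V₀ P + volterraOp μ A Φ V P) : ContDiff ℝ n V := by
  induction n generalizing F with
  | zero => exact contDiff_zero.2 hV
  | succ n ih =>
    have hVn : ContDiff ℝ n V := ih hA h (hV₀.of_le (by exact_mod_cast n.le_succ)) hV hVeq
    have hW : ContDiff ℝ n fun P => fderiv ℝ V₀ P + kernelDeriv μ A Φ V P :=
      (hV₀.fderiv_right (by simp)).add (contDiff_kernelDeriv hA hΦ h.fiberCompact hVn)
    have hA' := contDiff_derivKernel hA hΦ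
    have h' := h.derivKernel hA hΦ
    obtain ⟨V', hV', hV'eq⟩ := volterra_exists hA'.continuous hΦ.continuous h' hW.continuous
    have key := volterra_hasFDerivAt hA hΦ h
      (hV₀.of_le (by exact_mod_cast Nat.le_add_left 1 n)) hV hVeq hV' hV'eq
    push_cast
    refine contDiff_succ_iff_fderiv.2 ⟨fun P => (key P).differentiableAt, by simp, ?_⟩
    rw [show fderiv ℝ V = V' from funext fun P => (key P).fderiv]
    exact ih hA' h' hW hV' hV'eq

/-- A linear integral equation of Volterra type with smooth data has a smooth solution. -/
theorem volterra_exists_contDiff [CompleteSpace F] {A : X × Z → F →L[ℝ] F} {Φ : X × Z → X}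
    (hA : ContDiff ℝ (⊤ : ℕ∞) A) (hΦ : ContDiff ℝ (⊤ : ℕ∞) Φ) (h : IsVolterra μ A Φ)
    {V₀ : X → F} (hV₀ : ContDiff ℝ (⊤ : ℕ∞) V₀) :
    ∃ V : X → F, ContDiff ℝ (⊤ : ℕ∞) V ∧ ∀ P, V P = V₀ P + volterraOp μ A Φ V P := by
  obtain ⟨V, hV, hVeq⟩ := volterra_exists hA.continuous hΦ.continuous h hV₀.continuous
  exact ⟨V, contDiff_infty.2 fun n => volterra_contDiff_nat hA hΦ h n (contDiff_infty.1 hV₀ n) hV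
    hVeq, hVeq⟩

end VolterraSmooth

/-! ### Orthonormal frames, planes and the measure `dz / |z|` -/

/-- The Euclidean plane, used to parametrize the planes orthogonal to a direction. -/
abbrev E2 : Type := EuclideanSpace ℝ (Fin 2)

/-- The vector `ω` is a unit vector and `J` maps the Euclidean plane isometrically into `ω^⊥`. -/
structure IsFrame (ω : E3) (J : E2 →ₗᵢ[ℝ] E3) : Prop where
  norm_eq : ‖ω‖ = 1
  orth : ∀ ζ, ⟪J ζ, ω⟫_ℝ = 0

theorem exists_isFrame {ω : E3} (hω : ‖ω‖ = 1) : ∃ J, IsFrame ω J := by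
  have h0 : ω ≠ 0 := by rintro rfl; simp at hω
  have : Fact (Module.finrank ℝ E3 = 2 + 1) := ⟨by simp⟩
  have h2 : Module.finrank ℝ (ℝ ∙ ω)ᗮ = 2 := Submodule.finrank_orthogonal_span_singleton h0
  let e : E2 ≃ₗᵢ[ℝ] (ℝ ∙ ω)ᗮ := ((stdOrthonormalBasis ℝ (ℝ ∙ ω)ᗮ).reindex
    (finCongr h2)).repr.symm
  refine ⟨(ℝ ∙ ω)ᗮ.subtypeₗᵢ.comp e.toLinearIsometry, hω, fun ζ => ?_⟩
  rw [real_inner_comm]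
  exact Submodule.mem_orthogonal_singleton_iff_inner_right.1 (e ζ).2

namespace IsFrame

variable {ω : E3} {J : E2 →ₗᵢ[ℝ] E3} (hJ : IsFrame ω J)
include hJ

theorem inner_self : ⟪ω, ω⟫_ℝ = 1 := by
  rw [real_inner_self_eq_norm_sq, hJ.norm_eq, one_pow]

theorem inner_add (ζ : E2) (h : ℝ) : ⟪J ζ + h • ω, ω⟫_ℝ = h := by
  rw [_root_.inner_add_left, hJ.orth, inner_smul_left, hJ.inner_self]
  simp

theorem norm_sq_add (ζ : E2) (h : ℝ) : ‖J ζ + h • ω‖ ^ 2 = ‖ζ‖ ^ 2 + h ^ 2 := by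
  rw [norm_add_sq_real, inner_smul_right, hJ.orth, J.norm_map, norm_smul, hJ.norm_eq]
  simp

/-- Orthogonal coordinates adapted to the direction `ω`. -/
def equiv : WithLp 2 (E2 × ℝ) ≃ₗᵢ[ℝ] E3 :=
  LinearIsometry.toLinearIsometryEquiv
    { toFun := fun p => J p.fst + p.snd • ω
      map_add' := fun p q => by simp [add_smul]; abel
      map_smul' := fun c p => by simp [mul_smul]
      norm_map' := fun p => by
        have h1 : ‖J p.fst + p.snd • ω‖ ^ 2 = ‖p‖ ^ 2 := by
          rw [hJ.norm_sq_add, WithLp.prod_norm_sq_eq_of_L2]; simp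
        exact (sq_eq_sq₀ (norm_nonneg _) (norm_nonneg _)).1 h1 }
    (by rw [(WithLp.linearEquiv 2 ℝ (E2 × ℝ)).finrank_eq]; simp)

theorem measurePreserving :
    MeasurePreserving (fun p : E2 × ℝ => J p.1 + p.2 • ω) volume volume :=
  (hJ.equiv.measurePreserving).comp (WithLp.volume_preserving_toLp E2 ℝ)

theorem measurableEmbedding :
    MeasurableEmbedding (fun p : E2 × ℝ => J p.1 + p.2 • ω) :=
  ((WithLp.homeomorphProd 2 E2 ℝ).symm.trans hJ.equiv.toHomeomorph).measurableEmbedding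

theorem integral_eq (f : E3 → ℝ) : ∫ x, f x = ∫ p : E2 × ℝ, f (J p.1 + p.2 • ω) :=
  (hJ.measurePreserving.integral_comp hJ.measurableEmbedding f).symm

theorem exists_eq (x : E3) : ∃ η : E2, x = J η + ⟪x, ω⟫_ℝ • ω := by
  obtain ⟨p, rfl⟩ := hJ.equiv.surjective x
  refine ⟨p.fst, ?_⟩
  change J p.fst + p.snd • ω = J p.fst + ⟪J p.fst + p.snd • ω, ω⟫_ℝ • ω
  rw [hJ.inner_add]

theorem plane_eq_range (τ : ℝ) : {x : E3 | ⟪x, ω⟫_ℝ = τ} = range fun ζ : E2 => J ζ + τ • ω := by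
  ext x
  constructor
  · rintro rfl
    obtain ⟨η, hη⟩ := hJ.exists_eq x
    exact ⟨η, hη.symm⟩
  · rintro ⟨η, rfl⟩
    exact hJ.inner_add η τ

theorem map_plane (τ : ℝ) : Measure.map (fun ζ : E2 => J ζ + τ • ω) volume =
    (μHE[2] : Measure E3).restrict {x : E3 | ⟪x, ω⟫_ℝ = τ} := by
  have h1 : Isometry fun ζ : E2 => J ζ + τ • ω := by
    have := (IsometryEquiv.addRight (τ • ω)).isometry.comp J.isometry
    exact this
  rw [hJ.plane_eq_range, ← h1.map_euclideanHausdorffMeasure,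
    EuclideanSpace.euclideanHausdorffMeasure_eq_volume]

theorem measurableEmbedding_plane (τ : ℝ) : MeasurableEmbedding fun ζ : E2 => J ζ + τ • ω := by
  have h1 : Isometry fun ζ : E2 => J ζ + τ • ω :=
    (IsometryEquiv.addRight (τ • ω)).isometry.comp J.isometry
  exact h1.isClosedEmbedding.measurableEmbedding

theorem planeIntegral_eq (τ : ℝ) (f : E3 → ℝ) :
    planeIntegral ω τ f = ∫ ζ : E2, f (J ζ + τ • ω) := by
  rw [planeIntegral, ← hJ.map_plane τ, (hJ.measurableEmbedding_plane τ).integral_map]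

theorem integrableOn_plane_iff (τ : ℝ) (f : E3 → ℝ) :
    IntegrableOn f {x : E3 | ⟪x, ω⟫_ℝ = τ} μHE[2] ↔
      Integrable fun ζ : E2 => f (J ζ + τ • ω) := by
  rw [IntegrableOn, ← hJ.map_plane τ, (hJ.measurableEmbedding_plane τ).integrable_map_iff]
  rfl

/-- Integration over the plane `ω^⊥`, written as a weighted integral over the whole space. -/
theorem integral_mul_inner (F : E3 → ℝ) (ρ : ℝ → ℝ) :
    ∫ ξ : E3, F (ξ - ⟪ξ, ω⟫_ℝ • ω) * ρ ⟪ξ, ω⟫_ℝ = (∫ ζ : E2, F (J ζ)) * ∫ h, ρ h := by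
  rw [hJ.integral_eq, ← integral_prod_mul]
  refine integral_congr_ae (Eventually.of_forall fun p => ?_)
  simp only
  rw [hJ.inner_add]
  simp

end IsFrame

/-- The measure `dz / |z|` on three-dimensional space. -/
def newton : Measure E3 := volume.withDensity fun z => ENNReal.ofReal ‖z‖⁻¹

instance : SigmaFinite newton := by
  unfold newton
  exact SigmaFinite.withDensity_ofReal _

theorem lintegral_newton {g : E3 → ENNReal} (hg : Measurable g) :
    ∫⁻ z, g z ∂newton = ∫⁻ z, ENNReal.ofReal ‖z‖⁻¹ * g z := by
  rw [newton, lintegral_withDensity_eq_lintegral_mul _ (by fun_prop) hg]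
  rfl

instance : newton.IsNegInvariant := by
  refine ⟨Measure.ext_of_lintegral _ fun g hg => ?_⟩
  rw [Measure.neg, lintegral_map hg measurable_neg, lintegral_newton hg,
    lintegral_newton (g := fun z => g (-z)) (hg.comp measurable_neg), ← lintegral_neg_eq_self]
  simp

/-- Paraboloid coordinates: the point of the paraboloid `|z| + z · ω = a` whose projection to the
plane `ω^⊥` is `√a ζ`. -/
def parab (ω : E3) (J : E2 →ₗᵢ[ℝ] E3) (p : ℝ × E2) : E3 :=
  √p.1 • J p.2 + ((p.1 - ‖p.2‖ ^ 2) / 2) • ω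

@[fun_prop]
theorem continuous_parab (ω : E3) (J : E2 →ₗᵢ[ℝ] E3) : Continuous (parab ω J) := by
  unfold parab
  have := J.continuous
  fun_prop

/-- Polar coordinates in the plane: `|ζ|²` has the distribution `π db` on the half-line. -/
theorem integral_radial (F : ℝ → ℝ) :
    ∫ ζ : E2, F (‖ζ‖ ^ 2) = Real.pi * ∫ b in Ioi (0 : ℝ), F b := by
  rw [integral_fun_norm_addHaar volume fun r => F (r ^ 2)]
  have h1 := integral_comp_rpow_Ioi F (p := 2) (by norm_num)
  rw [← h1]
  have h2 : (volume : Measure E2).real (Metric.ball 0 1) = Real.pi := by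
    rw [Measure.real, EuclideanSpace.volume_ball_fin_two]
    simp [Real.pi_pos.le]
  rw [h2]
  simp only [finrank_euclideanSpace, Fintype.card_fin, nsmul_eq_mul, smul_eq_mul]
  rw [← integral_const_mul, ← integral_const_mul, ← integral_const_mul]
  refine setIntegral_congr_fun measurableSet_Ioi fun y hy => ?_
  simp
  norm_num
  ring

namespace IsFrame

variable {ω : E3} {J : E2 →ₗᵢ[ℝ] E3} (hJ : IsFrame ω J)
include hJ

theorem inner_parab (a : ℝ) (ζ : E2) : ⟪parab ω J (a, ζ), ω⟫_ℝ = (a - ‖ζ‖ ^ 2) / 2 := by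
  rw [parab, ← map_smul, hJ.inner_add]

theorem norm_parab {a : ℝ} (ha : 0 ≤ a) (ζ : E2) : ‖parab ω J (a, ζ)‖ = (a + ‖ζ‖ ^ 2) / 2 := by
  refine (sq_eq_sq₀ (norm_nonneg _) (by positivity)).1 ?_
  rw [parab, ← map_smul, hJ.norm_sq_add, norm_smul, Real.norm_eq_abs, mul_pow, sq_abs,
    Real.sq_sqrt ha]
  ring

end IsFrame

/-! ### Paraboloid coordinates -/

/-- Lebesgue measure on the half-space `a > 0` of the coordinate space `ℝ × E2`. -/
def halfSpace : Measure (ℝ × E2) := (volume.restrict (Ioi (0 : ℝ))).prod volume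

instance : IsFiniteMeasureOnCompacts halfSpace := by
  unfold halfSpace; infer_instance

/-- On a vertical line at distance `√s` from the axis, the point of the paraboloid with parameter `a`
has height `(a - s / a) / 2`; every point of the line is reached. -/
theorem image_height {s : ℝ} (hs : 0 < s) : (fun a : ℝ => (a - s / a) / 2) '' Ioi 0 = univ := by
  refine eq_univ_of_forall fun h => ⟨h + √(h ^ 2 + s), ?_, ?_⟩
  · have h1 : |h| < √(h ^ 2 + s) := by
      rw [← Real.sqrt_sq_eq_abs]
      exact Real.sqrt_lt_sqrt (sq_nonneg h) (by linarith)
    have := neg_abs_le h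
    simp only [mem_Ioi]
    linarith
  · have h1 : |h| < √(h ^ 2 + s) := by
      rw [← Real.sqrt_sq_eq_abs]
      exact Real.sqrt_lt_sqrt (sq_nonneg h) (by linarith)
    have h2 : 0 < h + √(h ^ 2 + s) := by linarith [neg_abs_le h]
    have h3 : √(h ^ 2 + s) ^ 2 = h ^ 2 + s := Real.sq_sqrt (by positivity)
    simp only
    rw [div_eq_iff two_ne_zero, sub_eq_iff_eq_add, ← sub_eq_iff_eq_add', eq_div_iff h2.ne']
    nlinarith

/-- Integration along a vertical line at distance `√s` from the axis: the parameter `a = |z| + h` turns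
`dh / |z|` into `da / a`. -/
theorem lintegral_height {s : ℝ} (hs : 0 < s) (F : ℝ → ENNReal) :
    ∫⁻ h, ENNReal.ofReal (√(s + h ^ 2))⁻¹ * F h =
      ∫⁻ a in Ioi (0 : ℝ), ENNReal.ofReal a⁻¹ * F ((a - s / a) / 2) := by
  have hd : ∀ a ∈ Ioi (0 : ℝ), HasDerivWithinAt (fun a : ℝ => (a - s / a) / 2)
      ((1 + s / a ^ 2) / 2) (Ioi 0) a := by
    intro a ha
    have ha' : a ≠ 0 := ne_of_gt ha
    have h1 := ((hasDerivAt_id a).sub ((hasDerivAt_inv ha').const_mul s)).div_const 2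
    refine (h1.congr_deriv ?_).hasDerivWithinAt
    field_simp
    ring
  have hinj : InjOn (fun a : ℝ => (a - s / a) / 2) (Ioi 0) := by
    intro a ha b hb hab
    have ha' : 0 < a := ha
    have hb' : 0 < b := hb
    simp only at hab
    have h1 : (a - b) * (1 + s / (a * b)) = 0 := by
      field_simp at hab ⊢
      linarith
    rcases mul_eq_zero.1 h1 with h2 | h2
    · linarith
    · have : 0 < 1 + s / (a * b) := by positivity
      linarith
  have key := lintegral_image_eq_lintegral_abs_deriv_mul measurableSet_Ioi hd hinj
    fun h => ENNReal.ofReal (√(s + h ^ 2))⁻¹ * F h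
  rw [image_height hs, setLIntegral_univ] at key
  rw [key]
  refine setLIntegral_congr_fun measurableSet_Ioi fun a ha => ?_
  have ha' : 0 < a := ha
  rw [← mul_assoc, ← ENNReal.ofReal_mul (abs_nonneg _)]
  congr 2
  have h1 : s + ((a - s / a) / 2) ^ 2 = ((a + s / a) / 2) ^ 2 := by
    field_simp; ring
  rw [h1, Real.sqrt_sq (by positivity), abs_of_pos (by positivity)]
  have h2 : 0 < a ^ 2 + s := by positivity
  field_simp

theorem lintegral_comp_smul_plane {r : ℝ} (hr : 0 < r) {g : E2 → ENNReal} (hg : Measurable g) :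
    ∫⁻ ζ, g (r • ζ) = ENNReal.ofReal (r ^ 2)⁻¹ * ∫⁻ η, g η := by
  have h1 := Measure.map_addHaar_smul (volume : Measure E2) hr.ne'
  rw [← lintegral_map hg (measurable_const_smul r), h1, lintegral_smul_measure]
  simp [abs_of_pos (inv_pos.2 (pow_pos hr 2))]

namespace IsFrame

variable {ω : E3} {J : E2 →ₗᵢ[ℝ] E3} (hJ : IsFrame ω J)
include hJ

/-- In paraboloid coordinates the measure `dz / |z|` is Lebesgue measure. The factor `1 / a` from
`dh / |z| = da / a` cancels against the scaling `η = √a ζ` of the plane. -/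
theorem measurePreserving_parab : MeasurePreserving (parab ω J) halfSpace newton := by
  have hpm : Measurable (parab ω J) := (continuous_parab ω J).measurable
  refine ⟨hpm, (Measure.ext_of_lintegral _ fun g hg => ?_)⟩
  rw [lintegral_map hg hpm, lintegral_newton hg]
  have hJc := J.continuous
  have hm : Measurable fun z : E3 => ENNReal.ofReal ‖z‖⁻¹ * g z := by fun_prop
  rw [← hJ.measurePreserving.lintegral_comp hm, Measure.volume_eq_prod,
    lintegral_prod (fun p : E2 × ℝ => ENNReal.ofReal ‖J p.1 + p.2 • ω‖⁻¹ * g (J p.1 + p.2 • ω))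
      (hm.comp hJ.measurePreserving.measurable).aemeasurable]
  -- the substitution `h = (a - |η|² / a) / 2` on each vertical line
  have h1 : ∀ᵐ η : E2, ∫⁻ h : ℝ, ENNReal.ofReal ‖J η + h • ω‖⁻¹ * g (J η + h • ω) =
      ∫⁻ a in Ioi (0 : ℝ), ENNReal.ofReal a⁻¹ * g (J η + ((a - ‖η‖ ^ 2 / a) / 2) • ω) := by
    have h0 : ∀ᵐ η : E2, η ≠ 0 := by
      simp [ae_iff]
    filter_upwards [h0] with η hη
    rw [← lintegral_height (by positivity) fun h => g (J η + h • ω)]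
    refine lintegral_congr fun h => ?_
    rw [← hJ.norm_sq_add, Real.sqrt_sq (norm_nonneg _)]
  rw [lintegral_congr_ae h1]
  have hm2 : Measurable fun p : E2 × ℝ =>
      ENNReal.ofReal p.2⁻¹ * g (J p.1 + ((p.2 - ‖p.1‖ ^ 2 / p.2) / 2) • ω) := by
    have : Measurable fun p : E2 × ℝ => J p.1 := (hJc.comp continuous_fst).measurable
    fun_prop
  rw [lintegral_lintegral_swap hm2.aemeasurable, halfSpace,
    lintegral_prod (fun p => g (parab ω J p)) (hg.comp hpm).aemeasurable]
  refine setLIntegral_congr_fun measurableSet_Ioi fun a ha => ?_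
  have ha' : 0 < a := ha
  have hm3 : Measurable fun η : E2 => g (J η + ((a - ‖η‖ ^ 2 / a) / 2) • ω) := by
    have : Measurable fun p : E2 => J p := hJc.measurable
    fun_prop
  rw [lintegral_const_mul _ hm3]
  have h2 := lintegral_comp_smul_plane (Real.sqrt_pos.2 ha') hm3
  rw [Real.sq_sqrt ha'.le] at h2
  rw [← h2]
  refine lintegral_congr fun ζ => ?_
  rw [parab, norm_smul, mul_pow, Real.norm_eq_abs, sq_abs, Real.sq_sqrt ha'.le, map_smul,
    mul_div_cancel_left₀ _ ha'.ne']

theorem integral_newton {f : E3 → ℝ} (hf : Measurable f) :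
    ∫ z, f z ∂newton = ∫ p, f (parab ω J p) ∂halfSpace := by
  rw [← hJ.measurePreserving_parab.map_eq, integral_map
    hJ.measurePreserving_parab.measurable.aemeasurable hf.aestronglyMeasurable]

end IsFrame

theorem exists_unit : ∃ ω : E3, ‖ω‖ = 1 :=
  ⟨EuclideanSpace.single 0 1, by simp⟩

instance : IsFiniteMeasureOnCompacts newton := by
  refine ⟨fun K hK => ?_⟩
  obtain ⟨ω, hω⟩ := exists_unit
  obtain ⟨J, hJ⟩ := exists_isFrame hω
  obtain ⟨R, hR⟩ := hK.isBounded.subset_closedBall 0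
  refine (measure_mono hR).trans_lt ?_
  rw [← hJ.measurePreserving_parab.measure_preimage
    Metric.isClosed_closedBall.measurableSet.nullMeasurableSet]
  have hc : IsCompact (Icc 0 (2 * R) ×ˢ Metric.closedBall (0 : E2) (1 + 2 * |R|)) :=
    isCompact_Icc.prod (isCompact_closedBall _ _)
  have hae : ∀ᵐ p ∂halfSpace, p.1 ∈ Ioi (0 : ℝ) := by
    refine Measure.quasiMeasurePreserving_fst.ae ?_
    exact ae_restrict_mem measurableSet_Ioi
  refine (measure_mono_ae ?_).trans_lt hc.measure_lt_top
  filter_upwards [hae] with p hp h1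
  have hp' : 0 < p.1 := hp
  have h2 : ‖parab ω J p‖ ≤ R := by
    have : parab ω J p ∈ Metric.closedBall (0 : E3) R := h1
    simpa using this
  rw [show p = (p.1, p.2) from rfl, hJ.norm_parab hp'.le] at h2
  refine ⟨⟨hp'.le, by nlinarith [sq_nonneg ‖p.2‖]⟩, ?_⟩
  rw [mem_closedBall_zero_iff]
  nlinarith [norm_nonneg p.2, le_abs_self R, abs_nonneg R, sq_nonneg (‖p.2‖ - 1)]

/-! ### Paraboloids parametrized smoothly in the direction -/

/-- A smooth probability density on the line, supported in `[-1, 1]`. -/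
def lineBump : ℝ → ℝ :=
  (⟨1 / 2, 1, by norm_num, by norm_num⟩ : ContDiffBump (0 : ℝ)).normed volume

theorem contDiff_lineBump : ContDiff ℝ (⊤ : ℕ∞) lineBump := ContDiffBump.contDiff_normed _

theorem integral_lineBump : ∫ h, lineBump h = 1 := ContDiffBump.integral_normed _

theorem lineBump_neg (h : ℝ) : lineBump (-h) = lineBump h := ContDiffBump.normed_neg _ h

theorem abs_le_one_of_lineBump_ne_zero {h : ℝ} (h0 : lineBump h ≠ 0) : |h| ≤ 1 := by
  have h1 : h ∈ tsupport lineBump := subset_tsupport _ h0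
  rw [lineBump, ContDiffBump.tsupport_normed_eq] at h1
  simpa using h1

/-- The part of `ξ` orthogonal to `ω`, when `ω` is a unit vector. -/
def perp (ω ξ : E3) : E3 := ξ - ⟪ξ, ω⟫_ℝ • ω

/-- The point `x + r ζ + (r² - |ζ|²) / 2 ω`, where `ζ` is the part of `ξ` orthogonal to `ω`. It is
polynomial in all variables. -/
def parabPoint (x ω : E3) (r : ℝ) (ξ : E3) : E3 :=
  x + r • perp ω ξ + ((r ^ 2 - ‖perp ω ξ‖ ^ 2) / 2) • ω

/-- The weight which turns integrals over `ω^⊥` into integrals over the whole space, cut off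
smoothly outside a ball whose radius depends on the point. -/
def planeWeight (x ω : E3) (s : ℝ) (ξ : E3) : ℝ :=
  lineBump ⟪ξ, ω⟫_ℝ * Real.smoothTransition (2 - ‖ξ‖ ^ 2 / (4 + ‖x‖ ^ 2 + s ^ 2))

section Smooth

variable {G : Type} [NormedAddCommGroup G] [NormedSpace ℝ G] {n : WithTop ℕ∞}

theorem ContDiff.perp {f g : G → E3} (hf : ContDiff ℝ n f) (hg : ContDiff ℝ n g) :
    ContDiff ℝ n fun p => perp (f p) (g p) :=
  hg.sub ((hg.inner ℝ hf).smul hf)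

theorem ContDiff.parabPoint {x ω ξ : G → E3} {r : G → ℝ} (hx : ContDiff ℝ n x)
    (hω : ContDiff ℝ n ω) (hr : ContDiff ℝ n r) (hξ : ContDiff ℝ n ξ) :
    ContDiff ℝ n fun p => parabPoint (x p) (ω p) (r p) (ξ p) := by
  unfold _root_.parabPoint
  have h1 : ContDiff ℝ n fun p => _root_.perp (ω p) (ξ p) := ContDiff.perp hω hξ
  have h2 : ContDiff ℝ n fun p => ‖_root_.perp (ω p) (ξ p)‖ ^ 2 := h1.norm_sq ℝ
  exact (hx.add (hr.smul h1)).add ((((hr.pow 2).sub h2).div_const 2).smul hω)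

theorem ContDiff.planeWeight {x ω ξ : G → E3} {s : G → ℝ} (hx : ContDiff ℝ (⊤ : ℕ∞) x)
    (hω : ContDiff ℝ (⊤ : ℕ∞) ω) (hs : ContDiff ℝ (⊤ : ℕ∞) s) (hξ : ContDiff ℝ (⊤ : ℕ∞) ξ) :
    ContDiff ℝ (⊤ : ℕ∞) fun p => planeWeight (x p) (ω p) (s p) (ξ p) := by
  unfold _root_.planeWeight
  have h3 : ContDiff ℝ (⊤ : ℕ∞) fun p => ‖ξ p‖ ^ 2 := hξ.norm_sq ℝ
  have h4 : ContDiff ℝ (⊤ : ℕ∞) fun p => 4 + ‖x p‖ ^ 2 + s p ^ 2 :=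
    (contDiff_const.add (hx.norm_sq ℝ)).add (hs.pow 2)
  refine (contDiff_lineBump.comp (hξ.inner ℝ hω)).mul
    (Real.smoothTransition.contDiff.comp (contDiff_const.sub (h3.div h4 fun p => ?_)))
  positivity

end Smooth

theorem norm_sq_le_of_planeWeight_ne_zero {x ω ξ : E3} {s : ℝ} (h : planeWeight x ω s ξ ≠ 0) :
    ‖ξ‖ ^ 2 ≤ 2 * (4 + ‖x‖ ^ 2 + s ^ 2) := by
  by_contra! h1
  refine h (mul_eq_zero_of_right _ (Real.smoothTransition.zero_of_nonpos ?_))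
  rw [sub_nonpos, le_div_iff₀ (by positivity)]
  exact h1.le

theorem abs_planeWeight_le : ∃ B, 0 ≤ B ∧ ∀ x ω s ξ, |planeWeight x ω s ξ| ≤ B := by
  have hc : HasCompactSupport lineBump := ContDiffBump.hasCompactSupport_normed _
  obtain ⟨B, hB⟩ := contDiff_lineBump.continuous.bounded_above_of_compact_support hc
  refine ⟨B, (norm_nonneg _).trans (hB 0), fun x ω s ξ => ?_⟩
  rw [planeWeight, abs_mul]
  calc _ ≤ |lineBump ⟪ξ, ω⟫_ℝ| * 1 := by
        gcongr
        rw [abs_of_nonneg (Real.smoothTransition.nonneg _)]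
        exact Real.smoothTransition.le_one _
    _ ≤ B := by rw [mul_one]; exact hB _

theorem perp_neg (ω ξ : E3) : perp ω (-ξ) = -perp ω ξ := by
  simp [perp]; abel

theorem parabPoint_neg (x ω : E3) (r : ℝ) (ξ : E3) :
    parabPoint x ω (-r) (-ξ) = parabPoint x ω r ξ := by
  simp [parabPoint, perp_neg]

theorem planeWeight_neg (x ω : E3) (s : ℝ) (ξ : E3) :
    planeWeight x ω (-s) (-ξ) = planeWeight x ω s ξ := by
  simp [planeWeight, lineBump_neg]

theorem inner_perp {ω : E3} (hω : ‖ω‖ = 1) (ξ : E3) : ⟪perp ω ξ, ω⟫_ℝ = 0 := by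
  rw [perp, inner_sub_left, inner_smul_left, real_inner_self_eq_norm_sq, hω]
  simp

/-- On the support of the potential the cutoff in `planeWeight` equals one. -/
theorem mul_planeWeight {q : E3 → ℝ} (hq : tsupport q ⊆ Metric.closedBall 0 1) {ω : E3}
    (hω : ‖ω‖ = 1) (x ξ : E3) {r s : ℝ} (hrs : r ^ 2 ≤ s ^ 2) :
    q (parabPoint x ω r ξ) * planeWeight x ω s ξ =
      q (parabPoint x ω r ξ) * lineBump ⟪ξ, ω⟫_ℝ := by
  by_cases h1 : q (parabPoint x ω r ξ) = 0
  · simp [h1]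
  by_cases h2 : lineBump ⟪ξ, ω⟫_ℝ = 0
  · simp [h2, planeWeight]
  rw [planeWeight, Real.smoothTransition.one_of_one_le, mul_one]
  have h3 := abs_le_one_of_lineBump_ne_zero h2
  have h4 : ‖parabPoint x ω r ξ‖ ≤ 1 := by simpa using hq (subset_tsupport _ h1)
  have h5 : -1 ≤ ⟪parabPoint x ω r ξ, ω⟫_ℝ := by
    have := (abs_real_inner_le_norm (parabPoint x ω r ξ) ω).trans (by rw [hω, mul_one])
    linarith [neg_abs_le ⟪parabPoint x ω r ξ, ω⟫_ℝ]
  rw [parabPoint, inner_add_left, inner_add_left, inner_smul_left, inner_smul_left,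
    inner_perp hω, real_inner_self_eq_norm_sq, hω] at h5
  have h6 : ⟪x, ω⟫_ℝ ≤ ‖x‖ := by
    have := real_inner_le_norm x ω
    rwa [hω, mul_one] at this
  have h7 : ‖ξ‖ ^ 2 = ‖perp ω ξ‖ ^ 2 + ⟪ξ, ω⟫_ℝ ^ 2 := by
    rw [perp, norm_sub_sq_real, norm_smul, inner_smul_right, hω, Real.norm_eq_abs, mul_one, sq_abs]
    ring
  have h8 : ⟪ξ, ω⟫_ℝ ^ 2 ≤ 1 := (sq_le_one_iff_abs_le_one _).2 h3
  have h9 : ‖ξ‖ ^ 2 ≤ 4 + ‖x‖ ^ 2 + s ^ 2 := by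
    simp only [conj_trivial] at h5
    nlinarith [sq_nonneg (‖x‖ - 1)]
  have : ‖ξ‖ ^ 2 / (4 + ‖x‖ ^ 2 + s ^ 2) ≤ 1 := (div_le_one (by positivity)).2 h9
  linarith

theorem parabPoint_frame {ω : E3} {J : E2 →ₗᵢ[ℝ] E3} (hJ : IsFrame ω J) (x : E3) {r : ℝ}
    (hr : 0 ≤ r) (ζ : E2) : parabPoint x ω r (J ζ) = x + parab ω J (r ^ 2, ζ) := by
  simp [parabPoint, perp, hJ.orth, parab, Real.sqrt_sq hr, add_assoc]

theorem perp_perp {ω : E3} (hω : ‖ω‖ = 1) (ξ : E3) : perp ω (perp ω ξ) = perp ω ξ := by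
  rw [perp, inner_perp hω]; simp

theorem parabPoint_perp {ω : E3} (hω : ‖ω‖ = 1) (x : E3) (r : ℝ) (ξ : E3) :
    parabPoint x ω r (perp ω ξ) = parabPoint x ω r ξ := by
  rw [parabPoint, perp_perp hω, parabPoint]

/-- Integrals against `planeWeight` are integrals over the plane `ω^⊥`. -/
theorem integral_planeWeight {q : E3 → ℝ} (hq : tsupport q ⊆ Metric.closedBall 0 1) {ω : E3}
    {J : E2 →ₗᵢ[ℝ] E3} (hJ : IsFrame ω J) (x : E3) {r s : ℝ} (hr : 0 ≤ r) (hrs : r ^ 2 ≤ s ^ 2)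
    (f : E3 → ℝ) :
    ∫ ξ, q (parabPoint x ω r ξ) * f (parabPoint x ω r ξ) * planeWeight x ω s ξ =
      ∫ ζ : E2, q (x + parab ω J (r ^ 2, ζ)) * f (x + parab ω J (r ^ 2, ζ)) := by
  have h1 := hJ.integral_mul_inner
    (fun ξ => q (parabPoint x ω r ξ) * f (parabPoint x ω r ξ)) lineBump
  rw [integral_lineBump, mul_one] at h1
  simp_rw [parabPoint_frame hJ x hr] at h1
  rw [← h1]
  refine integral_congr_ae (Eventually.of_forall fun ξ => ?_)
  have h2 := mul_planeWeight hq hJ.norm_eq x ξ hrs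
  have h3 := parabPoint_perp hJ.norm_eq x r ξ
  rw [perp] at h3
  simp only [h3]
  linear_combination f (parabPoint x ω r ξ) * h2

/-! ### The integral equation for the scattered wave is of Volterra type -/

/-- The space of parameters `(x, ω, s)`, where `s` stands for `√(t - x · ω)`. -/
abbrev ParamSpace : Type := E3 × E3 × ℝ

/-- The measure `dθ dξ` on the slab `0 ≤ θ ≤ π / 2`. -/
def slab : Measure (ℝ × E3) := (volume.restrict (Icc (0 : ℝ) (Real.pi / 2))).prod volume

instance : IsFiniteMeasureOnCompacts slab := by unfold slab; infer_instance

theorem ae_slab : ∀ᵐ z ∂slab, z.1 ∈ Icc (0 : ℝ) (Real.pi / 2) :=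
  Measure.quasiMeasurePreserving_fst.ae (ae_restrict_mem measurableSet_Icc)

/-- The scalar kernel of the integral equation for the scattered wave. -/
def waveCoeff (q : E3 → ℝ) (p : ParamSpace × (ℝ × E3)) : ℝ :=
  -(1 / (4 * Real.pi)) * (2 * p.1.2.2 ^ 2 * Real.sin p.2.1 * Real.cos p.2.1) *
    (q (parabPoint p.1.1 p.1.2.1 (p.1.2.2 * Real.sin p.2.1) p.2.2) *
      planeWeight p.1.1 p.1.2.1 p.1.2.2 p.2.2)

/-- The kernel of the integral equation for the scattered wave, as a family of operators. -/
def waveKernel (q : E3 → ℝ) (p : ParamSpace × (ℝ × E3)) : ℝ →L[ℝ] ℝ :=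
  waveCoeff q p • ContinuousLinearMap.id ℝ ℝ

/-- The point at which the unknown is evaluated in the integral equation for the scattered wave. -/
def wavePoint (p : ParamSpace × (ℝ × E3)) : ParamSpace :=
  (parabPoint p.1.1 p.1.2.1 (p.1.2.2 * Real.sin p.2.1) p.2.2, p.1.2.1,
    p.1.2.2 * Real.cos p.2.1)

/-- The singly scattered wave. -/
def singleScatter (q : E3 → ℝ) (P : ParamSpace) : ℝ :=
  -(1 / (4 * Real.pi)) * ∫ ξ : E3, q (parabPoint P.1 P.2.1 P.2.2 ξ) * planeWeight P.1 P.2.1 P.2.2 ξ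

theorem contDiff_wavePoint : ContDiff ℝ (⊤ : ℕ∞) wavePoint := by
  unfold wavePoint
  refine ContDiff.prodMk (ContDiff.parabPoint ?_ ?_ ?_ ?_) (ContDiff.prodMk ?_ ?_) <;> fun_prop

theorem contDiff_waveCoeff {q : E3 → ℝ} (hq : ContDiff ℝ (⊤ : ℕ∞) q) :
    ContDiff ℝ (⊤ : ℕ∞) (waveCoeff q) := by
  unfold waveCoeff
  refine (ContDiff.mul (by fun_prop) (by fun_prop)).mul
    ((hq.comp (ContDiff.parabPoint ?_ ?_ ?_ ?_)).mul (ContDiff.planeWeight ?_ ?_ ?_ ?_)) <;>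
  fun_prop

theorem contDiff_waveKernel {q : E3 → ℝ} (hq : ContDiff ℝ (⊤ : ℕ∞) q) :
    ContDiff ℝ (⊤ : ℕ∞) (waveKernel q) :=
  (contDiff_waveCoeff hq).smul contDiff_const

theorem norm_waveKernel (q : E3 → ℝ) (p : ParamSpace × (ℝ × E3)) :
    ‖waveKernel q p‖ = |waveCoeff q p| := by
  rw [waveKernel, norm_smul, ContinuousLinearMap.norm_id, mul_one, Real.norm_eq_abs]

/-- For a compactly supported function the integral over the paraboloid only sees a bounded set. -/
theorem fiberCompact_of_planeWeight {f : ParamSpace × E3 → ℝ}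
    (h : ∀ P ξ, f (P, ξ) ≠ 0 → planeWeight P.1 P.2.1 P.2.2 ξ ≠ 0) :
    FiberCompact (volume : Measure E3) f := by
  intro P₀
  set R := ‖P₀‖ + 1
  have hR : 0 ≤ R := by positivity
  refine ⟨Metric.closedBall 0 R, ?_, Metric.closedBall 0 (3 + 2 * R), isCompact_closedBall _ _,
    Eventually.of_forall fun ξ P hP hξ => ?_⟩
  · exact Metric.closedBall_mem_nhds_of_mem (by simp [R])
  · by_contra h0
    have h1 := norm_sq_le_of_planeWeight_ne_zero (h P ξ h0)
    rw [mem_closedBall_zero_iff] at hP hξ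
    have h2 : ‖P.1‖ ≤ R := (norm_fst_le P).trans hP
    have h3 : |P.2.2| ≤ R := ((norm_snd_le P.2).trans (norm_snd_le P)).trans hP
    have h4 : P.2.2 ^ 2 ≤ R ^ 2 := sq_le_sq' (neg_le_of_abs_le h3) (le_of_abs_le h3)
    have h5 : ‖P.1‖ ^ 2 ≤ R ^ 2 := by gcongr
    nlinarith

theorem contDiff_singleScatter {q : E3 → ℝ} (hq : ContDiff ℝ (⊤ : ℕ∞) q) :
    ContDiff ℝ (⊤ : ℕ∞) (singleScatter q) := by
  unfold singleScatter
  refine contDiff_const.mul (FiberCompact.contDiff_integral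
    (f := fun p : ParamSpace × E3 => q (parabPoint p.1.1 p.1.2.1 p.1.2.2 p.2) *
      planeWeight p.1.1 p.1.2.1 p.1.2.2 p.2) ?_ (fiberCompact_of_planeWeight fun P ξ h =>
        right_ne_zero_of_mul h))
  refine ((hq.comp (ContDiff.parabPoint ?_ ?_ ?_ ?_)).mul (ContDiff.planeWeight ?_ ?_ ?_ ?_)) <;>
  fun_prop

/-- The weight `exp (λ s²)` makes the integral operator small, since the integrand is a derivative up to
a factor `2 λ`. -/
theorem integral_sin_cos_exp {lam : ℝ} (hl : 0 < lam) (s : ℝ) :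
    s ^ 2 * ∫ θ in Icc (0 : ℝ) (Real.pi / 2),
      Real.sin θ * Real.cos θ * Real.exp (lam * (s * Real.cos θ) ^ 2) ≤
      Real.exp (lam * s ^ 2) / (2 * lam) := by
  rw [integral_Icc_eq_integral_Ioc, ← intervalIntegral.integral_of_le (by positivity),
    ← intervalIntegral.integral_const_mul]
  have h1 : ∀ θ ∈ uIcc 0 (Real.pi / 2), HasDerivAt
      (fun θ => -(Real.exp (lam * (s * Real.cos θ) ^ 2) / (2 * lam)))
      (s ^ 2 * (Real.sin θ * Real.cos θ * Real.exp (lam * (s * Real.cos θ) ^ 2))) θ := by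
    intro θ _
    have h2 := (((((Real.hasDerivAt_cos θ).const_mul s).pow 2).const_mul lam).exp.div_const
      (2 * lam)).neg
    refine h2.congr_deriv ?_
    field_simp
    simp
    ring_nf
  rw [intervalIntegral.integral_eq_sub_of_hasDerivAt h1
    (Continuous.intervalIntegrable (by fun_prop) _ _)]
  simp only [Real.cos_pi_div_two, Real.cos_zero, mul_one]
  have : 0 ≤ Real.exp (lam * (s * 0) ^ 2) / (2 * lam) := by positivity
  linarith

/-- The contraction property, with the weight `exp (λ s²)` for large `λ`; the compact sets are balls. -/
theorem isVolterra_waveKernel {q : E3 → ℝ} (hq : ContDiff ℝ (⊤ : ℕ∞) q)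
    (hs : tsupport q ⊆ Metric.closedBall 0 1) : IsVolterra slab (waveKernel q) wavePoint := by
  intro P₀
  set R := ‖P₀‖ + 1 with hRdef
  have hR : 1 ≤ R := by simp [R]
  -- on the support of the kernel the paraboloid point lies in the unit ball
  have hsupp : ∀ P ∈ Metric.closedBall (0 : ParamSpace) R, ∀ z : ℝ × E3,
      (P, z) ∈ tsupport (waveKernel q) →
      ‖parabPoint P.1 P.2.1 (P.2.2 * Real.sin z.1) z.2‖ ≤ 1 ∧ ‖z.2‖ ≤ 3 + 2 * R := by
    intro P hP z hz
    have hclosed : IsClosed {p : ParamSpace × (ℝ × E3) |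
        ‖parabPoint p.1.1 p.1.2.1 (p.1.2.2 * Real.sin p.2.1) p.2.2‖ ≤ 1 ∧
        ‖p.2.2‖ ^ 2 ≤ 2 * (4 + ‖p.1.1‖ ^ 2 + p.1.2.2 ^ 2)} := by
      have h1 : IsClosed {p : ParamSpace × (ℝ × E3) |
          ‖parabPoint p.1.1 p.1.2.1 (p.1.2.2 * Real.sin p.2.1) p.2.2‖ ≤ 1} :=
        isClosed_le (continuous_fst.comp contDiff_wavePoint.continuous).norm continuous_const
      have h2 : IsClosed {p : ParamSpace × (ℝ × E3) |
          ‖p.2.2‖ ^ 2 ≤ 2 * (4 + ‖p.1.1‖ ^ 2 + p.1.2.2 ^ 2)} :=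
        isClosed_le (by fun_prop) (by fun_prop)
      exact h1.inter h2
    have h1 := closure_minimal (s := Function.support (waveKernel q)) (fun p hp => ?_) hclosed hz
    · refine ⟨h1.1, ?_⟩
      have h2 := h1.2
      simp only at h2
      rw [mem_closedBall_zero_iff] at hP
      have h3 : ‖P.1‖ ≤ R := (norm_fst_le P).trans hP
      have h4 : |P.2.2| ≤ R := ((norm_snd_le P.2).trans (norm_snd_le P)).trans hP
      have h5 : P.2.2 ^ 2 ≤ R ^ 2 := sq_le_sq' (neg_le_of_abs_le h4) (le_of_abs_le h4)
      have h6 : ‖P.1‖ ^ 2 ≤ R ^ 2 := by gcongr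
      by_contra! h7
      nlinarith
    · have h2 : waveCoeff q p ≠ 0 := fun h0 => hp (by simp [waveKernel, h0])
      have h3 := right_ne_zero_of_mul h2
      refine ⟨?_, norm_sq_le_of_planeWeight_ne_zero (right_ne_zero_of_mul h3)⟩
      simpa using hs (subset_tsupport _ (left_ne_zero_of_mul h3))
  refine ⟨Metric.closedBall 0 R, Metric.closedBall_mem_nhds_of_mem (by simp [R]),
    isCompact_closedBall _ _, ⟨Icc 0 (Real.pi / 2) ×ˢ Metric.closedBall 0 (3 + 2 * R),
    isCompact_Icc.prod (isCompact_closedBall _ _), ?_⟩, fun c hc => ?_⟩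
  · filter_upwards [ae_slab] with z hz P hP h0
    obtain ⟨h1, h2⟩ := hsupp P hP z h0
    refine ⟨⟨hz, by simpa using h2⟩, ?_⟩
    rw [mem_closedBall_zero_iff] at hP ⊢
    refine max_le (h1.trans hR) (max_le (((norm_fst_le P.2).trans (norm_snd_le P)).trans hP) ?_)
    rw [Real.norm_eq_abs]
    change |P.2.2 * Real.cos z.1| ≤ R
    rw [abs_mul]
    calc _ ≤ |P.2.2| * 1 := by gcongr; exact Real.abs_cos_le_one _
      _ ≤ R := by rw [mul_one]; exact ((norm_snd_le P.2).trans (norm_snd_le P)).trans hP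
  · have hqc : HasCompactSupport q := (isCompact_closedBall _ _).of_isClosed_subset
      (isClosed_tsupport q) hs
    obtain ⟨Mq, hMq⟩ := hq.continuous.bounded_above_of_compact_support hqc
    have hMq0 : 0 ≤ Mq := (norm_nonneg _).trans (hMq 0)
    obtain ⟨B, hB0, hB⟩ := abs_planeWeight_le
    set vol := (volume : Measure E3).real (Metric.closedBall 0 (3 + 2 * R)) with hvol
    have hvol0 : 0 ≤ vol := measureReal_nonneg
    set D := 2 * (1 / (4 * Real.pi)) * (Mq * B) with hD
    have hD0 : 0 ≤ D := by positivity
    set lam := c * D * vol + 1 with hlam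
    have hlam0 : 0 < lam := by positivity
    refine ⟨fun P => Real.exp (lam * P.2.2 ^ 2), by fun_prop, fun P => Real.exp_pos _,
      fun P hP => ?_⟩
    set s := P.2.2 with hsdef
    set g : ℝ → ℝ := fun θ => s ^ 2 * D *
      (Real.sin θ * Real.cos θ * Real.exp (lam * (s * Real.cos θ) ^ 2)) with hg
    set b : E3 → ℝ := (Metric.closedBall 0 (3 + 2 * R)).indicator fun _ => 1 with hb
    have hbi : Integrable b := (integrable_indicator_iff
      Metric.isClosed_closedBall.measurableSet).2
        (integrableOn_const (isCompact_closedBall _ _).measure_lt_top.ne)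
    have hgi : Integrable g (volume.restrict (Icc (0 : ℝ) (Real.pi / 2))) :=
      (Continuous.continuousOn (by fun_prop)).integrableOn_compact isCompact_Icc
    have hle : ∫ z, ‖waveKernel q (P, z)‖ * Real.exp (lam * (wavePoint (P, z)).2.2 ^ 2) ∂slab ≤
        (∫ θ in Icc (0 : ℝ) (Real.pi / 2), g θ) * vol := by
      have h1 : vol = ∫ ξ, b ξ := by
        rw [hb, integral_indicator Metric.isClosed_closedBall.measurableSet]
        simp [hvol, Measure.real]
      rw [h1, slab, ← integral_prod_mul]
      refine integral_mono_of_nonneg (Eventually.of_forall fun z => ?_) (hgi.mul_prod hbi) ?_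
      · positivity
      · have := ae_slab
        rw [slab] at this
        filter_upwards [this] with z hz
        have hsin : 0 ≤ Real.sin z.1 := Real.sin_nonneg_of_nonneg_of_le_pi hz.1
          (hz.2.trans (by linarith [Real.pi_pos]))
        have hcos : 0 ≤ Real.cos z.1 := Real.cos_nonneg_of_neg_pi_div_two_le_of_le
          (by linarith [hz.1, Real.pi_pos]) hz.2
        by_cases h0 : (P, z) ∈ tsupport (waveKernel q)
        · have h2 := (hsupp P hP z h0).2
          have h3 : b z.2 = 1 := by simp [hb, h2]
          rw [h3, mul_one, norm_waveKernel]
          have h4 : |waveCoeff q (P, z)| ≤ s ^ 2 * D * (Real.sin z.1 * Real.cos z.1) := by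
            rw [waveCoeff, abs_mul, abs_mul (-(1 / (4 * Real.pi))), abs_neg,
              abs_of_nonneg (show (0 : ℝ) ≤ 1 / (4 * Real.pi) by positivity),
              abs_of_nonneg (show 0 ≤ 2 * s ^ 2 * Real.sin z.1 * Real.cos z.1 by positivity)]
            calc _ ≤ 1 / (4 * Real.pi) * (2 * s ^ 2 * Real.sin z.1 * Real.cos z.1) *
                  (Mq * B) := by
                  gcongr
                  rw [abs_mul]
                  exact mul_le_mul (hMq _) (hB _ _ _ _) (abs_nonneg _) hMq0
              _ = _ := by rw [hD]; ring
          calc _ ≤ s ^ 2 * D * (Real.sin z.1 * Real.cos z.1) *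
                Real.exp (lam * (wavePoint (P, z)).2.2 ^ 2) := by gcongr
            _ = g z.1 := by rw [hg]; simp only [wavePoint]; ring
        · have h5 : waveKernel q (P, z) = 0 := image_eq_zero_of_notMem_tsupport h0
          simp only [h5, norm_zero, zero_mul]
          refine mul_nonneg ?_ (indicator_nonneg (fun _ _ => zero_le_one) _)
          positivity
    have hgint : ∫ θ in Icc (0 : ℝ) (Real.pi / 2), g θ ≤
        D * (Real.exp (lam * s ^ 2) / (2 * lam)) := by
      have h1 := integral_sin_cos_exp hlam0 s
      have h2 : ∫ θ in Icc (0 : ℝ) (Real.pi / 2), g θ = D * (s ^ 2 *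
          ∫ θ in Icc (0 : ℝ) (Real.pi / 2),
            Real.sin θ * Real.cos θ * Real.exp (lam * (s * Real.cos θ) ^ 2)) := by
        rw [hg, integral_const_mul]; ring
      rw [h2]
      gcongr
    calc _ ≤ c * (D * (Real.exp (lam * s ^ 2) / (2 * lam)) * vol) := by
          gcongr
          exact hle.trans (by gcongr)
      _ = (c * D * vol / lam) * (1 / 2 * Real.exp (lam * s ^ 2)) := by
          field_simp
      _ ≤ 1 * (1 / 2 * Real.exp (lam * s ^ 2)) := by
          gcongr
          exact (div_le_one hlam0).2 (by linarith)
      _ = _ := one_mul _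

/-! ### The profile of the scattered wave -/

/-- The function `V` is the profile of the scattered wave for the potential `q`: the wave is
`u (x, t, ω) = V (x, ω, √(t - x · ω))` for `t ≥ x · ω`. The integral equation is the
Lippmann–Schwinger equation `u = -E * (q (δ(t - x · ω) + u))` with the retarded fundamental
solution `E`, written in paraboloid coordinates. -/
structure IsProfile (q : E3 → ℝ) (V : ParamSpace → ℝ) : Prop where
  smooth : ContDiff ℝ (⊤ : ℕ∞) V
  even : ∀ x ω s, V (x, ω, -s) = V (x, ω, s)
  eqn : ∀ (ω : E3) (J : E2 →ₗᵢ[ℝ] E3), IsFrame ω J → ∀ (x : E3) (s : ℝ), 0 ≤ s →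
    V (x, ω, s) = -(1 / (4 * Real.pi)) * ((∫ ζ : E2, q (x + parab ω J (s ^ 2, ζ))) +
      ∫ a in (0 : ℝ)..s ^ 2, ∫ ζ : E2,
        q (x + parab ω J (a, ζ)) * V (x + parab ω J (a, ζ), ω, √(s ^ 2 - a)))

/-- The substitution `a = s² sin² θ` in the integral over the paraboloid parameter. It removes the
square roots: the paraboloid with parameter `a` and the new distance `√(s² - a)` involve `s sin θ`
and `s cos θ` only, hence depend smoothly on `s`. -/
theorem integral_waveKernel {q : E3 → ℝ} (hq : ContDiff ℝ (⊤ : ℕ∞) q)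
    (hs : tsupport q ⊆ Metric.closedBall 0 1) {V : ParamSpace → ℝ} (hV : Continuous V) {ω : E3}
    {J : E2 →ₗᵢ[ℝ] E3} (hJ : IsFrame ω J) (x : E3) {s : ℝ} (hs0 : 0 ≤ s) :
    volterraOp slab (waveKernel q) wavePoint V (x, ω, s) =
      -(1 / (4 * Real.pi)) * ∫ a in (0 : ℝ)..s ^ 2, ∫ ζ : E2,
        q (x + parab ω J (a, ζ)) * V (x + parab ω J (a, ζ), ω, √(s ^ 2 - a)) := by
  have hint : Integrable (fun z => waveKernel q ((x, ω, s), z) (V (wavePoint ((x, ω, s), z))))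
      slab := ((isVolterra_waveKernel hq hs).fiberCompact_apply V).integrable
    ((contDiff_waveKernel hq).continuous.clm_apply (hV.comp contDiff_wavePoint.continuous)) _
  -- the integral over the paraboloid with parameter `a`
  set G : ℝ → ℝ := fun a => ∫ ξ, q (parabPoint x ω (√a) ξ) *
    V (parabPoint x ω (√a) ξ, ω, √(s ^ 2 - a)) * planeWeight x ω s ξ with hG
  have hGc : Continuous G := by
    have hc : Continuous fun p : ℝ × E3 => parabPoint x ω (√p.1) p.2 := by
      have h1 : ContDiff ℝ 0 fun p : ℝ × E3 => parabPoint x ω p.1 p.2 :=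
        ContDiff.parabPoint contDiff_const contDiff_const contDiff_fst contDiff_snd
      exact h1.continuous.comp (by fun_prop : Continuous fun p : ℝ × E3 => (√p.1, p.2))
    have hw : Continuous fun p : ℝ × E3 => planeWeight x ω s p.2 :=
      (ContDiff.planeWeight contDiff_const contDiff_const contDiff_const contDiff_snd).continuous
    refine FiberCompact.continuous_integral (f := fun p : ℝ × E3 => q (parabPoint x ω (√p.1) p.2) *
      V (parabPoint x ω (√p.1) p.2, ω, √(s ^ 2 - p.1)) * planeWeight x ω s p.2) ?_ ?_
    · refine ((hq.continuous.comp hc).mul (hV.comp ?_)).mul hw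
      exact hc.prodMk (continuous_const.prodMk (by fun_prop))
    · intro a
      refine ⟨univ, univ_mem, Metric.closedBall 0 (√(2 * (4 + ‖x‖ ^ 2 + s ^ 2))),
        isCompact_closedBall _ _, Eventually.of_forall fun ξ a _ hξ => ?_⟩
      by_contra h0
      refine hξ ?_
      rw [mem_closedBall_zero_iff]
      exact Real.le_sqrt_of_sq_le
        (norm_sq_le_of_planeWeight_ne_zero (right_ne_zero_of_mul h0))
  have h1 : volterraOp slab (waveKernel q) wavePoint V (x, ω, s) =
      ∫ θ in (0 : ℝ)..(Real.pi / 2), -(1 / (4 * Real.pi)) *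
        (G (s ^ 2 * Real.sin θ ^ 2) * (s ^ 2 * (2 * Real.sin θ * Real.cos θ))) := by
    rw [volterraOp, slab, integral_prod _ hint, intervalIntegral.integral_of_le (by positivity),
      ← integral_Icc_eq_integral_Ioc]
    refine setIntegral_congr_fun measurableSet_Icc fun θ hθ => ?_
    have hsin : 0 ≤ Real.sin θ := Real.sin_nonneg_of_nonneg_of_le_pi hθ.1
      (hθ.2.trans (by linarith [Real.pi_pos]))
    have hcos : 0 ≤ Real.cos θ := Real.cos_nonneg_of_neg_pi_div_two_le_of_le
      (by linarith [hθ.1, Real.pi_pos]) hθ.2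
    have e1 : √(s ^ 2 * Real.sin θ ^ 2) = s * Real.sin θ := by
      rw [← mul_pow, Real.sqrt_sq (by positivity)]
    have e2 : √(s ^ 2 - s ^ 2 * Real.sin θ ^ 2) = s * Real.cos θ := by
      rw [show s ^ 2 - s ^ 2 * Real.sin θ ^ 2 = (s * Real.cos θ) ^ 2 by
        rw [mul_pow, Real.cos_sq']; ring, Real.sqrt_sq (by positivity)]
    simp only [hG]
    rw [e1, e2, ← mul_assoc, mul_comm _ (s ^ 2 * _), ← mul_assoc, ← integral_const_mul]
    refine integral_congr_ae (Eventually.of_forall fun ξ => ?_)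
    simp only [waveKernel, waveCoeff, wavePoint, _root_.smul_apply,
      ContinuousLinearMap.id_apply, smul_eq_mul]
    ring
  rw [h1, intervalIntegral.integral_const_mul]
  congr 1
  have h2 := intervalIntegral.integral_comp_mul_deriv (a := 0) (b := Real.pi / 2)
    (f := fun θ => s ^ 2 * Real.sin θ ^ 2) (f' := fun θ => s ^ 2 * (2 * Real.sin θ * Real.cos θ))
    (g := G) (fun θ _ => by
      refine (((Real.hasDerivAt_sin θ).pow 2).const_mul (s ^ 2)).congr_deriv ?_
      simp) (by fun_prop) hGc
  simp only [Function.comp_def, Real.sin_zero, Real.sin_pi_div_two] at h2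
  rw [h2]
  simp only [ne_eq, OfNat.ofNat_ne_zero, not_false_eq_true, zero_pow, mul_zero, one_pow, mul_one]
  refine intervalIntegral.integral_congr fun a ha => ?_
  rw [uIcc_of_le (sq_nonneg s)] at ha
  have h3 := integral_planeWeight hs hJ x (Real.sqrt_nonneg a) (s := s)
    (by rw [Real.sq_sqrt ha.1]; exact ha.2) fun y => V (y, ω, √(s ^ 2 - a))
  rw [Real.sq_sqrt ha.1] at h3
  exact h3

/-- Every smooth potential supported in the unit ball has a profile. -/
theorem exists_isProfile {q : E3 → ℝ} (hq : ContDiff ℝ (⊤ : ℕ∞) q)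
    (hs : tsupport q ⊆ Metric.closedBall 0 1) : ∃ V, IsProfile q V := by
  have hvol := isVolterra_waveKernel hq hs
  have hA := contDiff_waveKernel hq
  obtain ⟨V, hV, hVeq⟩ := volterra_exists_contDiff hA contDiff_wavePoint hvol
    (contDiff_singleScatter hq)
  refine ⟨V, hV, ?_, ?_⟩
  · -- the reflected function solves the same equation
    have hflip : Continuous fun P : ParamSpace => V (P.1, P.2.1, -P.2.2) :=
      hV.continuous.comp (by fun_prop)
    have h1 := volterra_unique hA.continuous contDiff_wavePoint.continuous hvol
      (contDiff_singleScatter hq).continuous hV.continuous hVeq hflip fun P => by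
        rw [hVeq (P.1, P.2.1, -P.2.2)]
        congr 1
        · rw [singleScatter, ← integral_neg_eq_self]
          simp only [parabPoint_neg, planeWeight_neg]
          rfl
        · have hmp : MeasurePreserving (MeasurableEquiv.prodCongr (MeasurableEquiv.refl ℝ)
              (MeasurableEquiv.neg E3)) slab slab := by
            have := (MeasurePreserving.id (volume.restrict (Icc (0 : ℝ) (Real.pi / 2)))).prod
              (Measure.measurePreserving_neg (volume : Measure E3))
            exact this
          rw [volterraOp, volterraOp, ← hmp.integral_comp (MeasurableEquiv.measurableEmbedding _)]
          refine integral_congr_ae (Eventually.of_forall fun z => ?_)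
          have e : MeasurableEquiv.prodCongr (MeasurableEquiv.refl ℝ) (MeasurableEquiv.neg E3) z =
            (z.1, -z.2) := rfl
          simp only [e]
          simp [waveKernel, waveCoeff, wavePoint, parabPoint_neg, planeWeight_neg]
    intro x ω s
    exact (congrFun h1 (x, ω, s)).symm
  · intro ω J hJ x s hs0
    rw [hVeq, integral_waveKernel hq hs hV.continuous hJ x hs0, mul_add, singleScatter]
    congr 2
    have := integral_planeWeight hs hJ x hs0 (le_refl (s ^ 2)) fun _ => 1
    simpa using this

/-! ### The scattered wave and the Lippmann–Schwinger equation -/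

/-- The scattered wave with profile `V` for the incoming direction `ω`. -/
def wave (V : ParamSpace → ℝ) (ω x : E3) (t : ℝ) : ℝ :=
  if ⟪x, ω⟫_ℝ ≤ t then V (x, ω, √(t - ⟪x, ω⟫_ℝ)) else 0

theorem wave_of_le {V : ParamSpace → ℝ} {ω x : E3} {t : ℝ} (h : ⟪x, ω⟫_ℝ ≤ t) :
    wave V ω x t = V (x, ω, √(t - ⟪x, ω⟫_ℝ)) := if_pos h

theorem wave_of_lt {V : ParamSpace → ℝ} {ω x : E3} {t : ℝ} (h : t < ⟪x, ω⟫_ℝ) :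
    wave V ω x t = 0 := if_neg h.not_ge

theorem integrable_of_bounded_of_compact {Y : Type} [TopologicalSpace Y] [T2Space Y]
    [MeasurableSpace Y] [BorelSpace Y] {μ : Measure Y} [IsFiniteMeasureOnCompacts μ] {f : Y → ℝ}
    (hf : Measurable f) {C : Set Y} (hC : IsCompact C) (h0 : ∀ y, f y ≠ 0 → y ∈ C) {M : ℝ}
    (hM : ∀ y ∈ C, |f y| ≤ M) : Integrable f μ := by
  refine (integrableOn_iff_integrable_of_support_subset fun y hy => h0 y hy).1 ?_
  exact Measure.integrableOn_of_bounded hC.measure_lt_top.ne hf.aestronglyMeasurable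
    ((ae_restrict_mem hC.measurableSet).mono fun y hy => hM y hy)

theorem measurable_wave {V : ParamSpace → ℝ} (hV : Continuous V) (ω : E3) :
    Measurable fun z : E3 × ℝ => wave V ω z.1 z.2 := by
  unfold wave
  refine Measurable.ite (measurableSet_le (by fun_prop) (by fun_prop)) ?_ measurable_const
  exact (hV.comp (by fun_prop : Continuous fun z : E3 × ℝ =>
    (z.1, ω, √(z.2 - ⟪z.1, ω⟫_ℝ)))).measurable

theorem wave_bounded {V : ParamSpace → ℝ} (hV : Continuous V) (ω : E3) (R : ℝ) :
    ∃ M, 0 ≤ M ∧ ∀ x t, ‖x‖ ≤ R → |t| ≤ R → |wave V ω x t| ≤ M := by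
  have hc : Continuous fun z : E3 × ℝ => V (z.1, ω, √(z.2 - ⟪z.1, ω⟫_ℝ)) :=
    hV.comp (by fun_prop)
  obtain ⟨M, hM⟩ := ((isCompact_closedBall (0 : E3) R).prod
    (isCompact_closedBall (0 : ℝ) R)).exists_bound_of_continuousOn hc.continuousOn
  refine ⟨max M 0, le_max_right _ _, fun x t hx ht => ?_⟩
  by_cases h : ⟪x, ω⟫_ℝ ≤ t
  · rw [wave_of_le h]
    exact (hM (x, t) ⟨by simpa using hx, by simpa using ht⟩).trans (le_max_left _ _)
  · rw [wave_of_lt (not_le.1 h)]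
    simp

theorem norm_le_one_of_ne_zero {q : E3 → ℝ} (hs : tsupport q ⊆ Metric.closedBall 0 1) {x : E3}
    (h : q x ≠ 0) : ‖x‖ ≤ 1 := by
  simpa using hs (subset_tsupport _ h)

theorem neg_one_le_inner {ω x : E3} (hω : ‖ω‖ = 1) (hx : ‖x‖ ≤ 1) : -1 ≤ ⟪x, ω⟫_ℝ := by
  have h1 := (abs_real_inner_le_norm x ω).trans (by rw [hω, mul_one])
  linarith [neg_abs_le ⟪x, ω⟫_ℝ]

namespace IsProfile

variable {q : E3 → ℝ} {V : ParamSpace → ℝ} (hV : IsProfile q V)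
  (hs : tsupport q ⊆ Metric.closedBall 0 1) {ω : E3} {J : E2 →ₗᵢ[ℝ] E3} (hJ : IsFrame ω J)
include hV hs hJ

/-- Finite speed of propagation. -/
theorem wave_support {x : E3} {t : ℝ} (h : wave V ω x t ≠ 0) : -1 ≤ t ∧ ‖x‖ ≤ t + 2 := by
  have hle : ⟪x, ω⟫_ℝ ≤ t := by
    by_contra h1
    exact h (wave_of_lt (not_le.1 h1))
  by_contra hcon
  refine h ?_
  have hq0 : ∀ a : ℝ, 0 ≤ a → a ≤ t - ⟪x, ω⟫_ℝ → ∀ ζ : E2, q (x + parab ω J (a, ζ)) = 0 := by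
    intro a ha hat ζ
    by_contra h1
    have h2 := norm_le_one_of_ne_zero hs h1
    have h3 := neg_one_le_inner hJ.norm_eq h2
    rw [inner_add_left, hJ.inner_parab] at h3
    have h4 := hJ.norm_parab ha ζ
    have h5 : ‖x‖ ≤ ‖x + parab ω J (a, ζ)‖ + ‖parab ω J (a, ζ)‖ := by
      simpa using norm_sub_le (x + parab ω J (a, ζ)) (parab ω J (a, ζ))
    refine hcon ⟨?_, ?_⟩
    · nlinarith [sq_nonneg ‖ζ‖]
    · linarith
  have hσ : 0 ≤ t - ⟪x, ω⟫_ℝ := sub_nonneg.2 hle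
  rw [wave_of_le hle, hV.eqn ω J hJ x _ (Real.sqrt_nonneg _), Real.sq_sqrt hσ]
  have h1 : ∫ ζ : E2, q (x + parab ω J (t - ⟪x, ω⟫_ℝ, ζ)) = 0 := by
    simp [hq0 _ hσ le_rfl]
  have h2 : ∫ a in (0 : ℝ)..(t - ⟪x, ω⟫_ℝ), ∫ ζ : E2, q (x + parab ω J (a, ζ)) *
      V (x + parab ω J (a, ζ), ω, √(t - ⟪x, ω⟫_ℝ - a)) = 0 := by
    rw [intervalIntegral.integral_congr (g := fun _ => 0)]
    · simp
    · intro a ha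
      rw [uIcc_of_le hσ] at ha
      simp [hq0 a ha.1 ha.2]
  rw [h1, h2]
  simp

omit hs hJ in
theorem measurable_wave_comp (hq : Continuous q) {Y : Type} [MeasurableSpace Y] {f : Y → E3}
    {g : Y → ℝ} (hf : Measurable f) (hg : Measurable g) :
    Measurable fun y => q (f y) * wave V ω (f y) (g y) :=
  (hq.measurable.comp hf).mul ((measurable_wave hV.smooth.continuous ω).comp (hf.prodMk hg))

theorem integrable_newton (hq : Continuous q) (x : E3) (t : ℝ) :
    Integrable (fun z => q (x + z) * wave V ω (x + z) (t - ‖z‖)) newton := by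
  obtain ⟨Mq, hMq⟩ := hq.bounded_above_of_compact_support
    ((isCompact_closedBall _ _).of_isClosed_subset (isClosed_tsupport q) hs)
  obtain ⟨M, hM0, hM⟩ := wave_bounded hV.smooth.continuous ω (2 + ‖x‖ + |t|)
  have hz : ∀ z, q (x + z) * wave V ω (x + z) (t - ‖z‖) ≠ 0 → ‖x + z‖ ≤ 1 ∧ ‖z‖ ≤ 1 + ‖x‖ := by
    intro z hz
    have h1 := norm_le_one_of_ne_zero hs (left_ne_zero_of_mul hz)
    refine ⟨h1, ?_⟩
    have : ‖z‖ ≤ ‖x + z‖ + ‖x‖ := by simpa using norm_sub_le (x + z) x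
    linarith
  refine integrable_of_bounded_of_compact (C := Metric.closedBall 0 (1 + ‖x‖)) (M := Mq * M)
    (hV.measurable_wave_comp hq (by fun_prop) (by fun_prop)) (isCompact_closedBall _ _)
    (fun z h0 => by simpa using (hz z h0).2) fun z _ => ?_
  by_cases h0 : q (x + z) * wave V ω (x + z) (t - ‖z‖) = 0
  · rw [h0, abs_zero]
    exact mul_nonneg ((norm_nonneg _).trans (hMq 0)) hM0
  · obtain ⟨h1, h2⟩ := hz z h0
    rw [abs_mul]
    refine mul_le_mul (hMq _) (hM _ _ (by linarith [norm_nonneg x, abs_nonneg t]) ?_)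
      (abs_nonneg _) ((norm_nonneg _).trans (hMq 0))
    rw [abs_le]
    constructor <;> linarith [norm_nonneg z, neg_abs_le t, le_abs_self t, norm_nonneg x]

/-- The multiply scattered part in paraboloid coordinates. -/
theorem integral_newton_eq (hq : Continuous q) {x : E3} {t : ℝ} (hle : ⟪x, ω⟫_ℝ ≤ t) :
    ∫ z, q (x + z) * wave V ω (x + z) (t - ‖z‖) ∂newton =
      ∫ a in (0 : ℝ)..(t - ⟪x, ω⟫_ℝ), ∫ ζ : E2, q (x + parab ω J (a, ζ)) *
        V (x + parab ω J (a, ζ), ω, √(t - ⟪x, ω⟫_ℝ - a)) := by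
  have hm : Measurable fun z => q (x + z) * wave V ω (x + z) (t - ‖z‖) :=
    hV.measurable_wave_comp hq (by fun_prop) (by fun_prop)
  have hi := (hJ.measurePreserving_parab.integrable_comp hm.aestronglyMeasurable).2
    (hV.integrable_newton hs hJ hq x t)
  rw [hJ.integral_newton hm]
  have hi' : Integrable (fun p : ℝ × E2 => q (x + parab ω J p) * wave V ω (x + parab ω J p)
    (t - ‖parab ω J p‖)) ((volume.restrict (Ioi (0 : ℝ))).prod volume) := hi
  rw [halfSpace, integral_prod _ hi', intervalIntegral.integral_of_le (sub_nonneg.2 hle),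
    ← integral_indicator measurableSet_Ioc, ← integral_indicator measurableSet_Ioi]
  congr 1
  funext a
  by_cases ha : 0 < a
  · have hcond : ∀ ζ : E2, ⟪x + parab ω J (a, ζ), ω⟫_ℝ ≤ t - ‖parab ω J (a, ζ)‖ ↔
        a ≤ t - ⟪x, ω⟫_ℝ := by
      intro ζ
      rw [inner_add_left, hJ.inner_parab, hJ.norm_parab ha.le]
      constructor <;> intro h <;> linarith
    by_cases hat : a ≤ t - ⟪x, ω⟫_ℝ
    · rw [indicator_of_mem (show a ∈ Ioi (0 : ℝ) from ha),
        indicator_of_mem (show a ∈ Ioc (0 : ℝ) (t - ⟪x, ω⟫_ℝ) from ⟨ha, hat⟩)]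
      refine integral_congr_ae (Eventually.of_forall fun ζ => ?_)
      simp only
      rw [wave_of_le ((hcond ζ).2 hat)]
      congr 4
      rw [inner_add_left, hJ.inner_parab, hJ.norm_parab ha.le]
      ring_nf
    · rw [indicator_of_mem (show a ∈ Ioi (0 : ℝ) from ha),
        indicator_of_notMem fun h => hat h.2]
      simp_rw [wave_of_lt (not_le.1 (mt (hcond _).1 hat))]
      simp
  · rw [indicator_of_notMem (show a ∉ Ioi (0 : ℝ) from ha), indicator_of_notMem fun h => ha h.1]

/-- The Lippmann–Schwinger equation behind the wave front. -/
theorem wave_eq (hq : Continuous q) {x : E3} {t : ℝ} (hle : ⟪x, ω⟫_ℝ ≤ t) :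
    wave V ω x t = -(1 / (4 * Real.pi)) * ((∫ ζ : E2, q (x + parab ω J (t - ⟪x, ω⟫_ℝ, ζ))) +
      ∫ z, q (x + z) * wave V ω (x + z) (t - ‖z‖) ∂newton) := by
  rw [hV.integral_newton_eq hs hJ hq hle, wave_of_le hle,
    hV.eqn ω J hJ x _ (Real.sqrt_nonneg _), Real.sq_sqrt (sub_nonneg.2 hle)]

omit hV hs in
/-- Ahead of the wave front there is no multiply scattered wave. -/
theorem integral_newton_eq_zero {x : E3} {t : ℝ} (hlt : t < ⟪x, ω⟫_ℝ) :
    ∫ z, q (x + z) * wave V ω (x + z) (t - ‖z‖) ∂newton = 0 := by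
  refine integral_eq_zero_of_ae (Eventually.of_forall fun z => ?_)
  have h1 : t - ‖z‖ < ⟪x + z, ω⟫_ℝ := by
    have := (abs_real_inner_le_norm z ω).trans (by rw [hJ.norm_eq, mul_one])
    rw [inner_add_left]
    linarith [neg_abs_le ⟪z, ω⟫_ℝ]
  simp [wave_of_lt h1]

/-- The Lippmann–Schwinger equation, as an equation on the whole space-time. -/
theorem wave_eq_ite (hq : Continuous q) (x : E3) (t : ℝ) :
    wave V ω x t = -(1 / (4 * Real.pi)) *
      ((if ⟪x, ω⟫_ℝ ≤ t then ∫ ζ : E2, q (x + parab ω J (t - ⟪x, ω⟫_ℝ, ζ)) else 0) +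
      ∫ z, q (x + z) * wave V ω (x + z) (t - ‖z‖) ∂newton) := by
  by_cases h : ⟪x, ω⟫_ℝ ≤ t
  · rw [if_pos h, hV.wave_eq hs hJ hq h]
  · rw [if_neg h, wave_of_lt (not_le.1 h), integral_newton_eq_zero hJ (not_le.1 h)]
    simp

end IsProfile

/-! ### The weak form of the Lippmann–Schwinger equation -/

section Shift

variable {Y : Type} [AddGroup Y] [MeasurableSpace Y] [MeasurableAdd₂ Y] {μ : Measure Y} [SFinite μ]
  [μ.IsAddRightInvariant] {c : E3 → Y}

theorem measurePreserving_shift (hc : Measurable c) :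
    MeasurePreserving (fun p : E3 × Y => (-p.1, p.2 + c p.1)) (newton.prod μ)
      (newton.prod μ) :=
  (Measure.measurePreserving_neg newton).skew_product (g := fun z y => y + c z)
    (measurable_snd.add (hc.comp measurable_fst))
    (Eventually.of_forall fun z => map_add_right_eq_self μ (c z))

/-- A change of variables in double integrals against `dz / |z|`, based on the symmetry of that
measure under `z ↦ -z`. -/
theorem integral_newton_shift {H : E3 × Y → ℝ} (hm : Measurable H)
    (hi : Integrable H (newton.prod μ)) (hc : Measurable c) :
    ∫ y, ∫ z, H (z, y) ∂newton ∂μ = ∫ y, ∫ z, H (-z, y + c z) ∂newton ∂μ := by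
  have hp := measurePreserving_shift (μ := μ) hc
  have hi' := (hp.integrable_comp hm.aestronglyMeasurable).2 hi
  have h1 := integral_prod_symm H hi
  have h2 := integral_prod_symm _ hi'
  rw [← h1]
  refine Eq.trans ?_ h2
  conv_lhs => rw [← hp.map_eq]
  rw [integral_map hp.measurable.aemeasurable hm.aestronglyMeasurable]
  rfl

end Shift

/-- The advanced potential `∫ f (y + z, s + |z|) dz / |z|`. -/
def advanced (f : E3 × ℝ → ℝ) (y : E3) (s : ℝ) : ℝ :=
  ∫ z, f (y + z, s + ‖z‖) ∂newton

/-- A compactly supported function on space-time vanishes outside a cylinder of radius and height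
`R`. -/
theorem exists_radius {f : E3 × ℝ → ℝ} (hf : HasCompactSupport f) :
    ∃ R, 0 ≤ R ∧ ∀ x t, f (x, t) ≠ 0 → ‖x‖ ≤ R ∧ |t| ≤ R := by
  obtain ⟨R, hR⟩ := hf.isCompact.isBounded.subset_closedBall 0
  refine ⟨max R 0, le_max_right _ _, fun x t h => ?_⟩
  have h1 := hR (subset_tsupport _ h)
  rw [mem_closedBall_zero_iff] at h1
  exact ⟨((norm_fst_le (x, t)).trans h1).trans (le_max_left _ _),
    ((norm_snd_le (x, t)).trans h1).trans (le_max_left _ _)⟩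

theorem integral_shear (ω : E3) (f : E3 → ℝ → ℝ) (x : E3) :
    ∫ t, f x t = ∫ σ, f x (σ + ⟪x, ω⟫_ℝ) := (integral_add_right_eq_self (f x) _).symm

namespace IsProfile

variable {q : E3 → ℝ} {V : ParamSpace → ℝ} (hV : IsProfile q V) (hq : Continuous q)
  (hs : tsupport q ⊆ Metric.closedBall 0 1) {ω : E3} {J : E2 →ₗᵢ[ℝ] E3} (hJ : IsFrame ω J)

include hV hq in
theorem measurable_wave_prod {f : E3 × ℝ → ℝ} (hf : Continuous f) :
    Measurable fun p : E3 × (E3 × ℝ) =>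
      q (p.2.1 + p.1) * wave V ω (p.2.1 + p.1) (p.2.2 - ‖p.1‖) * f p.2 :=
  (hV.measurable_wave_comp hq (f := fun p : E3 × (E3 × ℝ) => p.2.1 + p.1)
    (g := fun p => p.2.2 - ‖p.1‖) (by fun_prop) (by fun_prop)).mul
    (hf.measurable.comp measurable_snd)

include hV hq hs in
theorem integrable_wave_prod {f : E3 × ℝ → ℝ} (hf : Continuous f) (hfc : HasCompactSupport f) :
    Integrable (fun p : E3 × (E3 × ℝ) =>
      q (p.2.1 + p.1) * wave V ω (p.2.1 + p.1) (p.2.2 - ‖p.1‖) * f p.2) (newton.prod volume) := by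
  obtain ⟨R, hR0, hR⟩ := exists_radius hfc
  obtain ⟨Mq, hMq⟩ := hq.bounded_above_of_compact_support
    ((isCompact_closedBall _ _).of_isClosed_subset (isClosed_tsupport q) hs)
  obtain ⟨Mf, hMf⟩ := hf.bounded_above_of_compact_support hfc
  obtain ⟨M, hM0, hM⟩ := wave_bounded hV.smooth.continuous ω (2 * R + 1)
  have key : ∀ p : E3 × (E3 × ℝ),
      q (p.2.1 + p.1) * wave V ω (p.2.1 + p.1) (p.2.2 - ‖p.1‖) * f p.2 ≠ 0 →
      ‖p.2.1 + p.1‖ ≤ 1 ∧ ‖p.1‖ ≤ 1 + R ∧ ‖p.2.1‖ ≤ R ∧ |p.2.2| ≤ R := by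
    intro p hp
    have h1 := norm_le_one_of_ne_zero hs (left_ne_zero_of_mul (left_ne_zero_of_mul hp))
    obtain ⟨h2, h3⟩ := hR p.2.1 p.2.2 (right_ne_zero_of_mul hp)
    refine ⟨h1, ?_, h2, h3⟩
    have : ‖p.1‖ ≤ ‖p.2.1 + p.1‖ + ‖p.2.1‖ := by simpa using norm_sub_le (p.2.1 + p.1) p.2.1
    linarith
  refine integrable_of_bounded_of_compact (C := Metric.closedBall 0 (1 + R) ×ˢ
    (Metric.closedBall 0 R ×ˢ Metric.closedBall 0 R)) (M := Mq * M * Mf)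
    (hV.measurable_wave_prod hq hf) ((isCompact_closedBall _ _).prod
      ((isCompact_closedBall _ _).prod (isCompact_closedBall _ _))) (fun p hp => ?_) fun p _ => ?_
  · obtain ⟨-, h1, h2, h3⟩ := key p hp
    exact ⟨by simpa using h1, by simpa using h2, by simpa using h3⟩
  · have hMq0 := (norm_nonneg _).trans (hMq 0)
    have hMf0 := (norm_nonneg _).trans (hMf 0)
    by_cases h0 : q (p.2.1 + p.1) * wave V ω (p.2.1 + p.1) (p.2.2 - ‖p.1‖) * f p.2 = 0
    · rw [h0, abs_zero]; positivity
    · obtain ⟨h1, h2, h3, h4⟩ := key p h0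
      rw [abs_mul, abs_mul]
      refine mul_le_mul (mul_le_mul (hMq _) (hM _ _ (by linarith) ?_) (abs_nonneg _) hMq0)
        (hMf _) (abs_nonneg _) (by positivity)
      rw [abs_le] at h4 ⊢
      constructor <;> linarith [norm_nonneg p.1]

include hs in
theorem integrable_front {f : E3 × ℝ → ℝ} (hq : Continuous q) (hf : Continuous f)
    (hfc : HasCompactSupport f) :
    Integrable (fun p : E3 × E3 =>
      q (p.2 + p.1) * f (p.2, ⟪p.2, ω⟫_ℝ + (‖p.1‖ + ⟪p.1, ω⟫_ℝ))) (newton.prod volume) := by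
  obtain ⟨R, hR0, hR⟩ := exists_radius hfc
  have hc : Continuous fun p : E3 × E3 =>
      q (p.2 + p.1) * f (p.2, ⟪p.2, ω⟫_ℝ + (‖p.1‖ + ⟪p.1, ω⟫_ℝ)) := by fun_prop
  refine hc.integrable_of_hasCompactSupport (HasCompactSupport.intro
    (K := Metric.closedBall 0 (1 + R) ×ˢ Metric.closedBall 0 R)
    ((isCompact_closedBall _ _).prod (isCompact_closedBall _ _)) fun p hp => ?_)
  by_contra h0
  have h1 := norm_le_one_of_ne_zero hs (left_ne_zero_of_mul h0)
  have h2 := (hR _ _ (right_ne_zero_of_mul h0)).1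
  have : ‖p.1‖ ≤ ‖p.2 + p.1‖ + ‖p.2‖ := by simpa using norm_sub_le (p.2 + p.1) p.2
  refine hp ⟨?_, by simpa using h2⟩
  rw [mem_closedBall_zero_iff]
  linarith

include hV hs in
theorem integrable_wave_mul {f : E3 × ℝ → ℝ} (hf : Continuous f) (hfc : HasCompactSupport f) :
    Integrable fun z : E3 × ℝ => wave V ω z.1 z.2 * f z := by
  obtain ⟨R, hR0, hR⟩ := exists_radius hfc
  obtain ⟨Mf, hMf⟩ := hf.bounded_above_of_compact_support hfc
  obtain ⟨M, hM0, hM⟩ := wave_bounded hV.smooth.continuous ω R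
  refine integrable_of_bounded_of_compact (C := Metric.closedBall 0 R ×ˢ Metric.closedBall 0 R)
    (M := M * Mf) ((measurable_wave hV.smooth.continuous ω).mul hf.measurable)
    ((isCompact_closedBall _ _).prod (isCompact_closedBall _ _)) (fun z hz => ?_) fun z hz => ?_
  · obtain ⟨h1, h2⟩ := hR z.1 z.2 (right_ne_zero_of_mul hz)
    exact ⟨by simpa using h1, by simpa using h2⟩
  · rw [abs_mul]
    exact mul_le_mul (hM _ _ (by simpa using hz.1) (by simpa using hz.2)) (hMf _) (abs_nonneg _)
      hM0

include hJ in
/-- The contribution of the wave front to the integral of the singly scattered wave. -/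
theorem _root_.integral_front {g : ℝ → ℝ} (hq : Continuous q) (hg : Measurable g) (x : E3)
    (hi : Integrable (fun z => q (x + z) * g (⟪x, ω⟫_ℝ + (‖z‖ + ⟪z, ω⟫_ℝ))) newton) :
    ∫ t, (if ⟪x, ω⟫_ℝ ≤ t then ∫ ζ : E2, q (x + parab ω J (t - ⟪x, ω⟫_ℝ, ζ)) else 0) * g t =
      ∫ z, q (x + z) * g (⟪x, ω⟫_ℝ + (‖z‖ + ⟪z, ω⟫_ℝ)) ∂newton := by
  have hc : Measurable fun z => q (x + z) * g (⟪x, ω⟫_ℝ + (‖z‖ + ⟪z, ω⟫_ℝ)) :=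
    (by fun_prop : Measurable fun z => q (x + z)).mul (hg.comp (by fun_prop))
  have hi' : Integrable (fun p : ℝ × E2 => q (x + parab ω J p) * g (⟪x, ω⟫_ℝ +
      (‖parab ω J p‖ + ⟪parab ω J p, ω⟫_ℝ))) ((volume.restrict (Ioi (0 : ℝ))).prod volume) :=
    (hJ.measurePreserving_parab.integrable_comp hc.aestronglyMeasurable).2 hi
  rw [hJ.integral_newton hc, halfSpace, integral_prod _ hi', integral_shear ω
    (fun x t => (if ⟪x, ω⟫_ℝ ≤ t then ∫ ζ : E2, q (x + parab ω J (t - ⟪x, ω⟫_ℝ, ζ)) else 0) *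
      g t), ← integral_Ici_eq_integral_Ioi,
    ← integral_indicator measurableSet_Ici]
  congr 1
  funext a
  by_cases ha : 0 ≤ a
  · rw [indicator_of_mem (show a ∈ Ici (0 : ℝ) from ha), if_pos (by linarith),
      add_sub_cancel_right, ← integral_mul_const]
    refine integral_congr_ae (Eventually.of_forall fun ζ => ?_)
    simp only
    congr 2
    rw [hJ.inner_parab, hJ.norm_parab ha]
    ring
  · rw [indicator_of_notMem (show a ∉ Ici (0 : ℝ) from ha), if_neg (by linarith), zero_mul]

include hs in
theorem _root_.integrable_front_newton {f : E3 × ℝ → ℝ} (hq : Continuous q) (hf : Continuous f)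
    (x : E3) :
    Integrable (fun z => q (x + z) * f (x, ⟪x, ω⟫_ℝ + (‖z‖ + ⟪z, ω⟫_ℝ))) newton := by
  have hc : Continuous fun z => q (x + z) * f (x, ⟪x, ω⟫_ℝ + (‖z‖ + ⟪z, ω⟫_ℝ)) := by fun_prop
  refine hc.integrable_of_hasCompactSupport (HasCompactSupport.intro
    (isCompact_closedBall 0 (1 + ‖x‖)) fun z hz => ?_)
  by_contra h0
  have h1 := norm_le_one_of_ne_zero hs (left_ne_zero_of_mul h0)
  have : ‖z‖ ≤ ‖x + z‖ + ‖x‖ := by simpa using norm_sub_le (x + z) x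
  refine hz ?_
  rw [mem_closedBall_zero_iff]
  linarith

include hV hq hs hJ in
/-- The weak form of the Lippmann–Schwinger equation. -/
theorem weak_eq {f : E3 × ℝ → ℝ} (hf : Continuous f) (hfc : HasCompactSupport f) :
    ∫ z : E3 × ℝ, wave V ω z.1 z.2 * f z = -(1 / (4 * Real.pi)) *
      ((∫ y, q y * advanced f y ⟪y, ω⟫_ℝ) +
        ∫ z : E3 × ℝ, q z.1 * wave V ω z.1 z.2 * advanced f z.1 z.2) := by
  have hi1 := hV.integrable_wave_prod (ω := ω) hq hs hf hfc
  have hm1 := hV.measurable_wave_prod (ω := ω) hq hf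
  set S : E3 × ℝ → ℝ := fun z =>
    if ⟪z.1, ω⟫_ℝ ≤ z.2 then ∫ ζ : E2, q (z.1 + parab ω J (z.2 - ⟪z.1, ω⟫_ℝ, ζ)) else 0 with hS
  set T : E3 × ℝ → ℝ := fun z =>
    ∫ w, q (z.1 + w) * wave V ω (z.1 + w) (z.2 - ‖w‖) ∂newton with hT
  have hwave : ∀ z : E3 × ℝ, wave V ω z.1 z.2 = -(1 / (4 * Real.pi)) * (S z + T z) :=
    fun z => hV.wave_eq_ite hs hJ hq z.1 z.2
  have hTf : Integrable fun z => T z * f z := by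
    refine hi1.integral_prod_right.congr (Eventually.of_forall fun z => ?_)
    simp only [hT, integral_mul_const]
  have hSf : Integrable fun z => S z * f z := by
    refine (((hV.integrable_wave_mul (ω := ω) hs hf hfc).const_mul (-(4 * Real.pi))).sub hTf).congr
      (Eventually.of_forall fun z => ?_)
    simp only [hwave z, Pi.sub_apply]
    have := Real.pi_ne_zero
    field_simp
    ring
  have e1 : ∫ z, T z * f z =
      ∫ z : E3 × ℝ, q z.1 * wave V ω z.1 z.2 * advanced f z.1 z.2 := by
    have : (volume : Measure (E3 × ℝ)).IsAddRightInvariant := by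
      rw [Measure.volume_eq_prod]; infer_instance
    have h1 := integral_newton_shift (c := fun z => ((z, ‖z‖) : E3 × ℝ)) hm1 hi1 (by fun_prop)
    simp only [hT, ← integral_mul_const]
    refine h1.trans (integral_congr_ae (Eventually.of_forall fun z => ?_))
    simp [advanced, integral_const_mul]
    left
    rfl
  have e2 : ∫ z, S z * f z = ∫ y, q y * advanced f y ⟪y, ω⟫_ℝ := by
    have h1 := integral_newton_shift (c := fun z => z) (H := fun p : E3 × E3 =>
      q (p.2 + p.1) * f (p.2, ⟪p.2, ω⟫_ℝ + (‖p.1‖ + ⟪p.1, ω⟫_ℝ))) (by fun_prop)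
      (integrable_front hs hq hf hfc) (by fun_prop)
    rw [Measure.volume_eq_prod, integral_prod _ hSf]
    have h2 : ∀ x : E3, Measurable fun t => f (x, t) := fun x => by fun_prop
    have h3 := fun x => integral_front hJ hq (h2 x) x (integrable_front_newton hs hq hf x)
    simp only [hS, h3]
    refine h1.trans (integral_congr_ae (Eventually.of_forall fun y => ?_))
    simp only [advanced, ← integral_const_mul]
    refine integral_congr_ae (Eventually.of_forall fun z => ?_)
    simp [inner_add_left]
    ring_nf
    simp
  simp_rw [← e1, ← e2]
  rw [← integral_add hSf hTf, ← integral_const_mul]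
  refine integral_congr_ae (Eventually.of_forall fun z => ?_)
  simp only [hwave z]
  ring

end IsProfile

/-! ### The d'Alembert operator in null coordinates -/

/-- The second derivative of a function on space-time, as a bilinear form. -/
def hess (f : E3 × ℝ → ℝ) (z u v : E3 × ℝ) : ℝ := fderiv ℝ (fderiv ℝ f) z u v

/-- The `i`-th standard basis vector of `ℝ³`. -/
def stdVec (i : Fin 3) : E3 := EuclideanSpace.basisFun (Fin 3) ℝ i

/-- The d'Alembert operator `∂_t² - Δ`. -/
def box (f : E3 × ℝ → ℝ) (z : E3 × ℝ) : ℝ :=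
  hess f z (0, 1) (0, 1) - ∑ i, hess f z (stdVec i, 0) (stdVec i, 0)

theorem hasFDerivAt_fderiv_apply {f : E3 × ℝ → ℝ} (hf : ContDiff ℝ 2 f) (v z : E3 × ℝ) :
    HasFDerivAt (fun z => fderiv ℝ f z v) ((fderiv ℝ (fderiv ℝ f) z).flip v) z := by
  have h1 : Differentiable ℝ (fderiv ℝ f) :=
    (hf.fderiv_right (m := 1) (by norm_num)).differentiable one_ne_zero
  have h2 := (h1 z).hasFDerivAt.clm_apply (hasFDerivAt_const v z)
  refine h2.congr_fderiv ?_
  ext <;> simp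

theorem hess_symm {f : E3 × ℝ → ℝ} (hf : ContDiff ℝ 2 f) (z u v : E3 × ℝ) :
    hess f z u v = hess f z v u :=
  (hf.contDiffAt.isSymmSndFDerivAt (by simp)) u v

theorem hess_add_left (f : E3 × ℝ → ℝ) (z u v w : E3 × ℝ) :
    hess f z (u + v) w = hess f z u w + hess f z v w := by simp [hess]

theorem hess_add_right (f : E3 × ℝ → ℝ) (z u v w : E3 × ℝ) :
    hess f z u (v + w) = hess f z u v + hess f z u w := by simp [hess]

theorem hess_smul_left (f : E3 × ℝ → ℝ) (z u v : E3 × ℝ) (c : ℝ) :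
    hess f z (c • u) v = c * hess f z u v := by simp [hess]

theorem hess_smul_right (f : E3 × ℝ → ℝ) (z u v : E3 × ℝ) (c : ℝ) :
    hess f z u (c • v) = c * hess f z u v := by simp [hess]

theorem contDiff_hess {f : E3 × ℝ → ℝ} (hf : ContDiff ℝ (⊤ : ℕ∞) f) (u v : E3 × ℝ) :
    ContDiff ℝ (⊤ : ℕ∞) fun z => hess f z u v :=
  (((hf.fderiv_right (m := (⊤ : ℕ∞)) (by simp)).fderiv_right (m := (⊤ : ℕ∞)) (by simp)).clm_apply
    contDiff_const).clm_apply contDiff_const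

theorem contDiff_box {f : E3 × ℝ → ℝ} (hf : ContDiff ℝ (⊤ : ℕ∞) f) :
    ContDiff ℝ (⊤ : ℕ∞) (box f) :=
  (contDiff_hess hf _ _).sub (ContDiff.sum fun _ _ => contDiff_hess hf _ _)

theorem waveOp_eq {f : E3 × ℝ → ℝ} (hf : ContDiff ℝ (⊤ : ℕ∞) f) (q : E3 → ℝ) (z : E3 × ℝ) :
    waveOp q f z = box f z + q z.1 * f z := by
  have hf2 : ContDiff ℝ 2 f := (contDiff_infty.1 hf) 2
  have hd : Differentiable ℝ f := hf.differentiable (by simp)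
  rw [waveOp, box]
  congr 2
  · have h1 : deriv (fun s : ℝ => f (z.1, s)) = fun s => fderiv ℝ f (z.1, s) (0, 1) := by
      funext s
      have := (hd (z.1, s)).hasFDerivAt.comp_hasDerivAt s
        ((hasDerivAt_const s z.1).prodMk (hasDerivAt_id s))
      exact this.deriv
    rw [iteratedDeriv_succ, iteratedDeriv_one, h1]
    have := (hasFDerivAt_fderiv_apply hf2 (0, 1) z).comp_hasDerivAt z.2
        ((hasDerivAt_const z.2 z.1).prodMk (hasDerivAt_id z.2))
    exact this.deriv
  · rw [congrFun (InnerProductSpace.laplacian_eq_iteratedFDeriv_orthonormalBasis _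
      (EuclideanSpace.basisFun (Fin 3) ℝ)) z.1]
    refine Finset.sum_congr rfl fun i _ => ?_
    have h1 : fderiv ℝ (fun y : E3 => f (y, z.2)) = fun y =>
        (fderiv ℝ f (y, z.2)).comp (ContinuousLinearMap.inl ℝ E3 ℝ) := by
      funext y
      exact ((hd (y, z.2)).hasFDerivAt.comp y (hasFDerivAt_prodMk_left y z.2)).fderiv
    rw [iteratedFDeriv_two_apply, h1]
    have h2 : Differentiable ℝ (fderiv ℝ f) :=
      (hf2.fderiv_right (m := 1) (by norm_num)).differentiable one_ne_zero
    have h3 : HasFDerivAt (fun y => fderiv ℝ f (y, z.2))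
        ((fderiv ℝ (fderiv ℝ f) z).comp (ContinuousLinearMap.inl ℝ E3 ℝ)) z.1 :=
      (h2 z).hasFDerivAt.comp z.1 (hasFDerivAt_prodMk_left z.1 z.2)
    have h4 := h3.clm_comp (hasFDerivAt_const (ContinuousLinearMap.inl ℝ E3 ℝ) z.1)
    rw [h4.fderiv]
    simp [hess, stdVec]

theorem integral_fderiv_eq_zero {E : Type} [NormedAddCommGroup E] [InnerProductSpace ℝ E]
    [FiniteDimensional ℝ E] [MeasurableSpace E] [BorelSpace E] {h : E → ℝ} (hh : ContDiff ℝ 1 h)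
    (hc : HasCompactSupport h) (v : E) : ∫ ζ, fderiv ℝ h ζ v = 0 := by
  have h1 := integral_mul_fderiv_eq_neg_fderiv_mul_of_integrable (μ := (volume : Measure E))
    (f := fun _ => (1 : ℝ)) (g := h) (v := v) (by simp) ?_ ?_ (by simp)
    (fun x _ => hh.differentiable one_ne_zero x)
  · simpa using h1
  · simp only [one_mul]
    exact ((hh.continuous_fderiv one_ne_zero).clm_apply
      continuous_const).integrable_of_hasCompactSupport (hc.fderiv_apply (𝕜 := ℝ) v)
  · simpa using hh.continuous.integrable_of_hasCompactSupport hc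

/-- The third coordinate direction. -/
def axis : E3 := stdVec 2

theorem norm_stdVec (i : Fin 3) : ‖stdVec i‖ = 1 :=
  (EuclideanSpace.basisFun (Fin 3) ℝ).orthonormal.1 i

theorem inner_stdVec {i j : Fin 3} (h : i ≠ j) : ⟪stdVec i, stdVec j⟫_ℝ = 0 :=
  (EuclideanSpace.basisFun (Fin 3) ℝ).orthonormal.2 h

/-- The inclusion of the plane spanned by the first two coordinate directions. -/
def planeIncl : E2 →ₗᵢ[ℝ] E3 where
  toFun ζ := ζ 0 • stdVec 0 + ζ 1 • stdVec 1
  map_add' ζ η := by simp [add_smul]; abel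
  map_smul' c ζ := by simp [mul_smul]
  norm_map' ζ := by
    have h1 : ‖ζ 0 • stdVec 0 + ζ 1 • stdVec 1‖ ^ 2 = ‖ζ‖ ^ 2 := by
      rw [norm_add_sq_real, inner_smul_left, inner_smul_right, inner_stdVec (by decide),
        norm_smul, norm_smul, norm_stdVec, norm_stdVec, EuclideanSpace.real_norm_sq_eq]
      simp
    exact (sq_eq_sq₀ (norm_nonneg _) (norm_nonneg _)).1 h1

theorem planeIncl_apply (ζ : E2) : planeIncl ζ = ζ 0 • stdVec 0 + ζ 1 • stdVec 1 := rfl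

theorem isFrame_planeIncl : IsFrame axis planeIncl := by
  refine ⟨norm_stdVec 2, fun ζ => ?_⟩
  rw [planeIncl_apply, axis, inner_add_left, inner_smul_left, inner_smul_left,
    inner_stdVec (by decide), inner_stdVec (by decide)]
  simp

/-- The point of the forward light cone of `(x, t)` with paraboloid coordinates `(r², ζ)`. -/
def conePoint (x : E3) (t : ℝ) (p : ℝ × E2) : E3 × ℝ :=
  (x + (p.1 • planeIncl p.2 + ((p.1 ^ 2 - ‖p.2‖ ^ 2) / 2) • axis), t + (p.1 ^ 2 + ‖p.2‖ ^ 2) / 2)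

theorem contDiff_conePoint (x : E3) (t : ℝ) : ContDiff ℝ (⊤ : ℕ∞) (conePoint x t) := by
  unfold conePoint
  have h1 : ContDiff ℝ (⊤ : ℕ∞) fun p : ℝ × E2 => planeIncl p.2 :=
    planeIncl.contDiff.comp contDiff_snd
  have h2 : ContDiff ℝ (⊤ : ℕ∞) fun p : ℝ × E2 => ‖p.2‖ ^ 2 := contDiff_snd.norm_sq ℝ
  fun_prop

theorem norm_conePoint (r : ℝ) (ζ : E2) :
    ‖r • planeIncl ζ + ((r ^ 2 - ‖ζ‖ ^ 2) / 2) • axis‖ = (r ^ 2 + ‖ζ‖ ^ 2) / 2 := by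
  refine (sq_eq_sq₀ (norm_nonneg _) (by positivity)).1 ?_
  rw [← map_smul, isFrame_planeIncl.norm_sq_add, norm_smul, Real.norm_eq_abs, mul_pow, sq_abs]
  ring

/-- The null direction `(∂_t + ∂_ω) / 2`. -/
def nullOut : E3 × ℝ := ((1 / 2 : ℝ) • axis, 1 / 2)

/-- The null direction `(∂_t - ∂_ω) / 2`. -/
def nullIn : E3 × ℝ := (-(1 / 2 : ℝ) • axis, 1 / 2)

/-- The d'Alembert operator in null coordinates. -/
theorem box_eq_null {f : E3 × ℝ → ℝ} (hf : ContDiff ℝ 2 f) (z : E3 × ℝ) :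
    box f z = 4 * hess f z nullOut nullIn - (hess f z (stdVec 0, 0) (stdVec 0, 0) +
      hess f z (stdVec 1, 0) (stdVec 1, 0)) := by
  have e1 : nullOut = (1 / 2 : ℝ) • (((0 : E3), (1 : ℝ)) + (stdVec 2, 0)) := by
    ext <;> simp [nullOut, axis]
  have e2 : nullIn = (1 / 2 : ℝ) • (((0 : E3), (1 : ℝ)) + (-1 : ℝ) • (stdVec 2, 0)) := by
    ext <;> simp [nullIn, axis]
  rw [box, e1, e2, Fin.sum_univ_three]
  simp only [hess_add_left, hess_add_right, hess_smul_left, hess_smul_right]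
  rw [hess_symm hf z (stdVec 2, 0) (0, 1)]
  ring

section Kirchhoff

variable {f : E3 × ℝ → ℝ} {ρ : ℝ}

theorem fderiv_eq_zero_of_far (h0 : ∀ x t, ρ < ‖x‖ → f (x, t) = 0) {z : E3 × ℝ}
    (hz : ρ < ‖z.1‖) : fderiv ℝ f z = 0 := by
  have hopen : IsOpen {z : E3 × ℝ | ρ < ‖z.1‖} := isOpen_lt continuous_const (by fun_prop)
  have h1 : f =ᶠ[𝓝 z] fun _ => 0 := by
    filter_upwards [hopen.mem_nhds hz] with w hw using h0 w.1 w.2 hw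
  rw [h1.fderiv_eq]
  simp

theorem hess_eq_zero_of_far (h0 : ∀ x t, ρ < ‖x‖ → f (x, t) = 0) {z : E3 × ℝ}
    (hz : ρ < ‖z.1‖) (u v : E3 × ℝ) : hess f z u v = 0 := by
  have hopen : IsOpen {z : E3 × ℝ | ρ < ‖z.1‖} := isOpen_lt continuous_const (by fun_prop)
  have h1 : fderiv ℝ f =ᶠ[𝓝 z] fun _ => 0 := by
    filter_upwards [hopen.mem_nhds hz] with w hw using fderiv_eq_zero_of_far h0 hw
  rw [hess, h1.fderiv_eq]
  simp

theorem box_eq_zero_of_far (h0 : ∀ x t, ρ < ‖x‖ → f (x, t) = 0) {z : E3 × ℝ}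
    (hz : ρ < ‖z.1‖) : box f z = 0 := by
  simp [box, hess_eq_zero_of_far h0 hz]

theorem norm_le_of_conePoint {x : E3} {t r : ℝ} {ζ : E2} (h : ‖(conePoint x t (r, ζ)).1‖ ≤ ρ) :
    r ^ 2 + ‖ζ‖ ^ 2 ≤ 2 * (ρ + ‖x‖) := by
  have h1 := norm_conePoint r ζ
  have h2 : ‖r • planeIncl ζ + ((r ^ 2 - ‖ζ‖ ^ 2) / 2) • axis‖ ≤
      ‖(conePoint x t (r, ζ)).1‖ + ‖x‖ := by
    have := norm_sub_le (conePoint x t (r, ζ)).1 x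
    simpa [conePoint] using this
  linarith

theorem fiberCompact_cone {g : E3 × ℝ → ℝ} (h0 : ∀ z : E3 × ℝ, ρ < ‖z.1‖ → g z = 0) (x : E3)
    (t : ℝ) : FiberCompact (volume : Measure E2) fun p : ℝ × E2 => g (conePoint x t p) := by
  intro r
  refine ⟨univ, univ_mem, Metric.closedBall 0 (√(2 * (ρ + ‖x‖))), isCompact_closedBall _ _,
    Eventually.of_forall fun ζ r _ hζ => h0 _ ?_⟩
  by_contra! h1
  refine hζ ?_
  rw [mem_closedBall_zero_iff]
  exact Real.le_sqrt_of_sq_le (by nlinarith [norm_le_of_conePoint h1, sq_nonneg r])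

theorem hasDerivAt_conePoint (x : E3) (t r : ℝ) (ζ : E2) :
    HasDerivAt (fun r => conePoint x t (r, ζ)) ((planeIncl ζ, 0) + (2 * r) • nullOut) r := by
  have h1 : HasDerivAt (fun r : ℝ => x + (r • planeIncl ζ + ((r ^ 2 - ‖ζ‖ ^ 2) / 2) • axis))
      (planeIncl ζ + r • axis) r := by
    have := (((hasDerivAt_id r).smul_const (planeIncl ζ)).add
      ((((hasDerivAt_pow 2 r).sub_const (‖ζ‖ ^ 2)).div_const 2).smul_const axis)).const_add x
    refine this.congr_deriv ?_
    simp
  have h2 : HasDerivAt (fun r : ℝ => t + (r ^ 2 + ‖ζ‖ ^ 2) / 2) r r := by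
    have := (((hasDerivAt_pow 2 r).add_const (‖ζ‖ ^ 2)).div_const 2).const_add t
    refine this.congr_deriv ?_
    simp
  refine (h1.prodMk h2).congr_deriv ?_
  ext <;> simp [nullOut] <;> ring

theorem hasFDerivAt_conePoint_snd (x : E3) (t r : ℝ) (ζ v : E2) :
    fderiv ℝ (fun ζ => conePoint x t (r, ζ)) ζ v =
      r • (planeIncl v, 0) + (2 * ⟪ζ, v⟫_ℝ) • nullIn := by
  have h0 : HasFDerivAt (fun ζ : E2 => ‖ζ‖ ^ 2) (2 • innerSL ℝ ζ) ζ :=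
    (hasStrictFDerivAt_norm_sq ζ).hasFDerivAt
  have h1 := (((planeIncl.toContinuousLinearMap.hasFDerivAt (x := ζ)).const_smul r).add
    (((h0.const_sub (r ^ 2)).mul_const (1 / 2)).smul_const axis)).const_add x
  have h2 := ((h0.const_add (r ^ 2)).mul_const (1 / 2)).const_add t
  have h3 := h1.prodMk h2
  have h4 : (fun ζ => conePoint x t (r, ζ)) = fun ζ => (x + (r • planeIncl.toContinuousLinearMap ζ +
      ((r ^ 2 - ‖ζ‖ ^ 2) * (1 / 2)) • axis), t + (r ^ 2 + ‖ζ‖ ^ 2) * (1 / 2)) := by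
    funext ζ
    simp [conePoint, div_eq_mul_inv]
  rw [h4]
  refine (congrArg (fun L => L v) h3.fderiv).trans ?_
  ext <;> simp [nullIn] <;> ring

end Kirchhoff

/-! ### Kirchhoff's formula -/

section Kirchhoff

variable {f : E3 × ℝ → ℝ} {ρ : ℝ}

theorem integrable_mul_cone {g : E3 × ℝ → ℝ} (hg : Continuous g)
    (h0 : ∀ z : E3 × ℝ, ρ < ‖z.1‖ → g z = 0) {c : E2 → ℝ} (hc : Continuous c) (x : E3) (t r : ℝ) :
    Integrable fun ζ => c ζ * g (conePoint x t (r, ζ)) :=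
  ((fiberCompact_cone h0 x t).mono (g := fun p : ℝ × E2 => c p.2 * g (conePoint x t p))
    fun p hp => by simp [hp]).integrable
      ((hc.comp continuous_snd).mul (hg.comp (contDiff_conePoint x t).continuous)) r

/-- Integration by parts along the paraboloid: the integrand is the derivative, in the direction of the
`i`-th coordinate of `ζ`, of a compactly supported function of `ζ`. -/
theorem integral_hess_cone (hf : ContDiff ℝ (⊤ : ℕ∞) f) (h0 : ∀ x t, ρ < ‖x‖ → f (x, t) = 0)
    (x : E3) (t r : ℝ) (i : Fin 2) (v : E3)
    (hv : v = planeIncl (EuclideanSpace.basisFun (Fin 2) ℝ i)) :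
    ∫ ζ : E2, (r * hess f (conePoint x t (r, ζ)) (v, 0) (v, 0) +
      2 * ζ i * hess f (conePoint x t (r, ζ)) nullIn (v, 0)) = 0 := by
  have hf2 : ContDiff ℝ 2 f := (contDiff_infty.1 hf) 2
  have hg : ContDiff ℝ (⊤ : ℕ∞) fun z => fderiv ℝ f z (v, 0) :=
    (hf.fderiv_right (m := (⊤ : ℕ∞)) (by simp)).clm_apply contDiff_const
  have hcone : ContDiff ℝ (⊤ : ℕ∞) fun ζ : E2 => conePoint x t (r, ζ) :=
    (contDiff_conePoint x t).comp (contDiff_prodMk_right r)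
  have h1 : ContDiff ℝ 1 fun ζ : E2 => fderiv ℝ f (conePoint x t (r, ζ)) (v, 0) :=
    (contDiff_infty.1 (hg.comp hcone)) 1
  have h2 : HasCompactSupport fun ζ : E2 => fderiv ℝ f (conePoint x t (r, ζ)) (v, 0) := by
    refine HasCompactSupport.intro (isCompact_closedBall 0 (√(2 * (ρ + ‖x‖)))) fun ζ hζ => ?_
    rw [fderiv_eq_zero_of_far h0]
    · rfl
    · by_contra! h
      refine hζ ?_
      rw [mem_closedBall_zero_iff]
      exact Real.le_sqrt_of_sq_le (by nlinarith [norm_le_of_conePoint h, sq_nonneg r])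
  refine Eq.trans ?_ (integral_fderiv_eq_zero h1 h2 (EuclideanSpace.basisFun (Fin 2) ℝ i))
  refine integral_congr_ae (Eventually.of_forall fun ζ => ?_)
  have h3 := (hasFDerivAt_fderiv_apply hf2 (v, 0) (conePoint x t (r, ζ))).comp ζ
    ((hcone.differentiable (by simp)) ζ).hasFDerivAt
  have h4 := congrArg (fun L => L (EuclideanSpace.basisFun (Fin 2) ℝ i)) h3.fderiv
  refine Eq.trans ?_ h4.symm
  simp only [ContinuousLinearMap.comp_apply, ContinuousLinearMap.flip_apply]
  rw [hasFDerivAt_conePoint_snd, ← hv]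
  have h5 : ⟪ζ, EuclideanSpace.basisFun (Fin 2) ℝ i⟫_ℝ = ζ i := by
    simp [EuclideanSpace.inner_single_right]
  rw [h5]
  change _ = hess f _ (_ + _) _
  rw [hess_add_left, hess_smul_left, hess_smul_left]

/-- The rate of change, in the parameter of the paraboloid, of the integral of an ingoing null
derivative over the paraboloid is half the parameter times the integral of the d'Alembertian. -/
theorem hasDerivAt_integral_cone (hf : ContDiff ℝ (⊤ : ℕ∞) f)
    (h0 : ∀ x t, ρ < ‖x‖ → f (x, t) = 0) (x : E3) (t r : ℝ) :
    HasDerivAt (fun r => ∫ ζ : E2, fderiv ℝ f (conePoint x t (r, ζ)) nullIn)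
      (r / 2 * ∫ ζ : E2, box f (conePoint x t (r, ζ))) r := by
  have hf2 : ContDiff ℝ 2 f := (contDiff_infty.1 hf) 2
  have hg : ContDiff ℝ (⊤ : ℕ∞) fun z => fderiv ℝ f z nullIn :=
    (hf.fderiv_right (m := (⊤ : ℕ∞)) (by simp)).clm_apply contDiff_const
  have hcone := contDiff_conePoint x t
  have hF : ContDiff ℝ 1 fun p : ℝ × E2 => fderiv ℝ f (conePoint x t p) nullIn :=
    (contDiff_infty.1 (hg.comp hcone)) 1
  have hFC : FiberCompact (volume : Measure E2)
      fun p : ℝ × E2 => fderiv ℝ f (conePoint x t p) nullIn :=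
    fiberCompact_cone (g := fun z => fderiv ℝ f z nullIn)
      (fun z hz => by rw [fderiv_eq_zero_of_far h0 hz]; rfl) x t
  have h1 := (hFC.hasFDerivAt_integral hF r).hasDerivAt
  refine h1.congr_deriv ?_
  have hd1 : Differentiable ℝ fun p : ℝ × E2 => fderiv ℝ f (conePoint x t p) nullIn :=
    hF.differentiable one_ne_zero
  rw [ContinuousLinearMap.integral_apply
    ((FiberCompact.fiberDeriv hd1 hFC).integrable
      (ContDiff.fiberDeriv hF (m := 0) (by simp)).continuous r)]
  have h2 : ∀ ζ : E2, fiberDeriv (fun p : ℝ × E2 => fderiv ℝ f (conePoint x t p) nullIn) (r, ζ) 1 =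
      hess f (conePoint x t (r, ζ)) (planeIncl ζ, 0) nullIn +
        2 * r * hess f (conePoint x t (r, ζ)) nullOut nullIn := by
    intro ζ
    have h3 := (hasFDerivAt_fiberDeriv hd1 r ζ).hasDerivAt
    have h4 := (hasFDerivAt_fderiv_apply hf2 nullIn (conePoint x t (r, ζ))).comp_hasDerivAt r
      (hasDerivAt_conePoint x t r ζ)
    rw [h3.unique h4, ContinuousLinearMap.flip_apply, ← hess, hess_add_left, hess_smul_left]
  simp only [h2]
  have hi : ∀ (u v : E3 × ℝ) (c : E2 → ℝ), Continuous c →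
      Integrable fun ζ : E2 => c ζ * hess f (conePoint x t (r, ζ)) u v := fun u v c hc =>
    integrable_mul_cone (contDiff_hess hf u v).continuous
      (fun z hz => hess_eq_zero_of_far h0 hz u v) hc x t r
  have k0 := integral_hess_cone hf h0 x t r 0 (stdVec 0) (by simp [planeIncl_apply])
  have k1 := integral_hess_cone hf h0 x t r 1 (stdVec 1) (by simp [planeIncl_apply])
  have c0 : Continuous fun ζ : E2 => ζ 0 := by fun_prop
  have c1 : Continuous fun ζ : E2 => ζ 1 := by fun_prop
  rw [integral_add (hi _ _ _ continuous_const) (hi _ _ _ (by fun_prop))] at k0 k1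
  have e1 : ∀ ζ : E2, hess f (conePoint x t (r, ζ)) (planeIncl ζ, 0) nullIn +
        2 * r * hess f (conePoint x t (r, ζ)) nullOut nullIn =
      (1 / 2) * (2 * ζ 0 * hess f (conePoint x t (r, ζ)) nullIn (stdVec 0, 0)) +
      (1 / 2) * (2 * ζ 1 * hess f (conePoint x t (r, ζ)) nullIn (stdVec 1, 0)) +
      2 * r * hess f (conePoint x t (r, ζ)) nullOut nullIn := by
    intro ζ
    have e2 : ((planeIncl ζ, 0) : E3 × ℝ) = ζ 0 • (stdVec 0, 0) + ζ 1 • (stdVec 1, 0) := by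
      rw [planeIncl_apply]; ext <;> simp
    rw [e2, hess_add_left, hess_smul_left, hess_smul_left, hess_symm hf2 _ nullIn,
      hess_symm hf2 _ nullIn]
    ring
  have e3 : ∀ ζ : E2, box f (conePoint x t (r, ζ)) =
      4 * hess f (conePoint x t (r, ζ)) nullOut nullIn -
        (1 * hess f (conePoint x t (r, ζ)) (stdVec 0, 0) (stdVec 0, 0) +
          1 * hess f (conePoint x t (r, ζ)) (stdVec 1, 0) (stdVec 1, 0)) := fun ζ => by
    rw [box_eq_null hf2, one_mul, one_mul]
  simp only [e1, e3]
  have i0 := hi nullIn (stdVec 0, 0) (fun ζ => 2 * ζ 0) (by fun_prop)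
  have i1 := hi nullIn (stdVec 1, 0) (fun ζ => 2 * ζ 1) (by fun_prop)
  rw [integral_add ((i0.const_mul _).fun_add (i1.const_mul _)) (hi _ _ _ continuous_const),
    integral_add (i0.const_mul _) (i1.const_mul _),
    integral_sub (hi _ _ _ continuous_const)
      ((hi _ _ _ continuous_const).fun_add (hi _ _ _ continuous_const)),
    integral_add (hi _ _ _ continuous_const) (hi _ _ _ continuous_const)]
  simp only [integral_const_mul] at k0 k1 ⊢
  linear_combination (1 / 2) * k0 + (1 / 2) * k1

/-- For the parameter `0` the paraboloid degenerates to the ray opposite to the axis, which the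
parametrization sweeps with `|ζ|²` as its parameter. -/
theorem integral_cone_zero (hf : ContDiff ℝ (⊤ : ℕ∞) f)
    (h0 : ∀ x t, ρ < ‖x‖ → f (x, t) = 0) (x : E3) (t : ℝ) :
    ∫ ζ : E2, fderiv ℝ f (conePoint x t (0, ζ)) nullIn = -(Real.pi * f (x, t)) := by
  have hd : Differentiable ℝ f := hf.differentiable (by simp)
  set ℓ : ℝ → E3 × ℝ := fun b => (x, t) + b • nullIn with hℓ
  have hℓd : ∀ b, HasDerivAt ℓ nullIn b := fun b =>
    (((hasDerivAt_id b).smul_const nullIn).const_add (x, t)).congr_deriv (one_smul _ _)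
  have hd' : ∀ b, HasDerivAt (fun b => f (ℓ b)) (fderiv ℝ f (ℓ b) nullIn) b := fun b =>
    (hd (ℓ b)).hasFDerivAt.comp_hasDerivAt b (hℓd b)
  have h1 : ∀ ζ : E2, conePoint x t (0, ζ) = ℓ (‖ζ‖ ^ 2) := by
    intro ζ
    simp only [conePoint, hℓ, nullIn]
    ext i
    · simp
      ring
    · simp
      ring
  simp only [h1]
  rw [integral_radial fun b => fderiv ℝ f (ℓ b) nullIn]
  have h2 : ContDiff ℝ 1 fun b => f (ℓ b) :=
    ((contDiff_infty.1 hf) 1).comp (contDiff_const.add (contDiff_id.smul contDiff_const))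
  have h3 : HasCompactSupport fun b => f (ℓ b) := by
    refine HasCompactSupport.intro (isCompact_closedBall 0 (2 * (ρ + ‖x‖))) fun b hb => ?_
    refine h0 _ _ ?_
    rw [mem_closedBall_zero_iff, not_le, Real.norm_eq_abs] at hb
    have h4 : ‖b • (-(1 / 2 : ℝ) • axis)‖ = |b| / 2 := by
      rw [norm_smul, norm_smul, isFrame_planeIncl.norm_eq]
      simp
      ring
    have h5 : ‖b • (-(1 / 2 : ℝ) • axis)‖ ≤ ‖x + b • (-(1 / 2 : ℝ) • axis)‖ + ‖x‖ := by
      have := norm_sub_le (x + b • (-(1 / 2 : ℝ) • axis)) x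
      simpa using this
    change ρ < ‖x + b • (-(1 / 2 : ℝ) • axis)‖
    linarith
  have h4 := h3.integral_Ioi_deriv_eq h2 0
  have h5 : deriv (fun b => f (ℓ b)) = fun b => fderiv ℝ f (ℓ b) nullIn :=
    funext fun b => (hd' b).deriv
  rw [h5] at h4
  rw [h4]
  simp [hℓ]

/-- The advanced potential in paraboloid coordinates; in these it is smooth in `(x, t)`. -/
def conePot (f : E3 × ℝ → ℝ) (P : E3 × ℝ) : ℝ :=
  ∫ p : ℝ × E2, 2 * p.1 * f (conePoint P.1 P.2 p) ∂halfSpace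

theorem integrable_conePot (hf : Continuous f) (h0 : ∀ z : E3 × ℝ, ρ < ‖z.1‖ → f z = 0) (x : E3)
    (t : ℝ) : Integrable (fun p : ℝ × E2 => 2 * p.1 * f (conePoint x t p)) halfSpace := by
  refine Continuous.integrable_of_hasCompactSupport
    ((by fun_prop : Continuous fun p : ℝ × E2 => 2 * p.1).mul
      (hf.comp (contDiff_conePoint x t).continuous)) ?_
  refine HasCompactSupport.intro (isCompact_closedBall 0 (√(2 * (ρ + ‖x‖)))) fun p hp => ?_
  rw [h0, mul_zero]
  by_contra! h
  refine hp ?_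
  have h1 := norm_le_of_conePoint (r := p.1) (ζ := p.2) h
  rw [mem_closedBall_zero_iff]
  refine max_le (Real.le_sqrt_of_sq_le ?_) (Real.le_sqrt_of_sq_le ?_)
  · rw [Real.norm_eq_abs, sq_abs]
    nlinarith [sq_nonneg ‖p.2‖]
  · nlinarith [sq_nonneg p.1]

theorem conePot_eq (hf : Continuous f) (h0 : ∀ z : E3 × ℝ, ρ < ‖z.1‖ → f z = 0) (x : E3) (t : ℝ) :
    conePot f (x, t) = ∫ r in Ioi (0 : ℝ), 2 * r * ∫ ζ : E2, f (conePoint x t (r, ζ)) := by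
  have h1 := integrable_conePot hf h0 x t
  rw [conePot]
  rw [halfSpace] at h1 ⊢
  refine (integral_prod _ h1).trans ?_
  simp only [integral_const_mul]

theorem advanced_eq_conePot (hf : Continuous f) (h0 : ∀ z : E3 × ℝ, ρ < ‖z.1‖ → f z = 0) (x : E3)
    (t : ℝ) : advanced f x t = conePot f (x, t) := by
  have hcont : Continuous fun z : E3 => f (x + z, t + ‖z‖) := hf.comp (by fun_prop)
  have hcs : HasCompactSupport fun z : E3 => f (x + z, t + ‖z‖) := by
    refine HasCompactSupport.intro (isCompact_closedBall 0 (ρ + ‖x‖)) fun z hz => h0 _ ?_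
    rw [mem_closedBall_zero_iff, not_le] at hz
    have := norm_sub_le (x + z) x
    simp only [add_sub_cancel_left] at this
    change ρ < ‖x + z‖
    linarith
  have hint : Integrable (fun z : E3 => f (x + z, t + ‖z‖)) newton :=
    hcont.integrable_of_hasCompactSupport hcs
  have hint' := isFrame_planeIncl.measurePreserving_parab.integrable_comp_of_integrable hint
  rw [advanced, isFrame_planeIncl.integral_newton hcont.measurable, conePot_eq hf h0]
  rw [halfSpace] at hint' ⊢
  refine (integral_prod _ hint').trans ?_
  set H : ℝ → ℝ := fun r => ∫ ζ : E2, f (conePoint x t (r, ζ)) with hH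
  have e1 : ∫ a in Ioi (0 : ℝ), ∫ ζ : E2,
      f (x + parab axis planeIncl (a, ζ), t + ‖parab axis planeIncl (a, ζ)‖) =
      ∫ a in Ioi (0 : ℝ), H (√a) := by
    refine setIntegral_congr_fun measurableSet_Ioi fun a ha => ?_
    refine integral_congr_ae (Eventually.of_forall fun ζ => ?_)
    have ha' : √a ^ 2 = a := Real.sq_sqrt (le_of_lt ha)
    have := norm_conePoint (√a) ζ
    rw [ha'] at this
    simp only [parab, conePoint]
    rw [this, ha']
  refine e1.trans ?_
  rw [← integral_comp_rpow_Ioi_of_pos (p := 2) (by norm_num)]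
  refine setIntegral_congr_fun measurableSet_Ioi fun r hr => ?_
  have h1 : √(r ^ (2 : ℝ)) = r := by
    rw [Real.rpow_two]; exact Real.sqrt_sq (le_of_lt hr)
  have h2 : r ^ ((2 : ℝ) - 1) = r := by norm_num
  simp only [h1, h2, smul_eq_mul, hH]

/-- **Kirchhoff's formula**: the advanced potential inverts the d'Alembert operator. -/
theorem conePot_box (hf : ContDiff ℝ (⊤ : ℕ∞) f) (h0 : ∀ x t, ρ < ‖x‖ → f (x, t) = 0)
    (x : E3) (t : ℝ) : conePot (box f) (x, t) = 4 * Real.pi * f (x, t) := by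
  rw [conePot_eq (contDiff_box hf).continuous fun z hz => box_eq_zero_of_far h0 hz]
  set H : ℝ → ℝ := fun r => ∫ ζ : E2, box f (conePoint x t (r, ζ)) with hH
  set G : ℝ → ℝ := fun r => ∫ ζ : E2, fderiv ℝ f (conePoint x t (r, ζ)) nullIn with hG
  have hGd := fun r => hasDerivAt_integral_cone hf h0 x t r
  have e2 : ∫ r in Ioi (0 : ℝ), 2 * r * H r = ∫ r in Ioi (0 : ℝ), 4 * deriv G r := by
    refine setIntegral_congr_fun measurableSet_Ioi fun r hr => ?_
    simp only [(hGd r).deriv, hG, hH]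
    ring
  rw [e2, integral_const_mul]
  have hG1 : ContDiff ℝ 1 G := by
    have hg : ContDiff ℝ (⊤ : ℕ∞) fun z => fderiv ℝ f z nullIn :=
      (hf.fderiv_right (m := (⊤ : ℕ∞)) (by simp)).clm_apply contDiff_const
    refine (fiberCompact_cone (ρ := ρ) (g := fun z => fderiv ℝ f z nullIn) (fun z hz => ?_)
      x t).contDiff_integral_nat (F := ℝ)
      (f := fun p : ℝ × E2 => fderiv ℝ f (conePoint x t p) nullIn) 1
      ((contDiff_infty.1 (hg.comp (contDiff_conePoint x t))) 1)
    rw [fderiv_eq_zero_of_far h0 hz]; rfl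
  have hGc : HasCompactSupport G := by
    refine HasCompactSupport.intro (isCompact_closedBall 0 (√(2 * (ρ + ‖x‖)))) fun r hr => ?_
    refine integral_eq_zero_of_ae (Eventually.of_forall fun ζ => ?_)
    change fderiv ℝ f (conePoint x t (r, ζ)) nullIn = 0
    rw [fderiv_eq_zero_of_far h0]
    · rfl
    · by_contra! h
      refine hr ?_
      rw [mem_closedBall_zero_iff]
      refine Real.le_sqrt_of_sq_le ?_
      rw [Real.norm_eq_abs, sq_abs]
      nlinarith [norm_le_of_conePoint h, sq_nonneg ‖ζ‖]
  have hG0 : G 0 = -(Real.pi * f (x, t)) := integral_cone_zero hf h0 x t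
  rw [hGc.integral_Ioi_deriv_eq hG1 0, hG0]
  ring

theorem advanced_box (hf : ContDiff ℝ (⊤ : ℕ∞) f) (h0 : ∀ x t, ρ < ‖x‖ → f (x, t) = 0)
    (x : E3) (t : ℝ) : advanced (box f) x t = 4 * Real.pi * f (x, t) := by
  rw [advanced_eq_conePot (contDiff_box hf).continuous fun z hz => box_eq_zero_of_far h0 hz,
    conePot_box hf h0]

end Kirchhoff

/-! ### The backward problem with a potential -/

section ConePotential

variable {f : E3 × ℝ → ℝ} {ρ : ℝ}

/-- The point `conePoint x t p` as a function of `((x, t), p)`. -/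
def conePath (p : (E3 × ℝ) × (ℝ × E2)) : E3 × ℝ := conePoint p.1.1 p.1.2 p.2

theorem conePoint_eq (P : E3 × ℝ) (z : ℝ × E2) : conePoint P.1 P.2 z = P + conePoint 0 0 z := by
  simp only [conePoint, zero_add]
  rfl

theorem contDiff_conePath : ContDiff ℝ (⊤ : ℕ∞) conePath := by
  have h : conePath = fun p => p.1 + conePoint 0 0 p.2 := funext fun p => conePoint_eq _ _
  rw [h]
  exact contDiff_fst.add ((contDiff_conePoint 0 0).comp contDiff_snd)

theorem fiberCompact_conePot (h0 : ∀ z : E3 × ℝ, ρ < ‖z.1‖ → f z = 0) :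
    FiberCompact halfSpace fun p : (E3 × ℝ) × (ℝ × E2) => 2 * p.2.1 * f (conePath p) := by
  intro P₀
  set R := ‖P₀‖ + 1
  refine ⟨Metric.closedBall 0 R, Metric.closedBall_mem_nhds_of_mem (by simp [R]),
    Metric.closedBall 0 (√(2 * (ρ + R))), isCompact_closedBall _ _,
    Eventually.of_forall fun z P hP hz => ?_⟩
  have hPR : ‖P.1‖ ≤ R := (norm_fst_le P).trans (by simpa using hP)
  change 2 * z.1 * f (conePath (P, z)) = 0
  rw [h0, mul_zero]
  by_contra! h
  refine hz ?_
  have h1 := norm_le_of_conePoint (r := z.1) (ζ := z.2) h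
  rw [mem_closedBall_zero_iff]
  refine max_le (Real.le_sqrt_of_sq_le ?_) (Real.le_sqrt_of_sq_le ?_)
  · rw [Real.norm_eq_abs, sq_abs]
    nlinarith [sq_nonneg ‖z.2‖]
  · nlinarith [sq_nonneg z.1]

theorem contDiff_conePot_integrand (hf : ContDiff ℝ (⊤ : ℕ∞) f) :
    ContDiff ℝ (⊤ : ℕ∞) fun p : (E3 × ℝ) × (ℝ × E2) => 2 * p.2.1 * f (conePath p) :=
  (by fun_prop : ContDiff ℝ (⊤ : ℕ∞) fun p : (E3 × ℝ) × (ℝ × E2) => 2 * p.2.1).mul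
    (hf.comp contDiff_conePath)

theorem contDiff_conePot (hf : ContDiff ℝ (⊤ : ℕ∞) f) (h0 : ∀ z : E3 × ℝ, ρ < ‖z.1‖ → f z = 0) :
    ContDiff ℝ (⊤ : ℕ∞) (conePot f) :=
  (fiberCompact_conePot h0).contDiff_integral (contDiff_conePot_integrand hf)

/-- The potential commutes with derivatives, being a superposition of translates. -/
theorem fderiv_conePot (hf : ContDiff ℝ (⊤ : ℕ∞) f) (h0 : ∀ x t, ρ < ‖x‖ → f (x, t) = 0)
    (P v : E3 × ℝ) : fderiv ℝ (conePot f) P v = conePot (fun z => fderiv ℝ f z v) P := by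
  have hF := contDiff_conePot_integrand hf
  have hF1 := (contDiff_infty.1 hF) 1
  have hC := fiberCompact_conePot (f := f) fun z hz => h0 z.1 z.2 hz
  have hd := hF1.differentiable one_ne_zero
  have h1 := hC.hasFDerivAt_integral hF1 P
  refine (congrArg (fun L => L v) h1.fderiv).trans ?_
  rw [ContinuousLinearMap.integral_apply ((FiberCompact.fiberDeriv hd hC).integrable
    (ContDiff.fiberDeriv hF1 (m := 0) (by simp)).continuous P)]
  refine integral_congr_ae (Eventually.of_forall fun z => ?_)
  have h2 := hasFDerivAt_fiberDeriv hd P z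
  have h3 : HasFDerivAt (fun P' : E3 × ℝ => 2 * z.1 * f (P' + conePoint 0 0 z))
      ((2 * z.1) • fderiv ℝ f (P + conePoint 0 0 z)) P := by
    have h4 := ((hf.differentiable (by simp)) (P + conePoint 0 0 z)).hasFDerivAt.comp P
      ((hasFDerivAt_id P).add_const (conePoint 0 0 z))
    exact h4.const_mul (2 * z.1)
  have h4 : (fun P' : E3 × ℝ => 2 * z.1 * f (P' + conePoint 0 0 z)) =
      fun P' => 2 * z.1 * f (conePath (P', z)) := by
    funext P'
    rw [conePath, conePoint_eq]
  rw [h4] at h3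
  simp only
  rw [h2.unique h3, conePoint_eq]
  rfl

theorem hess_conePot (hf : ContDiff ℝ (⊤ : ℕ∞) f) (h0 : ∀ x t, ρ < ‖x‖ → f (x, t) = 0)
    (P u v : E3 × ℝ) : hess (conePot f) P u v = conePot (fun z => hess f z u v) P := by
  have h1 := contDiff_conePot hf fun z hz => h0 z.1 z.2 hz
  have h2 := (hasFDerivAt_fderiv_apply ((contDiff_infty.1 h1) 2) v P).fderiv
  have h3 : hess (conePot f) P u v = fderiv ℝ (fun z => fderiv ℝ (conePot f) z v) P u := by
    rw [h2]; rfl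
  have h4 : (fun z => fderiv ℝ (conePot f) z v) = conePot fun z => fderiv ℝ f z v :=
    funext fun z => fderiv_conePot hf h0 z v
  have h5 : ContDiff ℝ (⊤ : ℕ∞) fun z => fderiv ℝ f z v :=
    (hf.fderiv_right (m := (⊤ : ℕ∞)) (by simp)).clm_apply contDiff_const
  have h6 : ∀ x t, ρ < ‖x‖ → (fun z => fderiv ℝ f z v) (x, t) = 0 := fun x t hx => by
    simp [fderiv_eq_zero_of_far h0 (z := (x, t)) hx]
  have h7 : (fun z => fderiv ℝ (fun z => fderiv ℝ f z v) z u) = fun z => hess f z u v := by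
    funext z
    rw [(hasFDerivAt_fderiv_apply ((contDiff_infty.1 hf) 2) v z).fderiv]
    rfl
  rw [h3, h4, fderiv_conePot h5 h6, h7]

theorem conePot_sub {g : E3 × ℝ → ℝ} (hf : Continuous f) (h0 : ∀ z : E3 × ℝ, ρ < ‖z.1‖ → f z = 0)
    (hg : Continuous g) (h1 : ∀ z : E3 × ℝ, ρ < ‖z.1‖ → g z = 0) (P : E3 × ℝ) :
    conePot (fun z => f z - g z) P = conePot f P - conePot g P := by
  simp only [conePot, mul_sub]
  exact integral_sub (integrable_conePot hf h0 _ _) (integrable_conePot hg h1 _ _)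

theorem conePot_add {g : E3 × ℝ → ℝ} (hf : Continuous f) (h0 : ∀ z : E3 × ℝ, ρ < ‖z.1‖ → f z = 0)
    (hg : Continuous g) (h1 : ∀ z : E3 × ℝ, ρ < ‖z.1‖ → g z = 0) (P : E3 × ℝ) :
    conePot (fun z => f z + g z) P = conePot f P + conePot g P := by
  simp only [conePot, mul_add]
  exact integral_add (integrable_conePot hf h0 _ _) (integrable_conePot hg h1 _ _)

theorem box_conePot (hf : ContDiff ℝ (⊤ : ℕ∞) f) (h0 : ∀ x t, ρ < ‖x‖ → f (x, t) = 0)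
    (P : E3 × ℝ) : box (conePot f) P = 4 * Real.pi * f P := by
  have hc : ∀ u v, Continuous fun z => hess f z u v := fun u v => (contDiff_hess hf u v).continuous
  have hz : ∀ u v, ∀ z : E3 × ℝ, ρ < ‖z.1‖ → hess f z u v = 0 := fun u v z hz =>
    hess_eq_zero_of_far h0 hz u v
  have h1 : box (conePot f) P = conePot (box f) P := by
    have h2 : box f = fun z => hess f z (0, 1) (0, 1) - ((hess f z (stdVec 0, 0) (stdVec 0, 0) +
        hess f z (stdVec 1, 0) (stdVec 1, 0)) + hess f z (stdVec 2, 0) (stdVec 2, 0)) := by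
      funext z
      rw [box, Fin.sum_univ_three]
    have c1 : Continuous fun z => hess f z (stdVec 0, 0) (stdVec 0, 0) +
        hess f z (stdVec 1, 0) (stdVec 1, 0) := (hc _ _).add (hc _ _)
    have z1 : ∀ z : E3 × ℝ, ρ < ‖z.1‖ → hess f z (stdVec 0, 0) (stdVec 0, 0) +
        hess f z (stdVec 1, 0) (stdVec 1, 0) = 0 := fun z h => by
      rw [hz _ _ z h, hz _ _ z h, add_zero]
    have c2 : Continuous fun z => hess f z (stdVec 0, 0) (stdVec 0, 0) +
        hess f z (stdVec 1, 0) (stdVec 1, 0) + hess f z (stdVec 2, 0) (stdVec 2, 0) :=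
      c1.add (hc _ _)
    rw [h2, conePot_sub (hc _ _) (hz _ _) c2
      (fun z h => by rw [z1 z h, hz _ _ z h, add_zero]),
      conePot_add c1 z1 (hc _ _) (hz _ _), conePot_add (hc _ _) (hz _ _) (hc _ _) (hz _ _), box,
      Fin.sum_univ_three]
    simp only [hess_conePot hf h0]
  rw [h1]
  exact conePot_box hf h0 P.1 P.2

end ConePotential

section Backward

/-- The scalar kernel of the integral equation for the backward problem; the last factor switches
the kernel off for late times. -/
def backwardCoeff (q : E3 → ℝ) (T : ℝ) (p : (E3 × ℝ) × (ℝ × E2)) : ℝ :=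
  -(1 / (4 * Real.pi)) * (2 * p.2.1 * (q (conePath p).1 *
    Real.smoothTransition (T + 1 - (conePath p).2)))

/-- The kernel of the integral equation for the backward problem, as a family of operators. -/
def backwardKernel (q : E3 → ℝ) (T : ℝ) (p : (E3 × ℝ) × (ℝ × E2)) : ℝ →L[ℝ] ℝ :=
  backwardCoeff q T p • ContinuousLinearMap.id ℝ ℝ

theorem contDiff_backwardKernel {q : E3 → ℝ} (hq : ContDiff ℝ (⊤ : ℕ∞) q) (T : ℝ) :
    ContDiff ℝ (⊤ : ℕ∞) (backwardKernel q T) := by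
  have h : ContDiff ℝ (⊤ : ℕ∞) (backwardCoeff q T) :=
    contDiff_const.mul ((contDiff_const.mul (contDiff_fst.comp contDiff_snd)).mul
    ((hq.comp (contDiff_fst.comp contDiff_conePath)).mul (Real.smoothTransition.contDiff.comp
      (contDiff_const.sub (contDiff_snd.comp contDiff_conePath)))))
  exact h.smul contDiff_const

theorem integral_mul_exp_neg_sq {lam : ℝ} (hl : 0 < lam) :
    ∫ m in Ioi (0 : ℝ), m * Real.exp (-lam * m ^ 2) = 1 / (2 * lam) := by
  have h1 : ∀ m ∈ Ici (0 : ℝ), HasDerivAt (fun m => -(Real.exp (-lam * m ^ 2) / (2 * lam)))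
      (m * Real.exp (-lam * m ^ 2)) m := by
    intro m _
    have h2 := (((hasDerivAt_pow 2 m).const_mul (-lam)).exp.div_const (2 * lam)).neg
    refine h2.congr_deriv ?_
    field_simp
    simp
    ring
  have h2 : Tendsto (fun m : ℝ => -(Real.exp (-lam * m ^ 2) / (2 * lam))) atTop (𝓝 0) := by
    have h3 : Tendsto (fun m : ℝ => -lam * m ^ 2) atTop atBot :=
      (tendsto_pow_atTop two_ne_zero).const_mul_atTop_of_neg (neg_lt_zero.2 hl)
    simpa using ((Real.tendsto_exp_atBot.comp h3).div_const (2 * lam)).neg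
  rw [integral_Ioi_of_hasDerivAt_of_tendsto' h1 (integrable_mul_exp_neg_mul_sq hl).integrableOn h2]
  simp

/-- The contraction property, with the weight `exp (-λ t)` for large `λ`. -/
theorem isVolterra_backwardKernel {q : E3 → ℝ} (hq : ContDiff ℝ (⊤ : ℕ∞) q)
    (hs : tsupport q ⊆ Metric.closedBall 0 1) (T : ℝ) :
    IsVolterra halfSpace (backwardKernel q T) conePath := by
  intro P₀
  set R := ‖P₀‖ + |T| + 2 with hRdef
  have hR0 : 0 ≤ ‖P₀‖ + |T| := by positivity
  set R' := √(2 * (1 + R)) with hR'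
  have hsupp : ∀ p, p ∈ tsupport (backwardKernel q T) →
      ‖(conePath p).1‖ ≤ 1 ∧ (conePath p).2 ≤ T + 1 := by
    intro p hp
    have hclosed : IsClosed {p : (E3 × ℝ) × (ℝ × E2) |
        ‖(conePath p).1‖ ≤ 1 ∧ (conePath p).2 ≤ T + 1} :=
      (isClosed_le (continuous_fst.comp contDiff_conePath.continuous).norm continuous_const).inter
        (isClosed_le (continuous_snd.comp contDiff_conePath.continuous) continuous_const)
    refine closure_minimal (s := Function.support (backwardKernel q T)) (fun p hp => ?_) hclosed hp
    have h2 : backwardCoeff q T p ≠ 0 := fun h0 => hp (by simp [backwardKernel, h0])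
    have h3 := right_ne_zero_of_mul (right_ne_zero_of_mul h2)
    refine ⟨by simpa using hs (subset_tsupport _ (left_ne_zero_of_mul h3)), ?_⟩
    by_contra! h4
    exact right_ne_zero_of_mul h3 (Real.smoothTransition.zero_of_nonpos (by linarith))
  have hball : ∀ P ∈ Metric.closedBall (0 : E3 × ℝ) R, ∀ z : ℝ × E2,
      (P, z) ∈ tsupport (backwardKernel q T) → |z.1| ≤ R' ∧ ‖z.2‖ ≤ R' := by
    intro P hP z h0
    have hPR : ‖P.1‖ ≤ R := (norm_fst_le P).trans (by simpa using hP)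
    have h1 := norm_le_of_conePoint (r := z.1) (ζ := z.2) (hsupp _ h0).1
    constructor <;> refine Real.le_sqrt_of_sq_le ?_
    · rw [sq_abs]
      nlinarith [sq_nonneg ‖z.2‖]
    · nlinarith [sq_nonneg z.1]
  refine ⟨Metric.closedBall 0 R, Metric.closedBall_mem_nhds_of_mem ?_,
    isCompact_closedBall _ _, ⟨Metric.closedBall 0 R', isCompact_closedBall _ _,
    Eventually.of_forall fun z P hP h0 => ?_⟩, fun c hc => ?_⟩
  · rw [mem_ball_zero_iff]
    linarith [abs_nonneg T]
  · obtain ⟨h1, h2⟩ := hsupp _ h0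
    obtain ⟨h3, h4⟩ := hball P hP z h0
    refine ⟨by rw [mem_closedBall_zero_iff]; exact max_le h3 h4, ?_⟩
    rw [mem_closedBall_zero_iff] at hP ⊢
    refine max_le (h1.trans (by linarith)) (abs_le.2 ⟨?_, ?_⟩)
    · have h5 := (abs_le.1 ((norm_snd_le P).trans hP)).1
      have h6 : P.2 ≤ (conePath (P, z)).2 := by
        simp only [conePath, conePoint]
        have : 0 ≤ (z.1 ^ 2 + ‖z.2‖ ^ 2) / 2 := by positivity
        linarith
      linarith
    · linarith [le_abs_self T, norm_nonneg P₀]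
  · have hqc : HasCompactSupport q := (isCompact_closedBall _ _).of_isClosed_subset
      (isClosed_tsupport q) hs
    obtain ⟨Mq, hMq⟩ := hq.continuous.bounded_above_of_compact_support hqc
    have hMq0 : 0 ≤ Mq := (norm_nonneg _).trans (hMq 0)
    set vol := (volume : Measure E2).real (Metric.closedBall 0 R') with hvol
    have hvol0 : 0 ≤ vol := measureReal_nonneg
    set D := (1 / (4 * Real.pi)) * (2 * Mq) with hD
    have hD0 : 0 ≤ D := by positivity
    set lam := 2 * c * D * vol + 1 with hlam
    have hlam0 : 0 < lam := by positivity
    refine ⟨fun P => Real.exp (-lam * P.2), by fun_prop, fun P => Real.exp_pos _, fun P hP => ?_⟩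
    set g : ℝ → ℝ := fun m => D * Real.exp (-lam * P.2) * (m * Real.exp (-(lam / 2) * m ^ 2)) with hg
    set b : E2 → ℝ := (Metric.closedBall 0 R').indicator fun _ => 1 with hb
    have hbi : Integrable b := (integrable_indicator_iff
      Metric.isClosed_closedBall.measurableSet).2
        (integrableOn_const (isCompact_closedBall _ _).measure_lt_top.ne)
    have hgi : Integrable g (volume.restrict (Ioi (0 : ℝ))) :=
      ((integrable_mul_exp_neg_mul_sq (half_pos hlam0)).const_mul _).integrableOn
    have hle : ∫ z, ‖backwardKernel q T (P, z)‖ * Real.exp (-lam * (conePath (P, z)).2) ∂halfSpace ≤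
        (∫ m in Ioi (0 : ℝ), g m) * vol := by
      have h1 : vol = ∫ ξ, b ξ := by
        rw [hb, integral_indicator Metric.isClosed_closedBall.measurableSet]
        simp [hvol, Measure.real]
      rw [h1, halfSpace, ← integral_prod_mul]
      refine integral_mono_of_nonneg (Eventually.of_forall fun z => ?_) (hgi.mul_prod hbi) ?_
      · positivity
      · filter_upwards [Measure.quasiMeasurePreserving_fst.ae (ae_restrict_mem measurableSet_Ioi)]
          with z hz
        have hz0 : 0 ≤ z.1 := le_of_lt hz
        by_cases h0 : (P, z) ∈ tsupport (backwardKernel q T)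
        · have h3 : b z.2 = 1 := by simp [hb, (hball P hP z h0).2]
          rw [h3, mul_one, backwardKernel, norm_smul, ContinuousLinearMap.norm_id, mul_one,
            Real.norm_eq_abs]
          have h4 : |backwardCoeff q T (P, z)| ≤ D * z.1 := by
            rw [backwardCoeff, abs_mul, abs_neg, abs_mul, abs_mul (q _),
              abs_of_nonneg (show (0 : ℝ) ≤ 1 / (4 * Real.pi) by positivity),
              abs_of_nonneg (show 0 ≤ 2 * z.1 by positivity),
              abs_of_nonneg (Real.smoothTransition.nonneg _)]
            calc _ ≤ 1 / (4 * Real.pi) * (2 * z.1 * (Mq * 1)) := by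
                  gcongr
                  · exact Real.smoothTransition.nonneg _
                  · exact hMq _
                  · exact Real.smoothTransition.le_one _
              _ = _ := by rw [hD]; ring
          have h5 : Real.exp (-lam * (conePath (P, z)).2) ≤
              Real.exp (-lam * P.2) * Real.exp (-(lam / 2) * z.1 ^ 2) := by
            rw [← Real.exp_add]
            refine Real.exp_le_exp.2 ?_
            simp only [conePath, conePoint]
            nlinarith [mul_nonneg hlam0.le (sq_nonneg ‖z.2‖)]
          calc _ ≤ D * z.1 * (Real.exp (-lam * P.2) * Real.exp (-(lam / 2) * z.1 ^ 2)) := by gcongr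
            _ = g z.1 := by rw [hg]; ring
        · have h5 : backwardKernel q T (P, z) = 0 := image_eq_zero_of_notMem_tsupport h0
          simp only [h5, norm_zero, zero_mul]
          refine mul_nonneg ?_ (indicator_nonneg (fun _ _ => zero_le_one) _)
          positivity
    have hgint : ∫ m in Ioi (0 : ℝ), g m = D * Real.exp (-lam * P.2) / lam := by
      rw [hg, integral_const_mul, integral_mul_exp_neg_sq (half_pos hlam0)]
      field_simp
    rw [hgint] at hle
    calc _ ≤ c * (D * Real.exp (-lam * P.2) / lam * vol) := by gcongr
      _ = (2 * c * D * vol / lam) * (1 / 2 * Real.exp (-lam * P.2)) := by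
          field_simp
      _ ≤ 1 * (1 / 2 * Real.exp (-lam * P.2)) := by
          gcongr
          exact (div_le_one hlam0).2 (by linarith)
      _ = _ := one_mul _

/-- The backward problem for the wave equation with potential: every test function is the image of
a smooth function that vanishes outside a backward light cone. -/
theorem exists_backward {q : E3 → ℝ} (hq : ContDiff ℝ (⊤ : ℕ∞) q)
    (hs : tsupport q ⊆ Metric.closedBall 0 1) {ψ : E3 × ℝ → ℝ} (hψ : ContDiff ℝ (⊤ : ℕ∞) ψ)
    (hψc : HasCompactSupport ψ) :
    ∃ φ : E3 × ℝ → ℝ, ContDiff ℝ (⊤ : ℕ∞) φ ∧ (∀ z, waveOp q φ z = ψ z) ∧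
      ∃ R, ∀ x t, φ (x, t) ≠ 0 → t ≤ R ∧ ‖x‖ ≤ R - t := by
  obtain ⟨T, hT0, hT⟩ := exists_radius hψc
  set ρ := max T 1 with hρ
  have hψ0 : ∀ z : E3 × ℝ, ρ < ‖z.1‖ → ψ z = 0 := fun z hz => by
    by_contra h
    exact absurd ((hT z.1 z.2 h).1.trans (le_max_left _ _)) (not_le.2 hz)
  have hA := contDiff_backwardKernel hq T
  have hvol := isVolterra_backwardKernel hq hs T
  set φ₀ : E3 × ℝ → ℝ := fun P => 1 / (4 * Real.pi) * conePot ψ P with hφ₀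
  have hφ₀s : ContDiff ℝ (⊤ : ℕ∞) φ₀ := contDiff_const.mul (contDiff_conePot hψ hψ0)
  obtain ⟨φ, hφ, hφeq⟩ := volterra_exists_contDiff hA contDiff_conePath hvol hφ₀s
  set χ : ℝ → ℝ := fun t => Real.smoothTransition (T + 1 - t) with hχ
  have hχs : ContDiff ℝ (⊤ : ℕ∞) χ :=
    Real.smoothTransition.contDiff.comp (contDiff_const.sub contDiff_id)
  set g : E3 × ℝ → ℝ := fun z => q z.1 * χ z.2 * φ z with hg
  have hgs : ContDiff ℝ (⊤ : ℕ∞) g :=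
    ((hq.comp contDiff_fst).mul (hχs.comp contDiff_snd)).mul hφ
  have hg0 : ∀ z : E3 × ℝ, ρ < ‖z.1‖ → g z = 0 := fun z hz => by
    have : q z.1 = 0 := by
      by_contra h
      exact absurd ((norm_le_one_of_ne_zero hs h).trans (le_max_right T 1)) (not_le.2 hz)
    simp [hg, this]
  have hop : ∀ P, volterraOp halfSpace (backwardKernel q T) conePath φ P =
      -(1 / (4 * Real.pi)) * conePot g P := by
    intro P
    rw [volterraOp, conePot, ← integral_const_mul]
    refine integral_congr_ae (Eventually.of_forall fun z => ?_)
    simp only [backwardKernel, backwardCoeff, hg, hχ, conePath, smul_apply,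
      ContinuousLinearMap.id_apply, smul_eq_mul]
    ring
  set F : E3 × ℝ → ℝ := fun z => ψ z - g z with hF
  have hFs : ContDiff ℝ (⊤ : ℕ∞) F := hψ.sub hgs
  have hF0 : ∀ z : E3 × ℝ, ρ < ‖z.1‖ → F z = 0 := fun z hz => by
    simp [hF, hψ0 z hz, hg0 z hz]
  have hφF : φ = fun P => 1 / (4 * Real.pi) * conePot F P := by
    funext P
    rw [hφeq, hop, hF, conePot_sub hψ.continuous hψ0 hgs.continuous hg0]
    ring
  -- nothing happens after the time at which the source is switched off
  have hlate : ∀ P ∈ {P : E3 × ℝ | T < P.2}, φ P = 0 := by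
    intro P hP
    refine volterra_eq_zero hA.continuous contDiff_conePath.continuous hvol hφ₀s.continuous
      hφ.continuous hφeq (S := {P : E3 × ℝ | T < P.2}) (fun P hP z => ?_) (fun P hP => ?_) hP
    · change T < P.2 at hP
      change T < P.2 + (z.1 ^ 2 + ‖z.2‖ ^ 2) / 2
      have : 0 ≤ (z.1 ^ 2 + ‖z.2‖ ^ 2) / 2 := by positivity
      linarith
    · have : ∀ z : ℝ × E2, ψ (conePoint P.1 P.2 z) = 0 := fun z => by
        by_contra h
        have h1 := (le_abs_self _).trans (hT _ _ h).2
        have h2 : 0 ≤ (z.1 ^ 2 + ‖z.2‖ ^ 2) / 2 := by positivity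
        have hP' : T < P.2 := hP
        linarith
      simp [hφ₀, conePot, this]
  refine ⟨φ, hφ, fun z => ?_, ρ + T, fun x t h => ?_⟩
  · have hbox : box φ z = F z := by
      have h1 : box φ z = 1 / (4 * Real.pi) * box (conePot F) z := by
        have hcp := contDiff_conePot hFs hF0
        have h2 : ∀ u v, hess φ z u v = 1 / (4 * Real.pi) * hess (conePot F) z u v := by
          intro u v
          have h3 : fderiv ℝ φ = fun z => (1 / (4 * Real.pi)) • fderiv ℝ (conePot F) z := by
            rw [hφF]
            funext z
            exact fderiv_const_mul ((hcp.differentiable (by simp)) z) _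
          have h4 : DifferentiableAt ℝ (fderiv ℝ (conePot F)) z :=
            ((hcp.fderiv_right (m := (⊤ : ℕ∞)) (by simp)).differentiable (by simp)) z
          rw [hess, h3, fderiv_fun_const_smul h4]
          rfl
        simp only [box, h2, mul_sub, Finset.mul_sum]
      rw [h1, box_conePot hFs fun x t h => hF0 (x, t) h]
      have := Real.pi_pos.ne'
      field_simp
    rw [waveOp_eq hφ, hbox]
    by_cases h : T < z.2
    · simp [hF, hg, hlate z h]
    · have : χ z.2 = 1 := Real.smoothTransition.one_of_one_le (by linarith)
      simp [hF, hg, this]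
  · rw [hφF] at h
    obtain ⟨p, hp⟩ : ∃ p : ℝ × E2, F (conePoint x t p) ≠ 0 := by
      by_contra! h0
      exact h (by simp [conePot, h0])
    have h1 : ‖(conePoint x t p).1‖ ≤ ρ := by
      by_contra! h2
      exact hp (hF0 _ h2)
    have h2 : (conePoint x t p).2 ≤ T := by
      by_contra! h2
      have h3 : ψ (conePoint x t p) = 0 := by
        by_contra h4
        exact absurd ((le_abs_self _).trans (hT _ _ h4).2) (not_le.2 h2)
      exact hp (by simp [hF, hg, h3, hlate _ h2])
    have h3 := norm_conePoint p.1 p.2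
    have h4 : ‖x‖ ≤ ‖(conePoint x t p).1‖ + (p.1 ^ 2 + ‖p.2‖ ^ 2) / 2 := by
      have := norm_sub_le (conePoint x t p).1
        (p.1 • planeIncl p.2 + ((p.1 ^ 2 - ‖p.2‖ ^ 2) / 2) • axis)
      rw [h3] at this
      simpa [conePoint] using this
    simp only [conePoint] at h2
    have h5 : 0 ≤ (p.1 ^ 2 + ‖p.2‖ ^ 2) / 2 := by positivity
    have h6 : 0 ≤ ρ := hT0.trans (le_max_left _ _)
    exact ⟨by linarith, by linarith⟩

end Backward

/-! ### Uniqueness of the distribution solution -/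

theorem box_eventuallyEq {f g : E3 × ℝ → ℝ} {z : E3 × ℝ} (h : f =ᶠ[𝓝 z] g) :
    box f z = box g z := by
  have h1 : fderiv ℝ (fderiv ℝ f) z = fderiv ℝ (fderiv ℝ g) z := h.fderiv.fderiv_eq
  simp only [box, hess, h1]

theorem sum_inner_sq {ω : E3} (hω : ‖ω‖ = 1) : ∑ i, ⟪stdVec i, ω⟫_ℝ ^ 2 = 1 := by
  have := (EuclideanSpace.basisFun (Fin 3) ℝ).sum_sq_inner_right ω
  simp only [stdVec]
  rw [this, hω, one_pow]

/-- The plane wave `δ(t - x · ω)` solves the free wave equation. -/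
theorem planeWave_box {ω : E3} (hω : ‖ω‖ = 1) {f : E3 × ℝ → ℝ} (hf : ContDiff ℝ (⊤ : ℕ∞) f)
    (hfc : HasCompactSupport f) : planeWave ω (box f) = 0 := by
  have hf2 : ContDiff ℝ 2 f := (contDiff_infty.1 hf) 2
  obtain ⟨R, hR0, hR⟩ := exists_radius hfc
  have h0 : ∀ x t, R < ‖x‖ → f (x, t) = 0 := fun x t hx => by
    by_contra h
    exact absurd (hR x t h).1 (not_le.2 hx)
  set L : E3 →L[ℝ] E3 × ℝ := (ContinuousLinearMap.id ℝ E3).prod (innerSL ℝ ω) with hL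
  have hLx : ∀ x, L x = (x, ⟪x, ω⟫_ℝ) := fun x => by simp [hL, real_inner_comm]
  have hg : ∀ v : E3 × ℝ, ContDiff ℝ 1 fun x => fderiv ℝ f (L x) v := fun v =>
    (((hf2.fderiv_right (m := 1) (by norm_num)).clm_apply contDiff_const).comp L.contDiff)
  have hgc : ∀ v : E3 × ℝ, HasCompactSupport fun x => fderiv ℝ f (L x) v := fun v => by
    refine HasCompactSupport.intro (isCompact_closedBall 0 R) fun x hx => ?_
    rw [mem_closedBall_zero_iff, not_le] at hx
    rw [fderiv_eq_zero_of_far h0 (by simpa [hLx] using hx)]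
    rfl
  have hd : ∀ (v : E3 × ℝ) (x u : E3),
      fderiv ℝ (fun x => fderiv ℝ f (L x) v) x u = hess f (L x) (L u) v := by
    intro v x u
    have h1 := (hasFDerivAt_fderiv_apply hf2 v (L x)).comp x L.hasFDerivAt
    exact congrArg (fun M => M u) h1.fderiv
  have key : ∀ x, box f (L x) = -∑ i, fderiv ℝ (fun x => fderiv ℝ f (L x)
      ((stdVec i, 0) + (-⟪stdVec i, ω⟫_ℝ) • ((0 : E3), (1 : ℝ)))) x (stdVec i) := by
    intro x
    have e1 : ∀ i, L (stdVec i) = (stdVec i, 0) + ⟪stdVec i, ω⟫_ℝ • ((0 : E3), (1 : ℝ)) := by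
      intro i
      rw [hLx]
      ext <;> simp
    have e2 : ∀ i, fderiv ℝ (fun x => fderiv ℝ f (L x)
        ((stdVec i, 0) + (-⟪stdVec i, ω⟫_ℝ) • ((0 : E3), (1 : ℝ)))) x (stdVec i) =
        hess f (L x) (stdVec i, 0) (stdVec i, 0) -
          ⟪stdVec i, ω⟫_ℝ ^ 2 * hess f (L x) (0, 1) (0, 1) := by
      intro i
      rw [hd, e1]
      simp only [hess_add_left, hess_add_right, hess_smul_left, hess_smul_right]
      rw [hess_symm hf2 _ (stdVec i, 0) (0, 1)]
      ring
    simp only [e2]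
    rw [Finset.sum_sub_distrib, ← Finset.sum_mul, sum_inner_sq hω, box]
    ring
  have h1 : planeWave ω (box f) = ∫ x, box f (L x) := by
    simp only [planeWave, hLx]
  rw [h1]
  simp only [key]
  rw [integral_neg, integral_finsetSum]
  · simp [integral_fderiv_eq_zero (hg _) (hgc _)]
  · intro i _
    exact (((hg _).continuous_fderiv one_ne_zero).clm_apply
      continuous_const).integrable_of_hasCompactSupport ((hgc _).fderiv_apply (𝕜 := ℝ) _)

section Representation

variable {q : E3 → ℝ} {V : ParamSpace → ℝ} {ω : E3}

theorem contDiff_waveOp (hq : ContDiff ℝ (⊤ : ℕ∞) q) {f : E3 × ℝ → ℝ}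
    (hf : ContDiff ℝ (⊤ : ℕ∞) f) : ContDiff ℝ (⊤ : ℕ∞) (waveOp q f) := by
  have h : waveOp q f = fun z => box f z + q z.1 * f z := funext fun z => waveOp_eq hf q z
  rw [h]
  exact (contDiff_box hf).add ((hq.comp contDiff_fst).mul hf)

theorem HasCompactSupport.box {f : E3 × ℝ → ℝ} (hf : HasCompactSupport f) :
    HasCompactSupport (box f) := by
  refine HasCompactSupport.intro hf.isCompact fun z hz => ?_
  have h1 : f =ᶠ[𝓝 z] fun _ => 0 := notMem_tsupport_iff_eventuallyEq.1 hz
  rw [box_eventuallyEq h1]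
  simp [_root_.box, hess]

theorem HasCompactSupport.waveOp {f : E3 × ℝ → ℝ} (hf : HasCompactSupport f)
    (hfs : ContDiff ℝ (⊤ : ℕ∞) f) : HasCompactSupport (waveOp q f) := by
  have h : _root_.waveOp q f = fun z => _root_.box f z + q z.1 * f z :=
    funext fun z => waveOp_eq hfs q z
  rw [h]
  exact hf.box.add hf.mul_left

theorem integrable_planeWave {f : E3 × ℝ → ℝ} (hf : Continuous f) (hfc : HasCompactSupport f)
    (ω : E3) : Integrable fun x => f (x, ⟪x, ω⟫_ℝ) := by
  obtain ⟨R, hR0, hR⟩ := exists_radius hfc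
  refine Continuous.integrable_of_hasCompactSupport (hf.comp (by fun_prop))
    (HasCompactSupport.intro (isCompact_closedBall 0 R) fun x hx => ?_)
  by_contra h
  exact hx (by simpa using (hR _ _ h).1)

/-- The sum of the plane wave and the scattered wave is a weak solution of the wave equation with
potential. -/
theorem IsProfile.weak_solution (hV : IsProfile q V) (hq : ContDiff ℝ (⊤ : ℕ∞) q)
    (hs : tsupport q ⊆ Metric.closedBall 0 1) (hω : ‖ω‖ = 1) {f : E3 × ℝ → ℝ}
    (hf : ContDiff ℝ (⊤ : ℕ∞) f) (hfc : HasCompactSupport f) :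
    planeWave ω (waveOp q f) + ∫ z : E3 × ℝ, wave V ω z.1 z.2 * waveOp q f z = 0 := by
  obtain ⟨J, hJ⟩ := exists_isFrame hω
  obtain ⟨R, hR0, hR⟩ := exists_radius hfc
  have h0 : ∀ x t, R < ‖x‖ → f (x, t) = 0 := fun x t hx => by
    by_contra h
    exact absurd (hR x t h).1 (not_le.2 hx)
  have hb := (contDiff_box hf).continuous
  have hqf : Continuous fun z : E3 × ℝ => q z.1 * f z :=
    (hq.continuous.comp continuous_fst).mul hf.continuous
  have hqfc : HasCompactSupport fun z : E3 × ℝ => q z.1 * f z := hfc.mul_left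
  have e1 : planeWave ω (waveOp q f) = ∫ x, q x * f (x, ⟪x, ω⟫_ℝ) := by
    have h1 : planeWave ω (waveOp q f) =
        planeWave ω (box f) + ∫ x, q x * f (x, ⟪x, ω⟫_ℝ) := by
      simp only [planeWave, waveOp_eq hf]
      exact integral_add (integrable_planeWave hb hfc.box ω) (integrable_planeWave hqf hqfc ω)
    rw [h1, planeWave_box hω hf hfc, zero_add]
  have e2 : ∫ z : E3 × ℝ, wave V ω z.1 z.2 * waveOp q f z =
      (∫ z : E3 × ℝ, wave V ω z.1 z.2 * box f z) +
        ∫ z : E3 × ℝ, wave V ω z.1 z.2 * (q z.1 * f z) := by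
    simp only [waveOp_eq hf, mul_add]
    exact integral_add (hV.integrable_wave_mul hs hb hfc.box) (hV.integrable_wave_mul hs hqf hqfc)
  have e3 := hV.weak_eq hq.continuous hs hJ hb hfc.box
  simp only [advanced_box hf h0] at e3
  have e4 : ∫ y, q y * (4 * Real.pi * f (y, ⟪y, ω⟫_ℝ)) =
      4 * Real.pi * ∫ y, q y * f (y, ⟪y, ω⟫_ℝ) := by
    rw [← integral_const_mul]
    congr 1; funext y; ring
  have e5 : ∫ z : E3 × ℝ, q z.1 * wave V ω z.1 z.2 * (4 * Real.pi * f (z.1, z.2)) =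
      4 * Real.pi * ∫ z : E3 × ℝ, wave V ω z.1 z.2 * (q z.1 * f z) := by
    rw [← integral_const_mul]
    congr 1; funext y; ring
  rw [e1, e2, e3, e4, e5]
  have := Real.pi_ne_zero
  field_simp
  ring

/-- The distribution solution is unique, hence is the sum of the plane wave and the scattered
wave. -/
theorem IsProfile.repr (hV : IsProfile q V) (hq : ContDiff ℝ (⊤ : ℕ∞) q)
    (hs : tsupport q ⊆ Metric.closedBall 0 1) (hω : ‖ω‖ = 1) {U : SpaceTimeDistribution}
    (hU : IsPlaneWaveSolution q ω U) (ψ : SpaceTimeTest) :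
    U ψ = planeWave ω ψ + ∫ z : E3 × ℝ, wave V ω z.1 z.2 * ψ z := by
  obtain ⟨J, hJ⟩ := exists_isFrame hω
  have hψ : ContDiff ℝ (⊤ : ℕ∞) ψ := ψ.contDiff'
  have hψc : HasCompactSupport ψ := ψ.hasCompactSupport'
  obtain ⟨φ, hφ, hφψ, R, hR⟩ := exists_backward hq hs hψ hψc
  -- the backward solution, cut off in the far past
  set g : E3 × ℝ → ℝ := fun z => Real.smoothTransition (z.2 + 3) * φ z with hg
  have hgs : ContDiff ℝ (⊤ : ℕ∞) g :=
    (Real.smoothTransition.contDiff.comp (contDiff_snd.add contDiff_const)).mul hφ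
  have hgc : HasCompactSupport g := by
    refine HasCompactSupport.intro (K := Metric.closedBall 0 (R + 3) ×ˢ Icc (-3) R)
      ((isCompact_closedBall _ _).prod isCompact_Icc) fun z hz => ?_
    by_contra h
    have h1 : -3 ≤ z.2 := by
      by_contra! h2
      exact left_ne_zero_of_mul h (Real.smoothTransition.zero_of_nonpos (by linarith))
    obtain ⟨h2, h3⟩ := hR z.1 z.2 (right_ne_zero_of_mul h)
    exact hz ⟨by rw [mem_closedBall_zero_iff]; linarith, h1, h2⟩
  have hwc : HasCompactSupport (waveOp q g) := hgc.waveOp hgs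
  have hws := contDiff_waveOp hq hgs
  have hlate : ∀ z : E3 × ℝ, -2 < z.2 → waveOp q g z = ψ z := by
    intro z hz
    have h1 : g =ᶠ[𝓝 z] φ := by
      filter_upwards [(isOpen_lt continuous_const continuous_snd).mem_nhds hz] with w hw
      have hw' : -2 < w.2 := hw
      simp only [hg]
      rw [Real.smoothTransition.one_of_one_le (by linarith), one_mul]
    rw [waveOp_eq hgs, box_eventuallyEq h1, h1.eq_of_nhds, ← waveOp_eq hφ, hφψ]
  let G : SpaceTimeTest := ⟨g, hgs, hgc, subset_univ _⟩
  let W : SpaceTimeTest := ⟨waveOp q g, hws, hwc, subset_univ _⟩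
  have hUW : U W = 0 := hU.pde G W fun z => rfl
  have hearly : ∀ z, (ψ - W) z ≠ 0 → z.2 ≤ -2 := by
    intro z hz
    by_contra! h
    refine hz ?_
    change ψ z - waveOp q g z = 0
    rw [hlate z h, sub_self]
  have hsub : tsupport (ψ - W : SpaceTimeTest) ⊆ {z : E3 × ℝ | z.2 < -1} := by
    refine (closure_minimal (t := {z : E3 × ℝ | z.2 ≤ -2}) (fun z hz => hearly z hz)
      (isClosed_le continuous_snd continuous_const)).trans fun z hz => ?_
    have : z.2 ≤ -2 := hz
    change z.2 < -1
    linarith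
  have h1 : U ψ = planeWave ω (ψ - W : SpaceTimeTest) := by
    rw [← hU.init _ hsub, map_sub, hUW, sub_zero]
  have h2 : planeWave ω (ψ - W : SpaceTimeTest) = planeWave ω ψ - planeWave ω (waveOp q g) := by
    simp only [planeWave]
    exact integral_sub (integrable_planeWave hψ.continuous hψc ω)
      (integrable_planeWave hws.continuous hwc ω)
  have h3 : (∫ z : E3 × ℝ, wave V ω z.1 z.2 * ψ z) -
      ∫ z : E3 × ℝ, wave V ω z.1 z.2 * waveOp q g z = 0 := by
    rw [← integral_sub (hV.integrable_wave_mul hs hψ.continuous hψc)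
      (hV.integrable_wave_mul hs hws.continuous hwc)]
    refine integral_eq_zero_of_ae (Eventually.of_forall fun z => ?_)
    simp only [Pi.zero_apply]
    rw [← mul_sub, mul_eq_zero]
    by_contra! h
    have h4 := (hV.wave_support hs hJ h.1).1
    have h5 := hearly z h.2
    linarith
  have h4 := hV.weak_solution hq hs hω hgs hgc
  rw [h1, h2]
  linarith

end Representation

/-! ### Even functions as smooth functions of the square -/

section Even

variable {X F : Type} [NormedAddCommGroup X] [NormedSpace ℝ X] [FiniteDimensional ℝ X]
  [NormedAddCommGroup F] [NormedSpace ℝ F] [CompleteSpace F]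

/-- The derivative of `f (x, s)` in the real variable `s`. -/
def lastDeriv (f : X × ℝ → F) (p : X × ℝ) : F := fderiv ℝ f p (0, 1)

theorem ContDiff.lastDeriv {f : X × ℝ → F} (hf : ContDiff ℝ (⊤ : ℕ∞) f) :
    ContDiff ℝ (⊤ : ℕ∞) (lastDeriv f) :=
  (hf.fderiv_right (m := (⊤ : ℕ∞)) (by simp)).clm_apply contDiff_const

theorem hasDerivAt_lastDeriv {f : X × ℝ → F} (hf : ContDiff ℝ (⊤ : ℕ∞) f) (x : X) (s : ℝ) :
    HasDerivAt (fun s => f (x, s)) (lastDeriv f (x, s)) s :=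
  ((hf.differentiable (by simp)) (x, s)).hasFDerivAt.comp_hasDerivAt s
    ((hasDerivAt_const s x).prodMk (hasDerivAt_id s))

theorem lastDeriv_comp_neg {f : X × ℝ → F} (hf : ContDiff ℝ (⊤ : ℕ∞) f) {c : ℝ}
    (hc : ∀ x s, f (x, -s) = c • f (x, s)) (x : X) (s : ℝ) :
    lastDeriv f (x, -s) = (-c) • lastDeriv f (x, s) := by
  have h1 : HasDerivAt (fun s => f (x, -s)) (-lastDeriv f (x, -s)) s := by
    exact ((hasDerivAt_lastDeriv hf x (-s)).scomp s (hasDerivAt_neg s)).congr_deriv (by simp)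
  have h2 := (hasDerivAt_lastDeriv hf x s).const_smul c
  have h3 := h1.unique (h2.congr_of_eventuallyEq (Eventually.of_forall fun s => hc x s))
  rw [neg_smul, ← h3, neg_neg]

/-- The quotient of the derivative of an even function by twice the variable, as a smooth
function. -/
def evenQuotient (f : X × ℝ → F) (p : X × ℝ) : F :=
  (1 / 2 : ℝ) • ∫ r in Icc (0 : ℝ) 1, lastDeriv (lastDeriv f) (p.1, r * p.2)

theorem contDiff_evenQuotient {f : X × ℝ → F} (hf : ContDiff ℝ (⊤ : ℕ∞) f) :
    ContDiff ℝ (⊤ : ℕ∞) (evenQuotient f) := by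
  refine contDiff_const.smul (FiberCompact.contDiff_integral
    (f := fun z : (X × ℝ) × ℝ => lastDeriv (lastDeriv f) (z.1.1, z.2 * z.1.2))
    (hf.lastDeriv.lastDeriv.comp (by fun_prop)) fun P₀ => ?_)
  refine ⟨univ, univ_mem, Icc 0 1, isCompact_Icc, ?_⟩
  filter_upwards [ae_restrict_mem measurableSet_Icc] with r hr P _ h
  exact absurd hr h

theorem evenQuotient_comp_neg {f : X × ℝ → F} (hf : ContDiff ℝ (⊤ : ℕ∞) f)
    (he : ∀ x s, f (x, -s) = f (x, s)) (x : X) (s : ℝ) :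
    evenQuotient f (x, -s) = evenQuotient f (x, s) := by
  have h1 := lastDeriv_comp_neg hf (c := 1) (fun x s => by rw [one_smul, he])
  have h2 := lastDeriv_comp_neg hf.lastDeriv (c := -1) h1
  simp only [evenQuotient, mul_neg, h2, neg_neg, one_smul]

theorem smul_evenQuotient {f : X × ℝ → F} (hf : ContDiff ℝ (⊤ : ℕ∞) f)
    (he : ∀ x s, f (x, -s) = f (x, s)) (x : X) (s : ℝ) :
    (2 * s) • evenQuotient f (x, s) = lastDeriv f (x, s) := by
  have h1 := lastDeriv_comp_neg hf (c := 1) (fun x s => by rw [one_smul, he]) x 0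
  have h0 : lastDeriv f (x, 0) = 0 := by
    rw [neg_zero, neg_one_smul] at h1
    have h2 : (2 : ℝ) • lastDeriv f (x, 0) = 0 := by
      rw [two_smul]
      exact add_eq_zero_iff_eq_neg.2 h1
    exact (smul_eq_zero.1 h2).resolve_left two_ne_zero
  have h2 : ∀ r ∈ uIcc (0 : ℝ) 1, HasDerivAt (fun r => lastDeriv f (x, r * s))
      (s • lastDeriv (lastDeriv f) (x, r * s)) r := fun r _ =>
    HasDerivAt.scomp (g₁ := fun r => lastDeriv f (x, r)) (h := fun r => r * s) r
      (hasDerivAt_lastDeriv hf.lastDeriv x (r * s)) (hasDerivAt_mul_const s)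
  have h3 : Continuous fun r : ℝ => lastDeriv (lastDeriv f) (x, r * s) :=
    hf.lastDeriv.lastDeriv.continuous.comp (by fun_prop)
  have h4 := intervalIntegral.integral_eq_sub_of_hasDerivAt h2
    (Continuous.intervalIntegrable (u := fun r => s • lastDeriv (lastDeriv f) (x, r * s))
      (h3.const_smul s) _ _)
  simp only [one_mul, zero_mul, h0, sub_zero] at h4
  rw [← h4, evenQuotient, intervalIntegral.integral_smul,
    intervalIntegral.integral_of_le zero_le_one,
    integral_Icc_eq_integral_Ioc, smul_smul]
  congr 1
  ring

/-- The derivative of `f (x, √a)`, as a function of `(x, √a)`. -/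
def sqrtDeriv (f : X × ℝ → F) (p : X × ℝ) : X × ℝ →L[ℝ] F :=
  (fiberDeriv f p).comp (ContinuousLinearMap.fst ℝ X ℝ) +
    (ContinuousLinearMap.snd ℝ X ℝ).smulRight (evenQuotient f p)

theorem contDiff_sqrtDeriv {f : X × ℝ → F} (hf : ContDiff ℝ (⊤ : ℕ∞) f) :
    ContDiff ℝ (⊤ : ℕ∞) (sqrtDeriv f) :=
  ((ContDiff.fiberDeriv hf (m := (⊤ : ℕ∞)) (by simp)).clm_comp contDiff_const).add
    (contDiff_const.smulRight (contDiff_evenQuotient hf))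

theorem sqrtDeriv_comp_neg {f : X × ℝ → F} (hf : ContDiff ℝ (⊤ : ℕ∞) f)
    (he : ∀ x s, f (x, -s) = f (x, s)) (x : X) (s : ℝ) :
    sqrtDeriv f (x, -s) = sqrtDeriv f (x, s) := by
  have hd := hf.differentiable (by simp)
  have h1 := hasFDerivAt_fiberDeriv hd x (-s)
  simp only [he] at h1
  rw [sqrtDeriv, sqrtDeriv, evenQuotient_comp_neg hf he, h1.unique (hasFDerivAt_fiberDeriv hd x s)]

/-- At the boundary the derivative exists because the derivatives in the interior have a limit. -/
theorem hasFDerivWithinAt_comp_sqrt {f : X × ℝ → F} (hf : ContDiff ℝ (⊤ : ℕ∞) f)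
    (he : ∀ x s, f (x, -s) = f (x, s)) (p : X × ℝ) :
    HasFDerivWithinAt (fun p : X × ℝ => f (p.1, √p.2)) (sqrtDeriv f (p.1, √p.2))
      (univ ×ˢ Ici 0) p := by
  have hcl : closure ((univ : Set X) ×ˢ Ioi (0 : ℝ)) = univ ×ˢ Ici 0 := by
    rw [closure_prod_eq, closure_univ, closure_Ioi]
  have hd := hf.differentiable (by simp)
  have hpos : ∀ p : X × ℝ, 0 < p.2 →
      HasFDerivAt (fun p : X × ℝ => f (p.1, √p.2)) (sqrtDeriv f (p.1, √p.2)) p := by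
    intro p hp
    have h1 : HasFDerivAt (fun p : X × ℝ => (p.1, √p.2)) ((ContinuousLinearMap.fst ℝ X ℝ).prod
        ((1 / (2 * √p.2)) • ContinuousLinearMap.snd ℝ X ℝ)) p :=
      hasFDerivAt_fst.prodMk (hasFDerivAt_snd.sqrt hp.ne')
    refine ((hd (p.1, √p.2)).hasFDerivAt.comp p h1).congr_fderiv ?_
    have h2 : 0 < √p.2 := Real.sqrt_pos.2 hp
    have h3 := smul_evenQuotient hf he p.1 (√p.2)
    ext v
    · simp [sqrtDeriv, fiberDeriv]
    · have h5 : evenQuotient f (p.1, √p.2) = (2 * √p.2)⁻¹ • lastDeriv f (p.1, √p.2) := by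
        rw [← h3, smul_smul, inv_mul_cancel₀ (by positivity), one_smul]
      simp only [sqrtDeriv, h5]
      simp [lastDeriv, fiberDeriv]
      have h6 : ((0 : X), (0 : ℝ)) = 0 := rfl
      rw [h6, map_zero, zero_add, ← map_smul]
      simp
  rw [← hcl]
  refine hasFDerivWithinAt_closure_of_tendsto_fderiv
    (fun p hp => (hpos p hp.2).differentiableAt.differentiableWithinAt)
    (convex_univ.prod (convex_Ioi 0)) (isOpen_univ.prod isOpen_Ioi)
    (fun y _ => ?_) ?_
  · exact (hf.continuous.comp
      (by fun_prop : Continuous fun p : X × ℝ => (p.1, √p.2))).continuousWithinAt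
  · have h1 : Continuous fun p : X × ℝ => sqrtDeriv f (p.1, √p.2) :=
      (contDiff_sqrtDeriv hf).continuous.comp (by fun_prop)
    refine (h1.continuousWithinAt (s := univ ×ˢ Ioi 0) (x := p)).tendsto.congr' ?_
    filter_upwards [self_mem_nhdsWithin] with p hp
    exact (hpos p hp.2).fderiv.symm

/-- A smooth function that is even in the real variable `s` is a smooth function of `s²`, up to the
boundary. -/
theorem contDiffOn_comp_sqrt {f : X × ℝ → F} (hf : ContDiff ℝ (⊤ : ℕ∞) f)
    (he : ∀ x s, f (x, -s) = f (x, s)) :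
    ContDiffOn ℝ (⊤ : ℕ∞) (fun p : X × ℝ => f (p.1, √p.2)) (univ ×ˢ Ici 0) := by
  have hu : UniqueDiffOn ℝ ((univ : Set X) ×ˢ Ici (0 : ℝ)) :=
    uniqueDiffOn_univ.prod (uniqueDiffOn_Ici 0)
  refine contDiffOn_infty.2 fun n => ?_
  induction n generalizing F with
  | zero =>
    exact contDiffOn_zero.2 (hf.continuous.comp (by fun_prop)).continuousOn
  | succ n ih =>
    have h1 := hasFDerivWithinAt_comp_sqrt hf he
    refine (contDiffOn_succ_iff_fderivWithin hu).2
      ⟨fun p _ => (h1 p).differentiableWithinAt, fun h => absurd h (WithTop.natCast_ne_top n), ?_⟩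
    refine (ih (contDiff_sqrtDeriv hf) (sqrtDeriv_comp_neg hf he)).congr fun p hp => ?_
    exact (h1 p).fderivWithin (hu p hp)

end Even

/-! ### Regularity of the wave and of the kernel -/

/-- The scattered wave is smooth up to the wave front. -/
theorem contDiffOn_wave {V : ParamSpace → ℝ} (hV : ContDiff ℝ (⊤ : ℕ∞) V)
    (he : ∀ x ω s, V (x, ω, -s) = V (x, ω, s)) (ω : E3) :
    ContDiffOn ℝ (⊤ : ℕ∞) (fun z : E3 × ℝ => wave V ω z.1 z.2)
      {z : E3 × ℝ | ⟪z.1, ω⟫_ℝ ≤ z.2} := by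
  have h1 := contDiffOn_comp_sqrt (f := fun p : E3 × ℝ => V (p.1, ω, p.2))
    (hV.comp (by fun_prop)) (fun x s => he x ω s)
  have h2 : ContDiff ℝ (⊤ : ℕ∞) fun z : E3 × ℝ => (z.1, z.2 - ⟪z.1, ω⟫_ℝ) :=
    contDiff_fst.prodMk (contDiff_snd.sub (contDiff_fst.inner ℝ contDiff_const))
  refine (h1.comp h2.contDiffOn fun z hz => ⟨mem_univ _, ?_⟩).congr fun z hz => ?_
  · have hz' : ⟪z.1, ω⟫_ℝ ≤ z.2 := hz
    exact sub_nonneg.2 hz'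
  · exact wave_of_le hz

/-- The kernel of the backscattering identity in terms of the profiles of the two scattered waves;
the last argument stands for `√(2 (τ - x · ω))`. -/
def kernelProfile (V W : ParamSpace → ℝ) (p : (E3 × E3) × ℝ) : ℝ :=
  2 * (V (p.1.1, p.1.2, p.2) + W (p.1.1, p.1.2, p.2)) +
    4 * p.2 ^ 2 * ∫ θ in Icc (0 : ℝ) (Real.pi / 2),
      V (p.1.1, p.1.2, p.2 * Real.sin θ) * W (p.1.1, p.1.2, p.2 * Real.cos θ) *
        (Real.sin θ * Real.cos θ)

theorem contDiff_kernelProfile {V W : ParamSpace → ℝ} (hV : ContDiff ℝ (⊤ : ℕ∞) V)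
    (hW : ContDiff ℝ (⊤ : ℕ∞) W) : ContDiff ℝ (⊤ : ℕ∞) (kernelProfile V W) := by
  have h1 : ContDiff ℝ (⊤ : ℕ∞) fun p : (E3 × E3) × ℝ => ∫ θ in Icc (0 : ℝ) (Real.pi / 2),
      V (p.1.1, p.1.2, p.2 * Real.sin θ) * W (p.1.1, p.1.2, p.2 * Real.cos θ) *
        (Real.sin θ * Real.cos θ) := by
    refine FiberCompact.contDiff_integral (f := fun z : ((E3 × E3) × ℝ) × ℝ =>
      V (z.1.1.1, z.1.1.2, z.1.2 * Real.sin z.2) * W (z.1.1.1, z.1.1.2, z.1.2 * Real.cos z.2) *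
        (Real.sin z.2 * Real.cos z.2)) ?_ fun P₀ => ?_
    · exact ((hV.comp (by fun_prop)).mul (hW.comp (by fun_prop))).mul (by fun_prop)
    · refine ⟨univ, univ_mem, Icc 0 (Real.pi / 2), isCompact_Icc, ?_⟩
      filter_upwards [ae_restrict_mem measurableSet_Icc] with r hr P _ h
      exact absurd hr h
  unfold kernelProfile
  exact (contDiff_const.mul ((hV.comp (by fun_prop)).add (hW.comp (by fun_prop)))).add
    ((by fun_prop : ContDiff ℝ (⊤ : ℕ∞) fun p : (E3 × E3) × ℝ => 4 * p.2 ^ 2).mul h1)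

/-- The substitution `s = x · ω + m² sin² θ`, with `m² = 2 (τ - x · ω)`, in the inner integral of the
kernel. -/
theorem identityKernel_wave {V W : ParamSpace → ℝ} (hV : Continuous V) (hW : Continuous W)
    {x ω : E3} {τ : ℝ} (h : ⟪x, ω⟫_ℝ ≤ τ) :
    identityKernel (wave V) (wave W) x ω τ =
      kernelProfile V W ((x, ω), √(2 * (τ - ⟪x, ω⟫_ℝ))) := by
  set m := √(2 * (τ - ⟪x, ω⟫_ℝ)) with hm
  have hm0 : 0 ≤ m := Real.sqrt_nonneg _
  have hm2 : m ^ 2 = 2 * (τ - ⟪x, ω⟫_ℝ) := Real.sq_sqrt (by linarith)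
  have e1 : 2 * τ - ⟪x, ω⟫_ℝ - ⟪x, ω⟫_ℝ = m ^ 2 := by rw [hm2]; ring
  set g : ℝ → ℝ := fun s => V (x, ω, √(s - ⟪x, ω⟫_ℝ)) * W (x, ω, √(2 * τ - s - ⟪x, ω⟫_ℝ)) with hg
  have hgc : Continuous g :=
    (hV.comp (by fun_prop)).mul (hW.comp (by fun_prop))
  have e2 : ∫ s in ⟪x, ω⟫_ℝ..(2 * τ - ⟪x, ω⟫_ℝ), wave V ω x s * wave W ω x (2 * τ - s) =
      ∫ s in ⟪x, ω⟫_ℝ..(2 * τ - ⟪x, ω⟫_ℝ), g s := by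
    refine intervalIntegral.integral_congr fun s hs => ?_
    rw [uIcc_of_le (by linarith)] at hs
    simp only [hg]
    rw [wave_of_le hs.1, wave_of_le (by linarith [hs.2])]
  have e3 := intervalIntegral.integral_comp_mul_deriv (a := 0) (b := Real.pi / 2) (g := g)
    (f := fun θ => ⟪x, ω⟫_ℝ + m ^ 2 * Real.sin θ ^ 2)
    (f' := fun θ => 2 * m ^ 2 * (Real.sin θ * Real.cos θ)) (fun θ _ => by
      refine ((((Real.hasDerivAt_sin θ).pow 2).const_mul (m ^ 2)).const_add _).congr_deriv ?_
      simp
      ring) (by fun_prop) hgc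
  have e4 : ⟪x, ω⟫_ℝ + m ^ 2 * Real.sin 0 ^ 2 = ⟪x, ω⟫_ℝ := by simp
  have e5 : ⟪x, ω⟫_ℝ + m ^ 2 * Real.sin (Real.pi / 2) ^ 2 = 2 * τ - ⟪x, ω⟫_ℝ := by
    rw [Real.sin_pi_div_two, hm2]; ring
  rw [e4, e5] at e3
  have e6 : ∫ θ in (0 : ℝ)..(Real.pi / 2),
      (g ∘ fun θ => ⟪x, ω⟫_ℝ + m ^ 2 * Real.sin θ ^ 2) θ * (2 * m ^ 2 * (Real.sin θ * Real.cos θ)) =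
      2 * m ^ 2 * ∫ θ in Icc (0 : ℝ) (Real.pi / 2),
        V (x, ω, m * Real.sin θ) * W (x, ω, m * Real.cos θ) * (Real.sin θ * Real.cos θ) := by
    rw [integral_Icc_eq_integral_Ioc, ← intervalIntegral.integral_of_le (by positivity),
      ← intervalIntegral.integral_const_mul]
    refine intervalIntegral.integral_congr fun θ hθ => ?_
    rw [uIcc_of_le (by positivity)] at hθ
    have hsin : 0 ≤ Real.sin θ := Real.sin_nonneg_of_nonneg_of_le_pi hθ.1
      (hθ.2.trans (by linarith [Real.pi_pos]))
    have hcos : 0 ≤ Real.cos θ := Real.cos_nonneg_of_neg_pi_div_two_le_of_le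
      (by linarith [hθ.1, Real.pi_pos]) hθ.2
    have s1 : √(⟪x, ω⟫_ℝ + m ^ 2 * Real.sin θ ^ 2 - ⟪x, ω⟫_ℝ) = m * Real.sin θ := by
      rw [← Real.sqrt_sq (mul_nonneg hm0 hsin)]
      congr 1; ring
    have s2 : √(2 * τ - (⟪x, ω⟫_ℝ + m ^ 2 * Real.sin θ ^ 2) - ⟪x, ω⟫_ℝ) = m * Real.cos θ := by
      rw [← Real.sqrt_sq (mul_nonneg hm0 hcos)]
      congr 1
      rw [mul_pow, Real.cos_sq', mul_sub, ← e1]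
      ring
    simp only [hg, Function.comp_apply, s1, s2]
    ring
  rw [identityKernel, kernelProfile, e2, ← e3, e6, wave_of_le (by linarith),
    wave_of_le (by linarith), e1, Real.sqrt_sq hm0]
  ring

/-- The kernel is smooth up to the boundary because its profile is smooth and even. -/
theorem contDiffOn_identityKernel {V W : ParamSpace → ℝ} (hV : ContDiff ℝ (⊤ : ℕ∞) V)
    (hW : ContDiff ℝ (⊤ : ℕ∞) W) (hVe : ∀ x ω s, V (x, ω, -s) = V (x, ω, s))
    (hWe : ∀ x ω s, W (x, ω, -s) = W (x, ω, s)) :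
    ContDiffOn ℝ (⊤ : ℕ∞)
      (fun z : E3 × E3 × ℝ => identityKernel (wave V) (wave W) z.1 z.2.1 z.2.2) kernelRegion := by
  have h1 := contDiffOn_comp_sqrt (contDiff_kernelProfile hV hW) fun x s => by
    simp [kernelProfile, hVe, hWe, neg_mul]
  have h2 : ContDiff ℝ (⊤ : ℕ∞) fun z : E3 × E3 × ℝ =>
      ((z.1, z.2.1), 2 * (z.2.2 - ⟪z.1, z.2.1⟫_ℝ)) :=
    (by fun_prop : ContDiff ℝ (⊤ : ℕ∞) fun z : E3 × E3 × ℝ => (z.1, z.2.1)).prodMk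
      (contDiff_const.mul ((by fun_prop : ContDiff ℝ (⊤ : ℕ∞) fun z : E3 × E3 × ℝ => z.2.2).sub
        (contDiff_fst.inner ℝ (by fun_prop : ContDiff ℝ (⊤ : ℕ∞) fun z : E3 × E3 × ℝ => z.2.1))))
  refine (h1.comp h2.contDiffOn fun z hz => ⟨mem_univ _, ?_⟩).congr fun z hz => ?_
  · have : 0 ≤ z.2.2 - ⟪z.1, z.2.1⟫_ℝ := sub_nonneg.2 hz.2.2
    change 0 ≤ 2 * (z.2.2 - ⟪z.1, z.2.1⟫_ℝ)
    positivity
  · exact identityKernel_wave hV.continuous hW.continuous hz.2.2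

/-! ### The singly scattered wave -/

section Front

variable {q : E3 → ℝ} {ω : E3} {J : E2 →ₗᵢ[ℝ] E3}

/-- The integral of `q` over the paraboloid with axis `ω`, focus `x` and parameter `a`, at
`z = (x, a)`. -/
def parabIntegral (q : E3 → ℝ) (ω : E3) (J : E2 →ₗᵢ[ℝ] E3) (z : E3 × ℝ) : ℝ :=
  ∫ ζ : E2, q (z.1 + parab ω J (z.2, ζ))

/-- The singly scattered wave, up to the factor `-1 / (4π)`. -/
def frontWave (q : E3 → ℝ) (ω : E3) (J : E2 →ₗᵢ[ℝ] E3) (x : E3) (t : ℝ) : ℝ :=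
  if ⟪x, ω⟫_ℝ ≤ t then parabIntegral q ω J (x, t - ⟪x, ω⟫_ℝ) else 0

theorem continuous_parabIntegral (hq : Continuous q) (hs : tsupport q ⊆ Metric.closedBall 0 1)
    (hJ : IsFrame ω J) : Continuous (parabIntegral q ω J) := by
  refine FiberCompact.continuous_integral (μ := (volume : Measure E2))
    (f := fun p : (E3 × ℝ) × E2 => q (p.1.1 + parab ω J (p.1.2, p.2))) (by fun_prop) fun P₀ => ?_
  set R := ‖P₀‖ + 1
  refine ⟨Metric.closedBall 0 R, Metric.closedBall_mem_nhds_of_mem (by simp [R]),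
    Metric.closedBall 0 (√(2 + 3 * R)), isCompact_closedBall _ _,
    Eventually.of_forall fun ζ P hP hζ => ?_⟩
  by_contra h0
  have h1 : ‖P‖ ≤ R := by simpa using hP
  have h2 := (norm_fst_le P).trans h1
  have h3 : |P.2| ≤ R := (norm_snd_le P).trans h1
  have h4 := norm_le_one_of_ne_zero hs h0
  have h5 := norm_sub_le (P.1 + parab ω J (P.2, ζ)) P.1
  rw [add_sub_cancel_left] at h5
  have h6 := abs_real_inner_le_norm (parab ω J (P.2, ζ)) ω
  rw [hJ.norm_eq, mul_one, hJ.inner_parab] at h6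
  refine hζ ?_
  rw [mem_closedBall_zero_iff]
  refine Real.le_sqrt_of_sq_le ?_
  linarith [(abs_le.1 h6).1, le_abs_self P.2]

theorem measurable_frontWave (hq : Continuous q) (hs : tsupport q ⊆ Metric.closedBall 0 1)
    (hJ : IsFrame ω J) : Measurable fun z : E3 × ℝ => frontWave q ω J z.1 z.2 := by
  unfold frontWave
  have := continuous_parabIntegral hq hs hJ
  exact Measurable.ite (measurableSet_le (by fun_prop) (by fun_prop))
    (by fun_prop : Continuous fun z : E3 × ℝ =>
      parabIntegral q ω J (z.1, z.2 - ⟪z.1, ω⟫_ℝ)).measurable measurable_const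

theorem frontWave_bounded (hq : Continuous q) (hs : tsupport q ⊆ Metric.closedBall 0 1)
    (hJ : IsFrame ω J) (R : ℝ) :
    ∃ M, 0 ≤ M ∧ ∀ x t, ‖x‖ ≤ R → |t| ≤ R → |frontWave q ω J x t| ≤ M := by
  have hc : Continuous fun z : E3 × ℝ => parabIntegral q ω J (z.1, z.2 - ⟪z.1, ω⟫_ℝ) := by
    have := continuous_parabIntegral hq hs hJ
    fun_prop
  obtain ⟨M, hM⟩ := ((isCompact_closedBall (0 : E3) R).prod
    (isCompact_closedBall (0 : ℝ) R)).exists_bound_of_continuousOn hc.continuousOn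
  refine ⟨max M 0, le_max_right _ _, fun x t hx ht => ?_⟩
  by_cases h : ⟪x, ω⟫_ℝ ≤ t
  · rw [frontWave, if_pos h]
    exact (hM (x, t) ⟨by simpa using hx, by simpa using ht⟩).trans (le_max_left _ _)
  · rw [frontWave, if_neg h]
    simp

/-- Integrals over the half-spaces `x · ω ≤ r / 2` depend continuously on `r`. -/
theorem continuous_integral_cut (hq : Continuous q) (hs : tsupport q ⊆ Metric.closedBall 0 1)
    (hJ : IsFrame ω J) {G : E3 × ℝ → ℝ} (hG : Continuous G) :
    Continuous fun r : ℝ => ∫ y, q y * (if ⟪y, ω⟫_ℝ ≤ r - ⟪y, ω⟫_ℝ then G (y, r) else 0) := by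
  simp only [hJ.integral_eq, hJ.inner_add]
  rw [continuous_iff_continuousAt]
  intro r₀
  obtain ⟨Mq, hMq⟩ := hq.bounded_above_of_compact_support
    ((isCompact_closedBall _ _).of_isClosed_subset (isClosed_tsupport q) hs)
  have hMq0 : 0 ≤ Mq := (norm_nonneg _).trans (hMq 0)
  obtain ⟨M, hM⟩ := ((isCompact_closedBall (0 : E3) 1).prod
    (isCompact_closedBall r₀ 1)).exists_bound_of_continuousOn hG.continuousOn
  have hM0 : 0 ≤ M := (norm_nonneg _).trans (hM (0, r₀) ⟨by simp, by simp⟩)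
  set K : Set (E2 × ℝ) := Metric.closedBall 0 1
  have hc : Continuous fun p : E2 × ℝ => J p.1 + p.2 • ω := by
    have := J.continuous
    fun_prop
  refine continuousAt_of_dominated (bound := K.indicator fun _ => Mq * M)
    (Eventually.of_forall fun r => ?_) ?_ ?_ ?_
  · refine ((hq.comp hc).measurable.mul (Measurable.ite (measurableSet_le (by fun_prop)
      (by fun_prop)) ?_ measurable_const)).aestronglyMeasurable
    exact (hG.comp (hc.prodMk continuous_const)).measurable
  · filter_upwards [Metric.closedBall_mem_nhds r₀ one_pos] with r hr
    refine Eventually.of_forall fun p => ?_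
    by_cases h0 : q (J p.1 + p.2 • ω) = 0
    · rw [h0, zero_mul, norm_zero]
      exact indicator_nonneg (fun _ _ => by positivity) _
    · have h1 := norm_le_one_of_ne_zero hs h0
      have h2 := hJ.norm_sq_add p.1 p.2
      have h3 : ‖J p.1 + p.2 • ω‖ ^ 2 ≤ 1 := pow_le_one₀ (norm_nonneg _) h1
      have h4 : p ∈ K := by
        rw [mem_closedBall_zero_iff]
        refine max_le ?_ ?_
        · exact (sq_le_one_iff₀ (norm_nonneg _)).1 (by nlinarith [sq_nonneg p.2])
        · refine (sq_le_one_iff₀ (norm_nonneg _)).1 ?_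
          rw [Real.norm_eq_abs, sq_abs]
          nlinarith [sq_nonneg ‖p.1‖]
      rw [indicator_of_mem h4, norm_mul]
      refine mul_le_mul (hMq _) ?_ (norm_nonneg _) hMq0
      split_ifs
      · exact hM _ ⟨by simpa using h1, hr⟩
      · simpa using hM0
  · exact (integrable_indicator_iff Metric.isClosed_closedBall.measurableSet).2
      (integrableOn_const (isCompact_closedBall _ _).measure_lt_top.ne)
  · have h1 : ∀ᵐ p : E2 × ℝ, p.2 ≠ r₀ / 2 :=
      Measure.quasiMeasurePreserving_snd.ae (Measure.ae_ne volume (r₀ / 2))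
    filter_upwards [h1] with p hp
    refine ContinuousAt.mul continuousAt_const ?_
    have hGp : ContinuousAt (fun r => G (J p.1 + p.2 • ω, r)) r₀ := by fun_prop
    rcases lt_or_gt_of_ne hp with h | h
    · refine hGp.congr ?_
      filter_upwards [lt_mem_nhds (show 2 * p.2 < r₀ by linarith)] with r hr
      rw [if_pos (by linarith)]
    · refine (continuousAt_const (y := (0 : ℝ))).congr ?_
      filter_upwards [gt_mem_nhds (show r₀ < 2 * p.2 by linarith)] with r hr
      rw [if_neg (by linarith)]

end Front

section DoubleFront

variable {q₁ q₂ : E3 → ℝ} {ω : E3} {J : E2 →ₗᵢ[ℝ] E3}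

theorem continuous_integral_frontWave (hq₁ : Continuous q₁)
    (hs₁ : tsupport q₁ ⊆ Metric.closedBall 0 1) (hq₂ : Continuous q₂)
    (hs₂ : tsupport q₂ ⊆ Metric.closedBall 0 1) (hJ : IsFrame ω J) :
    Continuous fun r : ℝ => ∫ y, q₂ y * frontWave q₁ ω J y (r - ⟪y, ω⟫_ℝ) := by
  have hc := continuous_parabIntegral hq₁ hs₁ hJ
  exact continuous_integral_cut hq₂ hs₂ hJ (G := fun z : E3 × ℝ =>
    parabIntegral q₁ ω J (z.1, z.2 - ⟪z.1, ω⟫_ℝ - ⟪z.1, ω⟫_ℝ)) (by fun_prop)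

/-- The front contribution tested against a function of `r`: a double integral in which the two
potentials play the same part. -/
theorem integral_mul_frontWave (hq₁ : Continuous q₁)
    (hs₁ : tsupport q₁ ⊆ Metric.closedBall 0 1) (hq₂ : Continuous q₂)
    (hs₂ : tsupport q₂ ⊆ Metric.closedBall 0 1) (hJ : IsFrame ω J) {g : ℝ → ℝ} (hg : Continuous g)
    (hgc : HasCompactSupport g) :
    ∫ r, g r * ∫ y, q₂ y * frontWave q₁ ω J y (r - ⟪y, ω⟫_ℝ) =
      ∫ y, ∫ z, q₂ y * (q₁ (y + z) * g (⟪y, ω⟫_ℝ + ⟪y + z, ω⟫_ℝ + ‖z‖)) ∂newton := by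
  obtain ⟨R, hR⟩ := hgc.isCompact.isBounded.subset_closedBall 0
  obtain ⟨Mg, hMg⟩ := hg.bounded_above_of_compact_support hgc
  obtain ⟨Mq, hMq⟩ := hq₂.bounded_above_of_compact_support
    ((isCompact_closedBall _ _).of_isClosed_subset (isClosed_tsupport q₂) hs₂)
  have hMq0 : 0 ≤ Mq := (norm_nonneg _).trans (hMq 0)
  have hMg0 : 0 ≤ Mg := (norm_nonneg _).trans (hMg 0)
  obtain ⟨M, hM0, hM⟩ := frontWave_bounded hq₁ hs₁ hJ (|R| + 1)
  have hi : Integrable fun p : ℝ × E3 =>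
      g p.1 * (q₂ p.2 * frontWave q₁ ω J p.2 (p.1 - ⟪p.2, ω⟫_ℝ)) := by
    refine integrable_of_bounded_of_compact (C := Metric.closedBall 0 R ×ˢ Metric.closedBall 0 1)
      (M := Mg * (Mq * M)) ?_ ((isCompact_closedBall _ _).prod (isCompact_closedBall _ _))
      (fun p hp => ⟨hR (subset_tsupport _ (left_ne_zero_of_mul hp)),
        hs₂ (subset_tsupport _ (left_ne_zero_of_mul (right_ne_zero_of_mul hp)))⟩) fun p hp => ?_
    · exact (hg.measurable.comp measurable_fst).mul ((hq₂.measurable.comp measurable_snd).mul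
        ((measurable_frontWave hq₁ hs₁ hJ).comp (measurable_snd.prodMk
          (by fun_prop : Measurable fun p : ℝ × E3 => p.1 - ⟪p.2, ω⟫_ℝ))))
    · have h1 : |p.1| ≤ R := by simpa using hp.1
      have h2 : ‖p.2‖ ≤ 1 := by simpa using hp.2
      have h3 := (abs_real_inner_le_norm p.2 ω).trans (by rw [hJ.norm_eq, mul_one])
      rw [abs_mul, abs_mul]
      refine mul_le_mul (hMg _) (mul_le_mul (hMq _) (hM _ _ ?_ ?_) (abs_nonneg _) hMq0)
        (by positivity) hMg0
      · linarith [abs_nonneg R]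
      · exact (abs_sub _ _).trans (by linarith [le_abs_self R])
  have e1 : ∫ r, g r * ∫ y, q₂ y * frontWave q₁ ω J y (r - ⟪y, ω⟫_ℝ) =
      ∫ y, ∫ r, g r * (q₂ y * frontWave q₁ ω J y (r - ⟪y, ω⟫_ℝ)) := by
    simp only [← integral_const_mul]
    exact integral_integral_swap hi
  rw [e1]
  refine integral_congr_ae (Eventually.of_forall fun y => ?_)
  simp only
  have hg' : Measurable fun s => g (s + ⟪y, ω⟫_ℝ) := by fun_prop
  have e2 := integral_front hJ hq₁ hg' y ?_
  · have e3 : ∫ r, g r * (q₂ y * frontWave q₁ ω J y (r - ⟪y, ω⟫_ℝ)) =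
        q₂ y * ∫ s, frontWave q₁ ω J y s * g (s + ⟪y, ω⟫_ℝ) := by
      rw [← integral_add_right_eq_self _ ⟪y, ω⟫_ℝ, ← integral_const_mul]
      refine integral_congr_ae (Eventually.of_forall fun s => ?_)
      simp only [add_sub_cancel_right]
      ring
    rw [e3]
    refine (congrArg (fun I => q₂ y * I) e2).trans ?_
    rw [← integral_const_mul]
    refine integral_congr_ae (Eventually.of_forall fun z => ?_)
    simp only [inner_add_left]
    congr 3
    ring
  · exact integrable_front_newton hs₁ hq₁ (f := fun z : E3 × ℝ => g (z.2 + ⟪y, ω⟫_ℝ))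
      (by fun_prop) y

/-- Double scattering at the front is symmetric in the two potentials. -/
theorem integral_frontWave_symm (hq₁ : Continuous q₁)
    (hs₁ : tsupport q₁ ⊆ Metric.closedBall 0 1) (hq₂ : Continuous q₂)
    (hs₂ : tsupport q₂ ⊆ Metric.closedBall 0 1) (hJ : IsFrame ω J) (r : ℝ) :
    ∫ y, q₂ y * frontWave q₁ ω J y (r - ⟪y, ω⟫_ℝ) =
      ∫ y, q₁ y * frontWave q₂ ω J y (r - ⟪y, ω⟫_ℝ) := by
  have c1 := continuous_integral_frontWave hq₁ hs₁ hq₂ hs₂ hJ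
  have c2 := continuous_integral_frontWave hq₂ hs₂ hq₁ hs₁ hJ
  have key := ae_eq_of_integral_contDiff_smul_eq (μ := (volume : Measure ℝ)) c1.locallyIntegrable
    c2.locallyIntegrable fun g hg hgc => ?_
  · exact congrFun ((c1.ae_eq_iff_eq volume c2).1 key) r
  · simp only [smul_eq_mul]
    rw [integral_mul_frontWave hq₁ hs₁ hq₂ hs₂ hJ hg.continuous hgc,
      integral_mul_frontWave hq₂ hs₂ hq₁ hs₁ hJ hg.continuous hgc]
    have hgcont := hg.continuous
    have hH : Continuous fun p : E3 × E3 => q₂ p.2 * (q₁ (p.2 + p.1) *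
        g (⟪p.2, ω⟫_ℝ + ⟪p.2 + p.1, ω⟫_ℝ + ‖p.1‖)) := by fun_prop
    have h1 := integral_newton_shift (μ := (volume : Measure E3)) (c := fun z => z) hH.measurable
      ?_ measurable_id
    · refine h1.trans ?_
      refine integral_congr_ae (Eventually.of_forall fun y => ?_)
      refine integral_congr_ae (Eventually.of_forall fun z => ?_)
      simp only [norm_neg, add_neg_cancel_right]
      rw [add_comm ⟪y + z, ω⟫_ℝ]
      ring
    · refine hH.integrable_of_hasCompactSupport (HasCompactSupport.intro
        (K := Metric.closedBall 0 2 ×ˢ Metric.closedBall 0 1)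
        ((isCompact_closedBall _ _).prod (isCompact_closedBall _ _)) fun p hp => ?_)
      by_contra h0
      have h1 := norm_le_one_of_ne_zero hs₂ (left_ne_zero_of_mul h0)
      have h2 := norm_le_one_of_ne_zero hs₁ (left_ne_zero_of_mul (right_ne_zero_of_mul h0))
      have : ‖p.1‖ ≤ ‖p.2 + p.1‖ + ‖p.2‖ := by simpa using norm_sub_le (p.2 + p.1) p.2
      refine hp ⟨?_, by simpa using h1⟩
      rw [mem_closedBall_zero_iff]
      linarith

end DoubleFront

/-! ### Reciprocity -/

section Reciprocity

/-- The multiply scattered wave, up to the factor `-1 / (4π)`. -/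
def multiWave (q : E3 → ℝ) (V : ParamSpace → ℝ) (ω x : E3) (t : ℝ) : ℝ :=
  ∫ z, q (x + z) * wave V ω (x + z) (t - ‖z‖) ∂newton

/-- The Lippmann–Schwinger equation as a splitting into single and multiple scattering. -/
theorem IsProfile.mul_wave_eq {q : E3 → ℝ} {V : ParamSpace → ℝ} (hV : IsProfile q V)
    (hs : tsupport q ⊆ Metric.closedBall 0 1) {ω : E3} {J : E2 →ₗᵢ[ℝ] E3} (hJ : IsFrame ω J)
    (hq : Continuous q) (x : E3) (t : ℝ) :
    -(4 * Real.pi) * wave V ω x t = frontWave q ω J x t + multiWave q V ω x t := by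
  rw [hV.wave_eq_ite hs hJ hq]
  have := Real.pi_ne_zero
  field_simp
  rfl

theorem Measurable.wave {V : ParamSpace → ℝ} (hV : Continuous V) (ω : E3) {Y : Type}
    [MeasurableSpace Y] {f : Y → E3} {g : Y → ℝ} (hf : Measurable f) (hg : Measurable g) :
    Measurable fun y => wave V ω (f y) (g y) :=
  (measurable_wave hV ω).comp (hf.prodMk hg)

/-- Splitting an integral according to the two parts of the scattered wave. -/
theorem integral_split {Y : Type} [MeasurableSpace Y] {μ : Measure Y} {c : ℝ} {f U S T : Y → ℝ}
    (h : ∀ y, c * U y = S y + T y) (h1 : Integrable (fun y => f y * U y) μ)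
    (h2 : Integrable (fun y => f y * T y) μ) :
    Integrable (fun y => f y * S y) μ ∧
      c * ∫ y, f y * U y ∂μ = (∫ y, f y * S y ∂μ) + ∫ y, f y * T y ∂μ := by
  have h3 : ∀ y, f y * S y = c * (f y * U y) - f y * T y := fun y => by
    linear_combination (-f y) * h y
  refine ⟨((h1.const_mul c).sub h2).congr (Eventually.of_forall fun y => (h3 y).symm), ?_⟩
  simp only [h3]
  rw [integral_sub (h1.const_mul c) h2, integral_const_mul]
  ring

theorem norm_le_two_of_mul_ne_zero {q₁ q₂ : E3 → ℝ} (hs₁ : tsupport q₁ ⊆ Metric.closedBall 0 1)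
    (hs₂ : tsupport q₂ ⊆ Metric.closedBall 0 1) {y z : E3} (h1 : q₁ (y + z) ≠ 0) (h2 : q₂ y ≠ 0) :
    ‖z‖ ≤ 2 := by
  have h3 := norm_le_one_of_ne_zero hs₁ h1
  have h4 := norm_le_one_of_ne_zero hs₂ h2
  have : ‖z‖ ≤ ‖y + z‖ + ‖y‖ := by simpa using norm_sub_le (y + z) y
  linarith

variable {q₁ q₂ : E3 → ℝ} {V₁ V₂ : ParamSpace → ℝ} {ω : E3} {J : E2 →ₗᵢ[ℝ] E3}
  (hV₁ : IsProfile q₁ V₁) (hV₂ : IsProfile q₂ V₂) (hq₁ : Continuous q₁) (hq₂ : Continuous q₂)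
  (hs₁ : tsupport q₁ ⊆ Metric.closedBall 0 1) (hs₂ : tsupport q₂ ⊆ Metric.closedBall 0 1)
  (hJ : IsFrame ω J) (r : ℝ)

include hV₁ hq₂ hs₂ hJ in
theorem integrable_mul_wave :
    Integrable fun y => q₂ y * wave V₁ ω y (r - ⟪y, ω⟫_ℝ) := by
  obtain ⟨Mq, hMq⟩ := hq₂.bounded_above_of_compact_support
    ((isCompact_closedBall _ _).of_isClosed_subset (isClosed_tsupport q₂) hs₂)
  obtain ⟨M, hM0, hM⟩ := wave_bounded hV₁.smooth.continuous ω (|r| + 1)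
  refine integrable_of_bounded_of_compact (C := Metric.closedBall 0 1) (M := Mq * M)
    (hq₂.measurable.mul (Measurable.wave hV₁.smooth.continuous ω measurable_id (by fun_prop)))
    (isCompact_closedBall _ _) (fun y hy => hs₂ (subset_tsupport _ (left_ne_zero_of_mul hy)))
    fun y hy => ?_
  have h1 : ‖y‖ ≤ 1 := by simpa using hy
  have h2 := (abs_real_inner_le_norm y ω).trans (by rw [hJ.norm_eq, mul_one])
  rw [abs_mul]
  exact mul_le_mul (hMq _) (hM _ _ (by linarith [abs_nonneg r])
    ((abs_sub _ _).trans (by linarith))) (abs_nonneg _) ((norm_nonneg _).trans (hMq 0))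

include hV₁ hV₂ hq₁ hq₂ hs₁ hs₂ hJ in
theorem integrable_mul_wave_wave {q : E3 → ℝ} (hq : Continuous q)
    (hs : tsupport q ⊆ Metric.closedBall 0 1) : Integrable fun z : E3 × ℝ =>
      q z.1 * (wave V₁ ω z.1 z.2 * wave V₂ ω z.1 (r - z.2)) := by
  obtain ⟨Mq, hMq⟩ := hq.bounded_above_of_compact_support
    ((isCompact_closedBall _ _).of_isClosed_subset (isClosed_tsupport q) hs)
  obtain ⟨M₁, hM₁0, hM₁⟩ := wave_bounded hV₁.smooth.continuous ω (2 * |r| + 2)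
  obtain ⟨M₂, hM₂0, hM₂⟩ := wave_bounded hV₂.smooth.continuous ω (2 * |r| + 2)
  have hMq0 := (norm_nonneg _).trans (hMq 0)
  refine integrable_of_bounded_of_compact (C := Metric.closedBall 0 1 ×ˢ Icc (-1) (r + 1))
    (M := Mq * (M₁ * M₂)) ((by fun_prop : Measurable fun z : E3 × ℝ => q z.1).mul
      ((measurable_wave hV₁.smooth.continuous ω).mul
        (Measurable.wave hV₂.smooth.continuous ω measurable_fst (by fun_prop))))
    ((isCompact_closedBall _ _).prod isCompact_Icc) (fun z hz => ?_) fun z hz => ?_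
  · have h1 := (hV₁.wave_support hs₁ hJ
      (left_ne_zero_of_mul (right_ne_zero_of_mul hz))).1
    have h2 := (hV₂.wave_support hs₂ hJ
      (right_ne_zero_of_mul (right_ne_zero_of_mul hz))).1
    exact ⟨hs (subset_tsupport _ (left_ne_zero_of_mul hz)), h1, by linarith⟩
  · have h1 : ‖z.1‖ ≤ 1 := by simpa using hz.1
    obtain ⟨h2, h3⟩ := hz.2
    have h4 := abs_nonneg r
    have h5 := le_abs_self r
    have h6 := neg_abs_le r
    rw [abs_mul, abs_mul]
    refine mul_le_mul (hMq _) (mul_le_mul (hM₁ _ _ ?_ ?_) (hM₂ _ _ ?_ ?_) (abs_nonneg _) hM₁0)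
      (by positivity) hMq0
    · linarith
    · exact abs_le.2 ⟨by linarith, by linarith⟩
    · linarith
    · exact abs_le.2 ⟨by linarith, by linarith⟩

theorem measurable_singleMulti (hV₁ : IsProfile q₁ V₁) (hq₁ : Continuous q₁)
    (hq₂ : Continuous q₂) : Measurable fun p : E3 × E3 =>
      q₂ p.2 * (q₁ (p.2 + p.1) * wave V₁ ω (p.2 + p.1) (r - ⟪p.2, ω⟫_ℝ - ‖p.1‖)) :=
  (by fun_prop : Measurable fun p : E3 × E3 => q₂ p.2).mul
    (hV₁.measurable_wave_comp hq₁ (by fun_prop) (by fun_prop))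

include hV₁ hq₁ hq₂ hs₁ hs₂ hJ in
theorem integrable_singleMulti : Integrable (fun p : E3 × E3 =>
      q₂ p.2 * (q₁ (p.2 + p.1) * wave V₁ ω (p.2 + p.1) (r - ⟪p.2, ω⟫_ℝ - ‖p.1‖)))
      (newton.prod volume) := by
  obtain ⟨Mq₁, hMq₁⟩ := hq₁.bounded_above_of_compact_support
    ((isCompact_closedBall _ _).of_isClosed_subset (isClosed_tsupport q₁) hs₁)
  obtain ⟨Mq₂, hMq₂⟩ := hq₂.bounded_above_of_compact_support
    ((isCompact_closedBall _ _).of_isClosed_subset (isClosed_tsupport q₂) hs₂)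
  have hMq₁0 := (norm_nonneg _).trans (hMq₁ 0)
  have hMq₂0 := (norm_nonneg _).trans (hMq₂ 0)
  obtain ⟨M, hM0, hM⟩ := wave_bounded hV₁.smooth.continuous ω (|r| + 3)
  refine integrable_of_bounded_of_compact (C := Metric.closedBall 0 2 ×ˢ Metric.closedBall 0 1)
    (M := Mq₂ * (Mq₁ * M)) (measurable_singleMulti r hV₁ hq₁ hq₂)
    ((isCompact_closedBall _ _).prod (isCompact_closedBall _ _)) (fun p hp => ?_) fun p hp => ?_
  · have h1 := left_ne_zero_of_mul hp
    have h2 := left_ne_zero_of_mul (right_ne_zero_of_mul hp)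
    exact ⟨by simpa using norm_le_two_of_mul_ne_zero hs₁ hs₂ h2 h1, hs₂ (subset_tsupport _ h1)⟩
  · have h1 : ‖p.1‖ ≤ 2 := by simpa using hp.1
    have h2 : ‖p.2‖ ≤ 1 := by simpa using hp.2
    have h3 := (abs_real_inner_le_norm p.2 ω).trans (by rw [hJ.norm_eq, mul_one])
    have h4 := abs_le.1 h3
    have h5 := le_abs_self r
    have h6 := neg_abs_le r
    have h7 := norm_nonneg p.1
    rw [abs_mul, abs_mul]
    refine mul_le_mul (hMq₂ _) (mul_le_mul (hMq₁ _) (hM _ _ ?_ ?_) (abs_nonneg _) hMq₁0)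
      (by positivity) hMq₂0
    · linarith [norm_add_le p.2 p.1, abs_nonneg r]
    · exact abs_le.2 ⟨by linarith, by linarith⟩

theorem measurable_doubleMulti (hV₁ : IsProfile q₁ V₁) (hV₂ : IsProfile q₂ V₂)
    (hq₁ : Continuous q₁) (hq₂ : Continuous q₂) :
    Measurable fun p : E3 × (E3 × ℝ) => q₂ p.2.1 * wave V₂ ω p.2.1 (r - p.2.2) *
      (q₁ (p.2.1 + p.1) * wave V₁ ω (p.2.1 + p.1) (p.2.2 - ‖p.1‖)) :=
  (hV₂.measurable_wave_comp hq₂ (by fun_prop) (by fun_prop)).mul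
    (hV₁.measurable_wave_comp hq₁ (by fun_prop) (by fun_prop))

include hV₁ hV₂ hq₁ hq₂ hs₁ hs₂ hJ in
theorem integrable_doubleMulti : Integrable (fun p : E3 × (E3 × ℝ) =>
      q₂ p.2.1 * wave V₂ ω p.2.1 (r - p.2.2) *
        (q₁ (p.2.1 + p.1) * wave V₁ ω (p.2.1 + p.1) (p.2.2 - ‖p.1‖))) (newton.prod volume) := by
  obtain ⟨Mq₁, hMq₁⟩ := hq₁.bounded_above_of_compact_support
    ((isCompact_closedBall _ _).of_isClosed_subset (isClosed_tsupport q₁) hs₁)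
  obtain ⟨Mq₂, hMq₂⟩ := hq₂.bounded_above_of_compact_support
    ((isCompact_closedBall _ _).of_isClosed_subset (isClosed_tsupport q₂) hs₂)
  have hMq₁0 := (norm_nonneg _).trans (hMq₁ 0)
  have hMq₂0 := (norm_nonneg _).trans (hMq₂ 0)
  obtain ⟨M₁, hM₁0, hM₁⟩ := wave_bounded hV₁.smooth.continuous ω (2 * |r| + 3)
  obtain ⟨M₂, hM₂0, hM₂⟩ := wave_bounded hV₂.smooth.continuous ω (2 * |r| + 3)
  refine integrable_of_bounded_of_compact
    (C := Metric.closedBall 0 2 ×ˢ (Metric.closedBall 0 1 ×ˢ Icc (-1) (r + 1)))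
    (M := Mq₂ * M₂ * (Mq₁ * M₁)) (measurable_doubleMulti r hV₁ hV₂ hq₁ hq₂)
    ((isCompact_closedBall _ _).prod ((isCompact_closedBall _ _).prod isCompact_Icc))
    (fun p hp => ?_) fun p hp => ?_
  · have h1 := left_ne_zero_of_mul (left_ne_zero_of_mul hp)
    have h2 := left_ne_zero_of_mul (right_ne_zero_of_mul hp)
    have h3 := (hV₂.wave_support hs₂ hJ (right_ne_zero_of_mul (left_ne_zero_of_mul hp))).1
    have h4 := (hV₁.wave_support hs₁ hJ (right_ne_zero_of_mul (right_ne_zero_of_mul hp))).1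
    exact ⟨by simpa using norm_le_two_of_mul_ne_zero hs₁ hs₂ h2 h1, hs₂ (subset_tsupport _ h1),
      by linarith [norm_nonneg p.1], by linarith⟩
  · have h1 : ‖p.1‖ ≤ 2 := by simpa using hp.1
    have h2 : ‖p.2.1‖ ≤ 1 := by simpa using hp.2.1
    obtain ⟨h3, h4⟩ := hp.2.2
    have h5 := le_abs_self r
    have h6 := neg_abs_le r
    have h7 := norm_nonneg p.1
    have h8 := abs_nonneg r
    rw [abs_mul, abs_mul, abs_mul]
    refine mul_le_mul (mul_le_mul (hMq₂ _) (hM₂ _ _ ?_ ?_) (abs_nonneg _) hMq₂0)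
      (mul_le_mul (hMq₁ _) (hM₁ _ _ ?_ ?_) (abs_nonneg _) hMq₁0)
      (by positivity) (by positivity)
    · linarith
    · exact abs_le.2 ⟨by linarith, by linarith⟩
    · linarith [norm_add_le p.2.1 p.1]
    · exact abs_le.2 ⟨by linarith, by linarith⟩

include hV₂ hq₁ hs₁ hJ in
/-- Pairing the singly scattered wave with a second wave. -/
theorem integral_front_wave (y : E3) :
    ∫ s, frontWave q₁ ω J y s * wave V₂ ω y (r - s) =
      ∫ z, q₁ (y + z) * wave V₂ ω y (r - (⟪y, ω⟫_ℝ + (‖z‖ + ⟪z, ω⟫_ℝ))) ∂newton := by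
  have hm : Measurable fun s => wave V₂ ω y (r - s) :=
    Measurable.wave hV₂.smooth.continuous ω measurable_const (by fun_prop)
  refine integral_front hJ hq₁ hm y ?_
  obtain ⟨Mq, hMq⟩ := hq₁.bounded_above_of_compact_support
    ((isCompact_closedBall _ _).of_isClosed_subset (isClosed_tsupport q₁) hs₁)
  obtain ⟨M, hM0, hM⟩ := wave_bounded hV₂.smooth.continuous ω (|r| + 3 * ‖y‖ + 2)
  refine integrable_of_bounded_of_compact (C := Metric.closedBall 0 (1 + ‖y‖)) (M := Mq * M)
    ((by fun_prop : Measurable fun z => q₁ (y + z)).mul (hm.comp (by fun_prop)))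
    (isCompact_closedBall _ _) (fun z hz => ?_) fun z hz => ?_
  · have h1 := norm_le_one_of_ne_zero hs₁ (left_ne_zero_of_mul hz)
    have : ‖z‖ ≤ ‖y + z‖ + ‖y‖ := by simpa using norm_sub_le (y + z) y
    rw [mem_closedBall_zero_iff]
    linarith
  · have h1 : ‖z‖ ≤ 1 + ‖y‖ := by simpa using hz
    have h2 := abs_le.1 ((abs_real_inner_le_norm y ω).trans (by rw [hJ.norm_eq, mul_one]))
    have h3 := abs_le.1 ((abs_real_inner_le_norm z ω).trans (by rw [hJ.norm_eq, mul_one]))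
    have h5 := le_abs_self r
    have h6 := neg_abs_le r
    have h7 := norm_nonneg z
    have h8 := norm_nonneg y
    have h9 := abs_nonneg r
    rw [abs_mul]
    exact mul_le_mul (hMq _) (hM _ _ (by linarith) (abs_le.2 ⟨by linarith, by linarith⟩))
      (abs_nonneg _) ((norm_nonneg _).trans (hMq 0))

include hV₁ hV₂ hq₁ hq₂ hs₁ hs₂ hJ in
/-- The integral equation for the first wave, inserted into the interaction of the two waves. -/
theorem interaction_eq : -(4 * Real.pi) * ((∫ y, q₂ y * wave V₁ ω y (r - ⟪y, ω⟫_ℝ)) +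
      ∫ z : E3 × ℝ, q₂ z.1 * (wave V₁ ω z.1 z.2 * wave V₂ ω z.1 (r - z.2))) =
    (∫ y, q₂ y * frontWave q₁ ω J y (r - ⟪y, ω⟫_ℝ)) +
    (∫ y, ∫ z, q₂ y * (q₁ (y + z) * wave V₁ ω (y + z) (r - ⟪y, ω⟫_ℝ - ‖z‖)) ∂newton) +
    ((∫ y, ∫ z, q₂ y * (q₁ (y + z) *
        wave V₂ ω y (r - (⟪y, ω⟫_ℝ + (‖z‖ + ⟪z, ω⟫_ℝ)))) ∂newton) +
      ∫ p : E3 × ℝ, ∫ z, q₂ p.1 * wave V₂ ω p.1 (r - p.2) *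
        (q₁ (p.1 + z) * wave V₁ ω (p.1 + z) (p.2 - ‖z‖)) ∂newton) := by
  have hwave := hV₁.mul_wave_eq hs₁ hJ hq₁
  have iA := (integrable_singleMulti hV₁ hq₁ hq₂ hs₁ hs₂ hJ r).integral_prod_right
  have iC := (integrable_doubleMulti hV₁ hV₂ hq₁ hq₂ hs₁ hs₂ hJ r).integral_prod_right
  simp only [integral_const_mul] at iA iC ⊢
  have i2 := integrable_mul_wave_wave hV₁ hV₂ hq₁ hq₂ hs₁ hs₂ hJ r hq₂ hs₂
  obtain ⟨-, e1⟩ := integral_split (f := q₂) (U := fun y => wave V₁ ω y (r - ⟪y, ω⟫_ℝ))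
    (fun y => hwave y _) (integrable_mul_wave hV₁ hq₂ hs₂ hJ r) iA
  obtain ⟨i3, e2⟩ := integral_split
    (f := fun p : E3 × ℝ => q₂ p.1 * wave V₂ ω p.1 (r - p.2))
    (U := fun p => wave V₁ ω p.1 p.2) (fun p => hwave p.1 p.2)
    (i2.congr (Eventually.of_forall fun p => by simp only; ring)) iC
  have e3 : ∫ z : E3 × ℝ, q₂ z.1 * (wave V₁ ω z.1 z.2 * wave V₂ ω z.1 (r - z.2)) =
      ∫ p : E3 × ℝ, q₂ p.1 * wave V₂ ω p.1 (r - p.2) * wave V₁ ω p.1 p.2 :=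
    integral_congr_ae (Eventually.of_forall fun p => by simp only; ring)
  have e4 : ∫ p : E3 × ℝ, q₂ p.1 * wave V₂ ω p.1 (r - p.2) * frontWave q₁ ω J p.1 p.2 =
      ∫ y, q₂ y * ∫ z, q₁ (y + z) *
        wave V₂ ω y (r - (⟪y, ω⟫_ℝ + (‖z‖ + ⟪z, ω⟫_ℝ))) ∂newton := by
    rw [Measure.volume_eq_prod] at i3 ⊢
    rw [integral_prod _ i3]
    refine integral_congr_ae (Eventually.of_forall fun y => ?_)
    simp only
    rw [← integral_front_wave hV₂ hq₁ hs₁ hJ, ← integral_const_mul]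
    refine integral_congr_ae (Eventually.of_forall fun s => ?_)
    simp only
    ring
  rw [mul_add, e1, e3, e2, e4]
  rfl

theorem integral_sub_snd (G : E3 × ℝ → ℝ) :
    ∫ z : E3 × ℝ, G (z.1, r - z.2) = ∫ z, G z := by
  have h1 : MeasurePreserving (fun z : E3 × ℝ => (z.1, r - z.2)) volume volume :=
    (MeasurePreserving.id volume).prod (volume.measurePreserving_sub_left r)
  have h2 : MeasurableEmbedding fun z : E3 × ℝ => (z.1, r - z.2) :=
    MeasurableEquiv.measurableEmbedding
      ((MeasurableEquiv.refl E3).prodCongr (MeasurableEquiv.subLeft r))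
  exact h1.integral_comp h2 G

include hV₁ hq₁ hq₂ hs₁ hs₂ hJ in
/-- The singly scattered wave of one potential against the other wave: the two ways in which this
term arises agree, by the symmetry of `dz / |z|`. -/
theorem integral_singleMulti_symm :
    ∫ y, ∫ z, q₂ y * (q₁ (y + z) * wave V₁ ω (y + z) (r - ⟪y, ω⟫_ℝ - ‖z‖)) ∂newton =
      ∫ y, ∫ z, q₁ y * (q₂ (y + z) *
        wave V₁ ω y (r - (⟪y, ω⟫_ℝ + (‖z‖ + ⟪z, ω⟫_ℝ)))) ∂newton := by
  have h1 := integral_newton_shift (μ := (volume : Measure E3)) (c := fun z => z)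
    (measurable_singleMulti (ω := ω) r hV₁ hq₁ hq₂)
    (integrable_singleMulti hV₁ hq₁ hq₂ hs₁ hs₂ hJ r) measurable_id
  refine h1.trans ?_
  refine integral_congr_ae (Eventually.of_forall fun y => ?_)
  refine integral_congr_ae (Eventually.of_forall fun z => ?_)
  simp only [norm_neg, add_neg_cancel_right, inner_add_left]
  rw [show r - (⟪y, ω⟫_ℝ + ⟪z, ω⟫_ℝ) - ‖z‖ = r - (⟪y, ω⟫_ℝ + (‖z‖ + ⟪z, ω⟫_ℝ)) by ring]
  ring

include hV₁ hV₂ hq₁ hq₂ hs₁ hs₂ hJ in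
/-- Multiple scattering in both waves, by the symmetry of `dz / |z|` and of `(s, r - s)`. -/
theorem integral_doubleMulti_symm :
    ∫ p : E3 × ℝ, ∫ z, q₂ p.1 * wave V₂ ω p.1 (r - p.2) *
        (q₁ (p.1 + z) * wave V₁ ω (p.1 + z) (p.2 - ‖z‖)) ∂newton =
      ∫ p : E3 × ℝ, ∫ z, q₁ p.1 * wave V₁ ω p.1 (r - p.2) *
        (q₂ (p.1 + z) * wave V₂ ω (p.1 + z) (p.2 - ‖z‖)) ∂newton := by
  have : (volume : Measure (E3 × ℝ)).IsAddRightInvariant := by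
    rw [Measure.volume_eq_prod]; infer_instance
  have h1 := integral_newton_shift (μ := (volume : Measure (E3 × ℝ)))
    (c := fun z => ((z, ‖z‖) : E3 × ℝ)) (measurable_doubleMulti (ω := ω) r hV₁ hV₂ hq₁ hq₂)
    (integrable_doubleMulti hV₁ hV₂ hq₁ hq₂ hs₁ hs₂ hJ r) (by fun_prop)
  refine h1.trans ?_
  rw [← integral_sub_snd r]
  refine integral_congr_ae (Eventually.of_forall fun p => ?_)
  refine integral_congr_ae (Eventually.of_forall fun z => ?_)
  simp only [norm_neg, Prod.fst_add, Prod.snd_add, add_neg_cancel_right, add_sub_cancel_right]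
  rw [show r - (r - p.2 + ‖z‖) = p.2 - ‖z‖ by ring]
  ring

include hV₁ hV₂ hq₁ hq₂ hs₁ hs₂ hJ in
/-- Reciprocity: the interaction of the first wave with the second potential and the second wave
is symmetric in the two potentials. -/
theorem reciprocity :
    (∫ y, q₂ y * wave V₁ ω y (r - ⟪y, ω⟫_ℝ)) +
      (∫ z : E3 × ℝ, q₂ z.1 * (wave V₁ ω z.1 z.2 * wave V₂ ω z.1 (r - z.2))) =
    (∫ y, q₁ y * wave V₂ ω y (r - ⟪y, ω⟫_ℝ)) +
      ∫ z : E3 × ℝ, q₁ z.1 * (wave V₁ ω z.1 z.2 * wave V₂ ω z.1 (r - z.2)) := by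
  have e1 := interaction_eq hV₁ hV₂ hq₁ hq₂ hs₁ hs₂ hJ r
  have e2 := interaction_eq hV₂ hV₁ hq₂ hq₁ hs₂ hs₁ hJ r
  rw [integral_frontWave_symm hq₂ hs₂ hq₁ hs₁ hJ r,
    integral_singleMulti_symm hV₂ hq₂ hq₁ hs₂ hs₁ hJ r,
    ← integral_singleMulti_symm hV₁ hq₁ hq₂ hs₁ hs₂ hJ r,
    integral_doubleMulti_symm hV₂ hV₁ hq₂ hq₁ hs₂ hs₁ hJ r] at e2
  have e3 : ∫ z : E3 × ℝ, q₁ z.1 * (wave V₂ ω z.1 z.2 * wave V₁ ω z.1 (r - z.2)) =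
      ∫ z : E3 × ℝ, q₁ z.1 * (wave V₁ ω z.1 z.2 * wave V₂ ω z.1 (r - z.2)) := by
    rw [← integral_sub_snd r]
    refine integral_congr_ae (Eventually.of_forall fun p => ?_)
    simp only [sub_sub_cancel]
    ring
  rw [e3] at e2
  have h : -(4 * Real.pi) ≠ 0 := by
    simp [Real.pi_ne_zero]
  refine mul_left_cancel₀ h ?_
  rw [e1, e2]
  ring

end Reciprocity

/-! ### Integrals of the wave over planes -/

section Slices

variable {q : E3 → ℝ} {V : ParamSpace → ℝ} {ω : E3} {J : E2 →ₗᵢ[ℝ] E3}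

theorem differentiableAt_wave (hV : ContDiff ℝ (⊤ : ℕ∞) V) {x : E3} {t : ℝ} (h : ⟪x, ω⟫_ℝ < t) :
    DifferentiableAt ℝ (fun y => wave V ω y t) x := by
  have hin : Continuous fun y : E3 => ⟪y, ω⟫_ℝ := by fun_prop
  have h1 : (fun y => wave V ω y t) =ᶠ[𝓝 x] fun y => V (y, ω, √(t - ⟪y, ω⟫_ℝ)) := by
    filter_upwards [(isOpen_lt hin continuous_const).mem_nhds h] with y hy
    exact wave_of_le (le_of_lt hy)
  refine DifferentiableAt.congr_of_eventuallyEq ?_ h1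
  have h2 : DifferentiableAt ℝ (fun y : E3 => √(t - ⟪y, ω⟫_ℝ)) x :=
    DifferentiableAt.sqrt ((differentiableAt_const t).sub
      (differentiableAt_id.inner ℝ (differentiableAt_const ω))) (sub_pos.2 h).ne'
  exact ((hV.differentiable (by simp)) _).comp x
    (differentiableAt_id.prodMk ((differentiableAt_const ω).prodMk h2))

/-- Finite speed of propagation in terms of the profile, for both signs of the last variable. -/
theorem IsProfile.norm_le (hV : IsProfile q V) (hs : tsupport q ⊆ Metric.closedBall 0 1)
    (hJ : IsFrame ω J) {x : E3} {s : ℝ} (h : V (x, ω, s) ≠ 0) : ‖x‖ ≤ s ^ 2 + ⟪x, ω⟫_ℝ + 2 := by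
  have h1 : wave V ω x (s ^ 2 + ⟪x, ω⟫_ℝ) = V (x, ω, s) := by
    rw [wave_of_le (by linarith [sq_nonneg s]), add_sub_cancel_right, Real.sqrt_sq_eq_abs]
    rcases abs_cases s with h2 | h2
    · rw [h2.1]
    · rw [h2.1, hV.even]
  exact (hV.wave_support hs hJ (by rwa [h1])).2

theorem IsFrame.norm_le_norm_add (hJ : IsFrame ω J) (η : E2) (h : ℝ) :
    ‖η‖ ≤ ‖J η + h • ω‖ ∧ |h| ≤ ‖J η + h • ω‖ := by
  have h1 := hJ.norm_sq_add η h
  constructor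
  · exact abs_le_of_sq_le_sq' (by nlinarith [sq_nonneg h]) (norm_nonneg _) |>.2
  · refine abs_le_of_sq_le_sq (by nlinarith [sq_nonneg ‖η‖]) (norm_nonneg _)

theorem fiberCompact_slice (hV : IsProfile q V) (hs : tsupport q ⊆ Metric.closedBall 0 1)
    (hJ : IsFrame ω J) : FiberCompact (volume : Measure E2)
      fun p : (ℝ × ℝ) × E2 => V (J p.2 + p.1.1 • ω, ω, p.1.2) := by
  intro P₀
  set R := ‖P₀‖ + 1
  refine ⟨Metric.closedBall 0 R, Metric.closedBall_mem_nhds_of_mem (by simp [R]),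
    Metric.closedBall 0 (R ^ 2 + R + 2), isCompact_closedBall _ _,
    Eventually.of_forall fun η P hP hη => ?_⟩
  by_contra h0
  have h1 : ‖P‖ ≤ R := by simpa using hP
  have h2 : |P.1| ≤ R := (norm_fst_le P).trans h1
  have h3 : |P.2| ≤ R := (norm_snd_le P).trans h1
  have h4 := hV.norm_le hs hJ h0
  simp only [hJ.inner_add] at h4
  have h5 := (hJ.norm_le_norm_add η P.1).1
  refine hη ?_
  rw [mem_closedBall_zero_iff]
  have h6 : P.2 ^ 2 ≤ R ^ 2 := sq_le_sq' (neg_le_of_abs_le h3) (le_of_abs_le h3)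
  linarith [le_abs_self P.1]

/-- Differentiation of integrals of the scattered wave over planes behind the wave front. -/
theorem IsProfile.hasDerivAt_slice (hV : IsProfile q V) (hs : tsupport q ⊆ Metric.closedBall 0 1)
    (hJ : IsFrame ω J) {z t : ℝ} (hz : z < t) :
    Integrable (fun η : E2 => fderiv ℝ (fun y => wave V ω y t) (J η + z • ω) ω) ∧
    HasDerivAt (fun z : ℝ => ∫ η : E2, wave V ω (J η + z • ω) t)
      (∫ η : E2, fderiv ℝ (fun y => wave V ω y t) (J η + z • ω) ω) z := by
  set f : (ℝ × ℝ) × E2 → ℝ := fun p => V (J p.2 + p.1.1 • ω, ω, p.1.2) with hf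
  have hfs : ContDiff ℝ 1 f := by
    have h1 : ContDiff ℝ (⊤ : ℕ∞) fun p : (ℝ × ℝ) × E2 => J p.2 := J.contDiff.comp contDiff_snd
    exact (contDiff_infty.1 (hV.smooth.comp (by fun_prop))) 1
  have hfd := hfs.differentiable one_ne_zero
  have hfc := fiberCompact_slice (ω := ω) hV hs hJ
  set c : ℝ → ℝ × ℝ := fun z => (z, √(t - z)) with hc
  set c' : ℝ × ℝ := (1, -1 / (2 * √(t - z))) with hc'
  have hcd : HasDerivAt c c' z :=
    (hasDerivAt_id z).prodMk (((hasDerivAt_id z).const_sub t).sqrt (sub_pos.2 hz).ne')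
  have hnear : ∀ᶠ z' in 𝓝 z, ∀ η : E2, wave V ω (J η + z' • ω) t = f (c z', η) := by
    filter_upwards [gt_mem_nhds hz] with z' hz' η
    rw [wave_of_le (by rw [hJ.inner_add]; exact hz'.le), hJ.inner_add]
  have hpt : ∀ η : E2, fderiv ℝ (fun y => wave V ω y t) (J η + z • ω) ω =
      fiberDeriv f (c z, η) c' := by
    intro η
    have h1 : HasDerivAt (fun z' : ℝ => J η + z' • ω) ω z :=
      (((hasDerivAt_id z).smul_const ω).const_add (J η)).congr_deriv (one_smul _ _)
    have h2 := ((differentiableAt_wave (ω := ω) (x := J η + z • ω) (t := t) hV.smooth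
      (by rw [hJ.inner_add]; exact hz)).hasFDerivAt).comp_hasDerivAt z h1
    have h3 := (hasFDerivAt_fiberDeriv hfd (c z) η).comp_hasDerivAt z hcd
    exact h2.unique (h3.congr_of_eventuallyEq (hnear.mono fun z' h => h η))
  have hi := (FiberCompact.fiberDeriv hfd hfc).integrable
    (ContDiff.fiberDeriv hfs (m := 0) (by simp)).continuous (c z)
  have h4 := (hfc.hasFDerivAt_integral hfs (c z)).comp_hasDerivAt z hcd
  simp only [hpt]
  refine ⟨hi.apply_continuousLinearMap c', ?_⟩
  rw [← ContinuousLinearMap.integral_apply hi]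
  refine h4.congr_of_eventuallyEq (hnear.mono fun z' h => ?_)
  simp only [h, Function.comp_apply, hf]

/-- The integral of a function over the planes `x · ω = h`, in a frame. -/
def slice (ω : E3) (J : E2 →ₗᵢ[ℝ] E3) (f : E3 → ℝ) (h : ℝ) : ℝ := ∫ η : E2, f (J η + h • ω)

/-- The integral over a plane does not see the part of a translation that lies in the plane. -/
theorem slice_translate (f : E3 → ℝ) (z a : ℝ) (ζ : E2) :
    ∫ η : E2, f (J η + z • ω + parab ω J (a, ζ)) = slice ω J f (z + (a - ‖ζ‖ ^ 2) / 2) := by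
  rw [slice, ← integral_add_right_eq_self
    (fun η => f (J η + (z + (a - ‖ζ‖ ^ 2) / 2) • ω)) (√a • ζ)]
  refine integral_congr_ae (Eventually.of_forall fun η => ?_)
  simp only [parab, map_add, map_smul, add_smul]
  congr 1
  abel

/-- The integral of the singly scattered wave over a plane. -/
theorem integral_slice_frontWave (hq : Continuous q) (hs : tsupport q ⊆ Metric.closedBall 0 1)
    (hJ : IsFrame ω J) {z t : ℝ} (hz : z ≤ t) :
    (Integrable fun η : E2 => frontWave q ω J (J η + z • ω) t) ∧
    ∫ η : E2, frontWave q ω J (J η + z • ω) t =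
      Real.pi * ∫ b in Ioi (0 : ℝ), slice ω J q ((t + z - b) / 2) := by
  set a := t - z with ha
  have ha0 : 0 ≤ a := sub_nonneg.2 hz
  have hJc := J.continuous
  set F : E2 × E2 → ℝ := fun p => q (J p.1 + z • ω + parab ω J (a, p.2)) with hF
  have hFc : Continuous F := by fun_prop
  have hint : Integrable F := by
    refine hFc.integrable_of_hasCompactSupport (HasCompactSupport.intro
      (K := Metric.closedBall 0 (1 + √a * √(2 + 2 * |z| + a)) ×ˢ
        Metric.closedBall 0 (√(2 + 2 * |z| + a)))
      ((isCompact_closedBall _ _).prod (isCompact_closedBall _ _)) fun p hp => ?_)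
    by_contra h0
    have h1 := norm_le_one_of_ne_zero hs h0
    have e1 : J p.1 + z • ω + parab ω J (a, p.2) =
        J (p.1 + √a • p.2) + (z + (a - ‖p.2‖ ^ 2) / 2) • ω := by
      simp only [parab, map_add, map_smul, add_smul]
      abel
    rw [e1] at h1
    obtain ⟨h2, h3⟩ := hJ.norm_le_norm_add (p.1 + √a • p.2) (z + (a - ‖p.2‖ ^ 2) / 2)
    have h4 := (abs_le.1 (h3.trans h1)).1
    have h5 : ‖p.2‖ ≤ √(2 + 2 * |z| + a) :=
      Real.le_sqrt_of_sq_le (by linarith [le_abs_self z])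
    have h6 : ‖p.1‖ ≤ ‖p.1 + √a • p.2‖ + ‖√a • p.2‖ := by
      simpa using norm_sub_le (p.1 + √a • p.2) (√a • p.2)
    rw [norm_smul, Real.norm_eq_abs, abs_of_nonneg (Real.sqrt_nonneg a)] at h6
    refine hp ⟨?_, by simpa using h5⟩
    rw [mem_closedBall_zero_iff]
    have : √a * ‖p.2‖ ≤ √a * √(2 + 2 * |z| + a) := by gcongr
    linarith [h2.trans h1]
  have e1 : ∀ η : E2, frontWave q ω J (J η + z • ω) t = ∫ ζ : E2, F (η, ζ) := fun η => by
    rw [frontWave, hJ.inner_add, if_pos hz]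
    rfl
  simp only [e1]
  refine ⟨hint.integral_prod_left, ?_⟩
  rw [integral_integral_swap hint]
  simp only [hF, slice_translate]
  rw [integral_radial fun b => slice ω J q (z + (a - b) / 2)]
  congr 1
  refine integral_congr_ae (Eventually.of_forall fun b => ?_)
  simp only [ha]
  congr 1
  ring

theorem slice_eq_zero (hs : tsupport q ⊆ Metric.closedBall 0 1) (hJ : IsFrame ω J) (u : E3 → ℝ)
    {h : ℝ} (hh : h < -1) : slice ω J (fun x => q x * u x) h = 0 := by
  refine integral_eq_zero_of_ae (Eventually.of_forall fun η => ?_)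
  have : q (J η + h • ω) = 0 := by
    by_contra h0
    have h1 := norm_le_one_of_ne_zero hs h0
    have h2 := (abs_le.1 ((hJ.norm_le_norm_add η h).2.trans h1)).1
    linarith
  simp [this]

/-- The integral of the multiply scattered wave over a plane in front of the support of the
potential. -/
theorem integral_slice_multiWave (hV : IsProfile q V) (hq : Continuous q)
    (hs : tsupport q ⊆ Metric.closedBall 0 1) (hJ : IsFrame ω J) {z t : ℝ} (hz : z ≤ -1) :
    (Integrable fun η : E2 => multiWave q V ω (J η + z • ω) t) ∧
    ∫ η : E2, multiWave q V ω (J η + z • ω) t =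
      2 * Real.pi * ∫ b in Ioi (0 : ℝ), ∫ y, q y * wave V ω y (t + z - b - ⟪y, ω⟫_ℝ) := by
  have hJc := J.continuous
  obtain ⟨Mq, hMq⟩ := hq.bounded_above_of_compact_support
    ((isCompact_closedBall _ _).of_isClosed_subset (isClosed_tsupport q) hs)
  obtain ⟨M, hM0, hM⟩ := wave_bounded hV.smooth.continuous ω (2 * |t| + 2)
  have hMq0 := (norm_nonneg _).trans (hMq 0)
  set F : E2 × E3 → ℝ := fun p =>
    q (J p.1 + z • ω + p.2) * wave V ω (J p.1 + z • ω + p.2) (t - ‖p.2‖) with hF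
  have hFm : Measurable F := hV.measurable_wave_comp hq (by fun_prop) (by fun_prop)
  have hsupp : ∀ p, F p ≠ 0 → ‖J p.1 + z • ω + p.2‖ ≤ 1 ∧ ‖p.2‖ ≤ t + 1 := by
    intro p hp
    refine ⟨norm_le_one_of_ne_zero hs (left_ne_zero_of_mul hp), ?_⟩
    linarith [(hV.wave_support hs hJ (right_ne_zero_of_mul hp)).1]
  have hint : Integrable F (volume.prod newton) := by
    refine integrable_of_bounded_of_compact (C := Metric.closedBall 0 (|t| + 2) ×ˢ
      Metric.closedBall 0 (|t| + 1)) (M := Mq * M) hFm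
      ((isCompact_closedBall _ _).prod (isCompact_closedBall _ _)) (fun p hp => ?_) fun p _ => ?_
    · obtain ⟨h1, h2⟩ := hsupp p hp
      have h3 := (hJ.norm_le_norm_add p.1 z).1
      have h4 : ‖J p.1 + z • ω‖ ≤ ‖J p.1 + z • ω + p.2‖ + ‖p.2‖ := by
        simpa using norm_sub_le (J p.1 + z • ω + p.2) p.2
      have h5 := le_abs_self t
      exact ⟨by rw [mem_closedBall_zero_iff]; linarith,
        by rw [mem_closedBall_zero_iff]; linarith⟩
    · by_cases h0 : F p = 0
      · rw [h0, abs_zero]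
        positivity
      · obtain ⟨h1, h2⟩ := hsupp p h0
        have h5 := le_abs_self t
        have h6 := neg_abs_le t
        have h7 := norm_nonneg p.2
        rw [abs_mul]
        exact mul_le_mul (hMq _) (hM _ _ (by linarith [abs_nonneg t])
          (abs_le.2 ⟨by linarith, by linarith⟩)) (abs_nonneg _) hMq0
  refine ⟨hint.integral_prod_left, ?_⟩
  have e1 : ∫ η : E2, multiWave q V ω (J η + z • ω) t = ∫ w, (∫ η : E2, F (η, w)) ∂newton :=
    integral_integral_swap (f := fun η w => F (η, w)) hint
  have hΞ : Measurable fun w => ∫ η : E2, F (η, w) :=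
    (hFm.stronglyMeasurable.integral_prod_left' (μ := (volume : Measure E2))).measurable
  have hΞi := hJ.measurePreserving_parab.integrable_comp_of_integrable hint.integral_prod_right
  rw [e1, hJ.integral_newton hΞ]
  set Ψ : ℝ → ℝ → ℝ := fun h s => slice ω J (fun x => q x * wave V ω x s) h with hΨ
  rw [halfSpace] at hΞi ⊢
  refine (integral_prod_symm _ hΞi).trans ?_
  have e2 : ∀ ζ : E2, ∫ a in Ioi (0 : ℝ), ((fun w => ∫ η : E2, F (η, w)) ∘ parab ω J) (a, ζ) =
      ∫ a in Ioi (0 : ℝ), Ψ (z + (a - ‖ζ‖ ^ 2) / 2) (t - (a + ‖ζ‖ ^ 2) / 2) := by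
    intro ζ
    refine setIntegral_congr_fun measurableSet_Ioi fun a ha => ?_
    simp only [hF, Function.comp_apply, hΨ]
    rw [← slice_translate, hJ.norm_parab (le_of_lt ha)]
  simp only [e2]
  rw [integral_radial fun b => ∫ a in Ioi (0 : ℝ), Ψ (z + (a - b) / 2) (t - (a + b) / 2),
    mul_comm 2 Real.pi, mul_assoc, ← integral_const_mul 2]
  congr 1
  refine setIntegral_congr_fun measurableSet_Ioi fun b hb => ?_
  have hb0 : (0 : ℝ) < b := hb
  set k : ℝ → ℝ := fun h => Ψ h (t + z - b - h) with hk
  have e3 : ∀ a, Ψ (z + (a - b) / 2) (t - (a + b) / 2) = k ((a + (2 * z - b)) / 2) := by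
    intro a
    simp only [hk]
    congr 1 <;> ring
  have e4 : ∫ a in Ioi (0 : ℝ), Ψ (z + (a - b) / 2) (t - (a + b) / 2) = 2 * ∫ h, k h := by
    simp only [e3]
    rw [← integral_Ici_eq_integral_Ioi, setIntegral_eq_integral_of_forall_compl_eq_zero,
      integral_add_right_eq_self (fun a => k (a / 2)), Measure.integral_comp_div]
    · simp
    · intro a ha
      exact slice_eq_zero hs hJ _ (by linarith [not_le.1 (notMem_Ici.1 ha |>.not_ge)])
  have e5 : ∫ y, q y * wave V ω y (t + z - b - ⟪y, ω⟫_ℝ) = ∫ h, k h := by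
    have hi := integrable_mul_wave hV hq hs hJ (t + z - b)
    have hi' := hJ.measurePreserving.integrable_comp_of_integrable hi
    rw [hJ.integral_eq]
    rw [Measure.volume_eq_prod] at hi' ⊢
    refine (integral_prod_symm _ hi').trans ?_
    refine integral_congr_ae (Eventually.of_forall fun h => ?_)
    refine integral_congr_ae (Eventually.of_forall fun η => ?_)
    simp only [Function.comp_apply, hJ.inner_add]
  rw [e4, e5]

theorem hasDerivAt_integral_sub {g : ℝ → ℝ} (hg : Continuous g) {A : ℝ} (h0 : ∀ r < A, g r = 0)
    (c : ℝ) : HasDerivAt (fun c => ∫ b in Ioi (0 : ℝ), g (c - b)) (g c) c := by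
  have hi : ∀ c, IntegrableOn g (Iic c) := fun c =>
    (hg.continuousOn.integrableOn_compact (isCompact_Icc (a := A) (b := c))).of_forall_sdiff_eq_zero
      measurableSet_Iic fun r hr => h0 r (by
        by_contra! h
        exact hr.2 ⟨h, hr.1⟩)
  have h1 : ∀ c, ∫ b in Ioi (0 : ℝ), g (c - b) = (∫ r in Iic A, g r) + ∫ r in A..c, g r := by
    intro c
    rw [← intervalIntegral.integral_Iic_sub_Iic (hi A) (hi c), add_sub_cancel,
      integral_Iic_eq_integral_Iio, ← integral_indicator measurableSet_Ioi,
      ← integral_indicator measurableSet_Iio,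
      ← integral_sub_left_eq_self ((Iio c).indicator g) volume c]
    congr 1
    funext b
    simp only [indicator, mem_Ioi, mem_Iio, sub_lt_self_iff]
  simp only [h1]
  exact ((hg.integral_hasStrictDerivAt A c).hasDerivAt).const_add _

end Slices

/-! ### The backscattering data -/

section Backscattering

variable {q : E3 → ℝ} {V : ParamSpace → ℝ} {ω : E3} {J : E2 →ₗᵢ[ℝ] E3}

theorem IsFrame.neg (hJ : IsFrame ω J) : IsFrame (-ω) J :=
  ⟨by rw [norm_neg, hJ.norm_eq], fun ζ => by rw [inner_neg_right, hJ.orth, neg_zero]⟩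

theorem neg_one_le_inner_of_ne_zero (hs : tsupport q ⊆ Metric.closedBall 0 1) (hω : ‖ω‖ = 1)
    {y : E3} (h : q y ≠ 0) : -1 ≤ ⟪y, ω⟫_ℝ :=
  neg_one_le_inner hω (norm_le_one_of_ne_zero hs h)

/-- The wave vanishes up to and including the time `-1`, when the front touches the unit ball. -/
theorem IsProfile.wave_eq_zero (hV : IsProfile q V) (hs : tsupport q ⊆ Metric.closedBall 0 1)
    (hJ : IsFrame ω J) {t : ℝ} (ht : t ≤ -1) (x : E3) : wave V ω x t = 0 := by
  rcases lt_or_ge t ⟪x, ω⟫_ℝ with h | h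
  · exact wave_of_lt h
  -- The point `(x - ε ω, t - ε)` has the same distance to the front and lies before time `-1`.
  rw [wave_of_le h]
  have hc : Continuous fun ε : ℝ => V (x - ε • ω, ω, √(t - ⟪x, ω⟫_ℝ)) :=
    hV.smooth.continuous.comp (by fun_prop)
  have h1 : Tendsto (fun ε : ℝ => V (x - ε • ω, ω, √(t - ⟪x, ω⟫_ℝ))) (𝓝[>] 0)
      (𝓝 (V (x - (0 : ℝ) • ω, ω, √(t - ⟪x, ω⟫_ℝ)))) := (hc.tendsto 0).mono_left nhdsWithin_le_nhds
  rw [zero_smul, sub_zero] at h1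
  refine tendsto_nhds_unique h1 (tendsto_const_nhds.congr' ?_)
  filter_upwards [self_mem_nhdsWithin] with ε hε
  have hin : ⟪x - ε • ω, ω⟫_ℝ = ⟪x, ω⟫_ℝ - ε := by
    rw [inner_sub_left, real_inner_smul_left, real_inner_self_eq_norm_sq, hJ.norm_eq]
    ring
  have h2 : wave V ω (x - ε • ω) (t - ε) = V (x - ε • ω, ω, √(t - ⟪x, ω⟫_ℝ)) := by
    rw [wave_of_le (by rw [hin]; linarith), hin, sub_sub_sub_cancel_right]
  rw [← h2]
  by_contra h3
  have h4 := (hV.wave_support hs hJ (Ne.symm h3)).1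
  have h5 : (0 : ℝ) < ε := hε
  linarith

theorem fiberCompact_comp_frame (hs : tsupport q ⊆ Metric.closedBall 0 1) (hJ : IsFrame ω J) :
    FiberCompact (volume : Measure E2) fun p : ℝ × E2 => q (J p.2 + p.1 • ω) := fun P => by
  refine ⟨univ, univ_mem, Metric.closedBall 0 1, isCompact_closedBall _ _,
    Eventually.of_forall fun η P _ hη => ?_⟩
  by_contra h0
  exact hη (by
    rw [mem_closedBall_zero_iff]
    exact (hJ.norm_le_norm_add η P).1.trans (norm_le_one_of_ne_zero hs h0))

theorem continuous_comp_frame (hq : Continuous q) :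
    Continuous fun p : ℝ × E2 => q (J p.2 + p.1 • ω) := by
  have hJc := J.continuous
  fun_prop

theorem integrable_slice (hq : Continuous q) (hs : tsupport q ⊆ Metric.closedBall 0 1)
    (hJ : IsFrame ω J) (h : ℝ) : Integrable fun η : E2 => q (J η + h • ω) :=
  (fiberCompact_comp_frame hs hJ).integrable (continuous_comp_frame hq) h

theorem continuous_slice (hq : Continuous q) (hs : tsupport q ⊆ Metric.closedBall 0 1)
    (hJ : IsFrame ω J) : Continuous (slice ω J q) :=
  (fiberCompact_comp_frame hs hJ).continuous_integral (continuous_comp_frame hq)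

theorem slice_eq_zero_of_le (hq : Continuous q) (hs : tsupport q ⊆ Metric.closedBall 0 1)
    (hJ : IsFrame ω J) {h : ℝ} (hh : h ≤ -1) : slice ω J q h = 0 := by
  have h1 : ∀ h < -1, slice ω J q h = 0 := fun h hh => by
    simpa using slice_eq_zero hs hJ (fun _ => 1) hh
  have h2 : IsClosed {h | slice ω J q h = 0} :=
    isClosed_eq (continuous_slice hq hs hJ) continuous_const
  have h3 : closure (Iio (-1 : ℝ)) ⊆ {h | slice ω J q h = 0} := h2.closure_subset_iff.2 h1
  rw [closure_Iio] at h3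
  exact h3 hh

theorem IsProfile.continuous_integral_mul_wave (hV : IsProfile q V) (hq : Continuous q)
    (hs : tsupport q ⊆ Metric.closedBall 0 1) (hJ : IsFrame ω J) :
    Continuous fun r : ℝ => ∫ y, q y * wave V ω y (r - ⟪y, ω⟫_ℝ) :=
  continuous_integral_cut hq hs hJ
    (G := fun p : E3 × ℝ => V (p.1, ω, √(p.2 - ⟪p.1, ω⟫_ℝ - ⟪p.1, ω⟫_ℝ)))
    (hV.smooth.continuous.comp (by fun_prop))

theorem IsProfile.integral_mul_wave_eq_zero (hV : IsProfile q V)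
    (hs : tsupport q ⊆ Metric.closedBall 0 1) (hJ : IsFrame ω J) {r : ℝ} (hr : r ≤ -2) :
    ∫ y, q y * wave V ω y (r - ⟪y, ω⟫_ℝ) = 0 := by
  refine integral_eq_zero_of_ae (Eventually.of_forall fun y => ?_)
  by_cases h : q y = 0
  · simp [h]
  · have h1 := neg_one_le_inner_of_ne_zero hs hJ.norm_eq h
    simp [hV.wave_eq_zero hs hJ (show r - ⟪y, ω⟫_ℝ ≤ -1 by linarith) y]

/-- Over a plane in front of the support of the potential the integral of the wave at time `t` is a
superposition of plane waves, a function of `t + z`: only the backscattered part is left. -/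
theorem IsProfile.integral_slice_wave (hV : IsProfile q V) (hq : Continuous q)
    (hs : tsupport q ⊆ Metric.closedBall 0 1) (hJ : IsFrame ω J) {z t : ℝ} (hz : z ≤ -1)
    (hzt : z ≤ t) : ∫ η : E2, wave V ω (J η + z • ω) t =
      -(1 / 4) * (∫ b in Ioi (0 : ℝ), slice ω J q ((t + z - b) / 2)) -
        1 / 2 * ∫ b in Ioi (0 : ℝ), ∫ y, q y * wave V ω y (t + z - b - ⟪y, ω⟫_ℝ) := by
  obtain ⟨i1, e1⟩ := integral_slice_frontWave hq hs hJ hzt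
  obtain ⟨i2, e2⟩ := integral_slice_multiWave (t := t) hV hq hs hJ hz
  have h := integral_add i1 i2
  simp only [← hV.mul_wave_eq hs hJ hq] at h
  rw [integral_const_mul, e1, e2] at h
  have hpi := Real.pi_ne_zero
  refine mul_left_cancel₀ (mul_ne_zero (neg_ne_zero.2 four_ne_zero) hpi) ?_
  linear_combination h

/-- The one-sided derivative of `integral_slice_wave` at `z = -1`. The formula holds for `z ≤ -1` only,
but the integral of the wave is differentiable at `-1`, so one side suffices. -/
theorem IsProfile.integral_fderiv_slice (hV : IsProfile q V) (hq : Continuous q)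
    (hs : tsupport q ⊆ Metric.closedBall 0 1) (hJ : IsFrame ω J) {t : ℝ} (ht : -1 < t) :
    ∫ η : E2, fderiv ℝ (fun y => wave V ω y t) (J η + (-1 : ℝ) • ω) ω =
      -(1 / 4) * slice ω J q ((t - 1) / 2) -
        1 / 2 * ∫ y, q y * wave V ω y (t - 1 - ⟪y, ω⟫_ℝ) := by
  have d1 := (hV.hasDerivAt_slice hs hJ ht).2
  have hsh : HasDerivAt (fun z : ℝ => t + z) 1 (-1) := (hasDerivAt_id _).const_add t
  have d2 := (hasDerivAt_integral_sub (g := fun r => slice ω J q (r / 2)) (A := -2)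
    ((continuous_slice hq hs hJ).comp (by fun_prop))
    (fun r hr => slice_eq_zero_of_le hq hs hJ (by linarith)) (t + -1)).comp (-1) hsh
  have d3 := (hasDerivAt_integral_sub (g := fun r => ∫ y, q y * wave V ω y (r - ⟪y, ω⟫_ℝ))
    (A := -2) (hV.continuous_integral_mul_wave hq hs hJ)
    (fun r hr => hV.integral_mul_wave_eq_zero hs hJ hr.le) (t + -1)).comp (-1) hsh
  have d4 := (d2.const_mul (-(1 / 4))).sub (d3.const_mul (1 / 2))
  have d5 : HasDerivWithinAt (fun z : ℝ => ∫ η : E2, wave V ω (J η + z • ω) t) _ (Iic (-1)) (-1) :=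
    d4.hasDerivWithinAt.congr
      (fun z hz => hV.integral_slice_wave hq hs hJ hz (le_trans hz ht.le))
      (hV.integral_slice_wave hq hs hJ le_rfl ht.le)
  rw [(uniqueDiffWithinAt_Iic (-1 : ℝ)).eq_deriv _ d1.hasDerivWithinAt d5]
  simp only [mul_one, sub_eq_add_neg]

/-- For `1 - s ≤ -1` the wave is zero; otherwise the plane lies strictly behind the front. -/
theorem IsProfile.backscatteringDefined (hV : IsProfile q V)
    (hs : tsupport q ⊆ Metric.closedBall 0 1) (hω : ‖ω‖ = 1) (s : ℝ) :
    BackscatteringDefined (wave V ω) ω s := by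
  obtain ⟨J, hJ⟩ := exists_isFrame hω
  rcases le_or_gt (1 - s) (-1) with ht | ht
  · have h0 : (fun y => wave V ω y (1 - s)) = fun _ => 0 :=
      funext fun y => hV.wave_eq_zero hs hJ ht y
    refine ⟨fun x _ => by rw [h0]; exact differentiableAt_const _, ?_⟩
    simp [spaceDeriv, h0]
  · refine ⟨fun x hx => differentiableAt_wave hV.smooth ?_, ?_⟩
    · rw [inner_neg_right] at hx
      linarith
    · rw [hJ.neg.integrableOn_plane_iff]
      simpa [spaceDeriv] using (hV.hasDerivAt_slice hs hJ ht).1.neg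

/-- The backscattering data consist of the plane integrals of the potential and of an average of
the scattered wave over the support of the potential. -/
theorem IsProfile.backscattering_eq (hV : IsProfile q V) (hq : Continuous q)
    (hs : tsupport q ⊆ Metric.closedBall 0 1) (hω : ‖ω‖ = 1) (τ : ℝ) :
    8 * Real.pi * backscattering (wave V ω) ω (-2 * τ) =
      -planeIntegral ω τ q - 2 * ∫ y, q y * wave V ω y (2 * τ - ⟪y, ω⟫_ℝ) := by
  obtain ⟨J, hJ⟩ := exists_isFrame hω
  have hpi := Real.pi_ne_zero
  rw [backscattering, hJ.neg.planeIntegral_eq, hJ.planeIntegral_eq]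
  change _ = -slice ω J q τ - _
  rcases le_or_gt τ (-1) with ht | ht
  · have h0 : (fun y => wave V ω y (1 - -2 * τ)) = fun _ => 0 :=
      funext fun y => hV.wave_eq_zero hs hJ (by linarith) y
    have h1 : ∀ x, spaceDeriv (wave V ω) (-ω) x (1 - -2 * τ) = 0 := fun x => by
      simp only [spaceDeriv, h0, fderiv_fun_const, Pi.zero_apply, zero_apply]
    simp only [h1]
    simp [slice_eq_zero_of_le hq hs hJ ht,
      hV.integral_mul_wave_eq_zero hs hJ (show 2 * τ ≤ -2 by linarith)]
  · have h1 := hV.integral_fderiv_slice hq hs hJ (t := 1 - -2 * τ) (by linarith)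
    have e1 : (1 - -2 * τ - 1) = 2 * τ := by ring
    rw [e1, mul_div_cancel_left₀ _ two_ne_zero] at h1
    have h2 : ∀ η : E2, spaceDeriv (wave V ω) (-ω) (J η + (1 : ℝ) • -ω) (1 - -2 * τ) =
        -fderiv ℝ (fun y => wave V ω y (1 - -2 * τ)) (J η + (-1 : ℝ) • ω) ω := fun η => by
      rw [spaceDeriv, map_neg, one_smul, neg_one_smul]
    simp only [h2]
    rw [integral_neg, h1]
    field_simp
    ring

end Backscattering

/-! ### The identity -/

section Identity

variable {q₁ q₂ : E3 → ℝ} {V₁ V₂ : ParamSpace → ℝ} {ω : E3} {J : E2 →ₗᵢ[ℝ] E3}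

/-- The kernel of the identity, with the inner integral extended over the whole line. Since the
waves vanish in front of their fronts it agrees with `identityKernel` where `y · ω ≤ τ`, and
vanishes elsewhere. -/
def extendedKernel (V₁ V₂ : ParamSpace → ℝ) (ω : E3) (τ : ℝ) (y : E3) : ℝ :=
  2 * (wave V₁ ω y (2 * τ - ⟪y, ω⟫_ℝ) + wave V₂ ω y (2 * τ - ⟪y, ω⟫_ℝ)) +
    2 * ∫ s, wave V₁ ω y s * wave V₂ ω y (2 * τ - s)

theorem extendedKernel_eq {τ : ℝ} {y : E3} (h : ⟪y, ω⟫_ℝ ≤ τ) :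
    extendedKernel V₁ V₂ ω τ y = identityKernel (wave V₁) (wave V₂) y ω τ := by
  rw [extendedKernel, identityKernel, intervalIntegral.integral_of_le (by linarith),
    ← integral_Icc_eq_integral_Ioc, setIntegral_eq_integral_of_forall_compl_eq_zero]
  intro s hs
  rcases lt_or_ge s ⟪y, ω⟫_ℝ with h1 | h1
  · rw [wave_of_lt h1, zero_mul]
  · have h2 : 2 * τ - ⟪y, ω⟫_ℝ < s := by
      by_contra! h2
      exact hs ⟨h1, h2⟩
    rw [wave_of_lt (show 2 * τ - s < ⟪y, ω⟫_ℝ by linarith), mul_zero]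

theorem extendedKernel_eq_zero {τ : ℝ} {y : E3} (h : τ < ⟪y, ω⟫_ℝ) :
    extendedKernel V₁ V₂ ω τ y = 0 := by
  have h1 : ∀ s, wave V₁ ω y s * wave V₂ ω y (2 * τ - s) = 0 := fun s => by
    rcases lt_or_ge s ⟪y, ω⟫_ℝ with h1 | h1
    · rw [wave_of_lt h1, zero_mul]
    · rw [wave_of_lt (show 2 * τ - s < ⟪y, ω⟫_ℝ by linarith), mul_zero]
  have h2 : 2 * τ - ⟪y, ω⟫_ℝ < ⟪y, ω⟫_ℝ := by linarith
  simp [extendedKernel, h1, wave_of_lt h2]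

variable (hV₁ : IsProfile q₁ V₁) (hV₂ : IsProfile q₂ V₂) (hq₁ : Continuous q₁)
  (hq₂ : Continuous q₂) (hs₁ : tsupport q₁ ⊆ Metric.closedBall 0 1)
  (hs₂ : tsupport q₂ ⊆ Metric.closedBall 0 1) (hJ : IsFrame ω J) (τ : ℝ)

include hV₁ hV₂ hq₁ hq₂ hs₁ hs₂ hJ in
theorem integral_mul_extendedKernel {q : E3 → ℝ} (hq : Continuous q)
    (hs : tsupport q ⊆ Metric.closedBall 0 1) :
    (Integrable fun y => extendedKernel V₁ V₂ ω τ y * q y) ∧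
    ∫ y, extendedKernel V₁ V₂ ω τ y * q y =
      2 * (∫ y, q y * wave V₁ ω y (2 * τ - ⟪y, ω⟫_ℝ)) +
      2 * (∫ y, q y * wave V₂ ω y (2 * τ - ⟪y, ω⟫_ℝ)) +
      2 * ∫ z : E3 × ℝ, q z.1 * (wave V₁ ω z.1 z.2 * wave V₂ ω z.1 (2 * τ - z.2)) := by
  have i1 := (integrable_mul_wave hV₁ hq hs hJ (2 * τ)).const_mul 2
  have i2 := (integrable_mul_wave hV₂ hq hs hJ (2 * τ)).const_mul 2
  have i3 := integrable_mul_wave_wave hV₁ hV₂ hq₁ hq₂ hs₁ hs₂ hJ (2 * τ) hq hs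
  rw [Measure.volume_eq_prod] at i3
  have i3' := i3.integral_prod_left.const_mul 2
  have e : ∀ y, extendedKernel V₁ V₂ ω τ y * q y =
      2 * (q y * wave V₁ ω y (2 * τ - ⟪y, ω⟫_ℝ)) + 2 * (q y * wave V₂ ω y (2 * τ - ⟪y, ω⟫_ℝ)) +
      2 * ∫ s, q y * (wave V₁ ω y s * wave V₂ ω y (2 * τ - s)) := fun y => by
    rw [extendedKernel, integral_const_mul]
    ring
  simp only [e]
  have i12 : Integrable fun y => 2 * (q y * wave V₁ ω y (2 * τ - ⟪y, ω⟫_ℝ)) +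
      2 * (q y * wave V₂ ω y (2 * τ - ⟪y, ω⟫_ℝ)) := i1.add i2
  refine ⟨i12.add i3', ?_⟩
  rw [integral_add i12 i3', integral_add i1 i2, integral_const_mul, integral_const_mul,
    integral_const_mul, Measure.volume_eq_prod, integral_prod _ i3]

include hJ in
/-- The iterated integral of the kernel over the planes `x · ω = t`, `-1 ≤ t ≤ τ`, is an integral
over the whole space: the potential vanishes where `x · ω < -1`, the extended kernel where
`x · ω > τ`. -/
theorem integral_planeIntegral_identityKernel {q : E3 → ℝ}
    (hs : tsupport q ⊆ Metric.closedBall 0 1)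
    (hi : Integrable fun y => extendedKernel V₁ V₂ ω τ y * q y) :
    ∫ t in (-1 : ℝ)..τ, planeIntegral ω t
      (fun x => identityKernel (wave V₁) (wave V₂) x ω τ * q x) =
    ∫ y, extendedKernel V₁ V₂ ω τ y * q y := by
  set g : ℝ → ℝ := fun t => ∫ η : E2, extendedKernel V₁ V₂ ω τ (J η + t • ω) * q (J η + t • ω)
    with hg
  have hq0 : ∀ t < (-1 : ℝ), ∀ η, q (J η + t • ω) = 0 := fun t ht η => by
    by_contra h0
    have h1 := neg_one_le_inner_of_ne_zero hs hJ.norm_eq h0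
    rw [hJ.inner_add] at h1
    linarith
  have h1 : ∫ y, extendedKernel V₁ V₂ ω τ y * q y = ∫ t, g t := by
    have hi' := hJ.measurePreserving.integrable_comp_of_integrable hi
    rw [hJ.integral_eq]
    rw [Measure.volume_eq_prod] at hi' ⊢
    exact integral_prod_symm _ hi'
  have hlt : ∀ t < -1, g t = 0 := fun t ht => by simp [hg, hq0 t ht]
  have hgt : ∀ t, τ < t → g t = 0 := fun t ht => by
    have h2 : ∀ η, extendedKernel V₁ V₂ ω τ (J η + t • ω) = 0 := fun η =>
      extendedKernel_eq_zero (by rwa [hJ.inner_add])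
    simp [hg, h2]
  rw [h1]
  simp only [hJ.planeIntegral_eq]
  rcases le_or_gt (-1) τ with hτ | hτ
  · rw [intervalIntegral.integral_of_le hτ, ← integral_Icc_eq_integral_Ioc,
      ← setIntegral_eq_integral_of_forall_compl_eq_zero (s := Icc (-1) τ) (f := g)]
    · refine setIntegral_congr_fun measurableSet_Icc fun t ht => ?_
      refine integral_congr_ae (Eventually.of_forall fun η => ?_)
      simp only
      rw [extendedKernel_eq (by rw [hJ.inner_add]; exact ht.2)]
    · intro t ht
      rcases lt_or_ge t (-1) with h2 | h2
      · exact hlt t h2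
      · exact hgt t (by
          by_contra! h3
          exact ht ⟨h2, h3⟩)
  · have h2 : ∫ t, g t = 0 := by
      refine integral_eq_zero_of_ae (Eventually.of_forall fun t => ?_)
      rcases lt_or_ge t (-1) with h2 | h2
      · exact hlt t h2
      · exact hgt t (by linarith)
    rw [h2, intervalIntegral.integral_of_ge hτ.le, integral_Ioc_eq_integral_Ioo,
      setIntegral_eq_zero_of_forall_eq_zero, neg_zero]
    intro t ht
    simp [hq0 t ht.2]

theorem tsupport_sub_subset {K : Set E3} (hK : IsClosed K) (h₁ : tsupport q₁ ⊆ K)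
    (h₂ : tsupport q₂ ⊆ K) : tsupport (fun x => q₂ x - q₁ x) ⊆ K :=
  closure_minimal (fun x hx => by
    by_contra h
    exact hx (by simp [image_eq_zero_of_notMem_tsupport (fun h' => h (h₁ h')),
      image_eq_zero_of_notMem_tsupport (fun h' => h (h₂ h'))])) hK

include hV₁ hV₂ hq₁ hq₂ hs₁ hs₂ in
/-- The identity for the difference of the backscattering data, with the waves given by their
profiles. -/
theorem backscattering_identity (hω : ‖ω‖ = 1) :
    8 * Real.pi * (backscattering (wave V₁ ω) ω (-2 * τ) - backscattering (wave V₂ ω) ω (-2 * τ)) =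
      planeIntegral ω τ (fun x => q₂ x - q₁ x) +
        ∫ t in (-1 : ℝ)..τ, planeIntegral ω t
          (fun x => identityKernel (wave V₁) (wave V₂) x ω τ * (q₂ x - q₁ x)) := by
  obtain ⟨J, hJ⟩ := exists_isFrame hω
  obtain ⟨i₁, e₁⟩ := integral_mul_extendedKernel hV₁ hV₂ hq₁ hq₂ hs₁ hs₂ hJ τ hq₁ hs₁
  obtain ⟨i₂, e₂⟩ := integral_mul_extendedKernel hV₁ hV₂ hq₁ hq₂ hs₁ hs₂ hJ τ hq₂ hs₂
  have h1 : ∀ y, extendedKernel V₁ V₂ ω τ y * (q₂ y - q₁ y) =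
      extendedKernel V₁ V₂ ω τ y * q₂ y - extendedKernel V₁ V₂ ω τ y * q₁ y := fun y =>
    mul_sub _ _ _
  have h2 := integral_planeIntegral_identityKernel (V₁ := V₁) (V₂ := V₂) hJ τ
    (tsupport_sub_subset Metric.isClosed_closedBall hs₁ hs₂)
    (by simp only [h1]; exact i₂.sub i₁)
  simp only [h1] at h2
  rw [integral_sub i₂ i₁] at h2
  have hpl : planeIntegral ω τ (fun x => q₂ x - q₁ x) =
      planeIntegral ω τ q₂ - planeIntegral ω τ q₁ := by
    simp only [hJ.planeIntegral_eq]
    exact integral_sub (integrable_slice hq₂ hs₂ hJ τ) (integrable_slice hq₁ hs₁ hJ τ)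
  have b₁ := hV₁.backscattering_eq hq₁ hs₁ hω τ
  have b₂ := hV₂.backscattering_eq hq₂ hs₂ hω τ
  have hr := reciprocity hV₁ hV₂ hq₁ hq₂ hs₁ hs₂ hJ (2 * τ)
  rw [h2, hpl]
  linear_combination b₁ - b₂ - e₂ + e₁ - 2 * hr

end Identity

end

end

theorem proposition1 (q₁ q₂ : E3 → ℝ)
    (hq₁ : ContDiff ℝ (⊤ : ℕ∞) q₁) (hq₂ : ContDiff ℝ (⊤ : ℕ∞) q₂)
    (hs₁ : tsupport q₁ ⊆ Metric.closedBall 0 1) (hs₂ : tsupport q₂ ⊆ Metric.closedBall 0 1)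
    (U₁ U₂ : E3 → SpaceTimeDistribution)
    (hU₁ : ∀ ω : E3, ‖ω‖ = 1 → IsPlaneWaveSolution q₁ ω (U₁ ω))
    (hU₂ : ∀ ω : E3, ‖ω‖ = 1 → IsPlaneWaveSolution q₂ ω (U₂ ω)) :
    ∃ u₁ u₂ : E3 → E3 → ℝ → ℝ,
      (∀ ω : E3, ‖ω‖ = 1 →
        IsScatteredWave ω (U₁ ω) (u₁ ω) ∧ IsScatteredWave ω (U₂ ω) (u₂ ω)) ∧
      (∀ ω : E3, ‖ω‖ = 1 → ∀ s : ℝ,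
        BackscatteringDefined (u₁ ω) ω s ∧ BackscatteringDefined (u₂ ω) ω s) ∧
      (∀ ω : E3, ‖ω‖ = 1 → ∀ τ : ℝ,
        8 * Real.pi *
            (backscattering (u₁ ω) ω (-2 * τ) - backscattering (u₂ ω) ω (-2 * τ)) =
          planeIntegral ω τ (fun x => q₂ x - q₁ x) +
            ∫ t in (-1 : ℝ)..τ,
              planeIntegral ω t (fun x => identityKernel u₁ u₂ x ω τ * (q₂ x - q₁ x))) ∧
      ContDiffOn ℝ (⊤ : ℕ∞) (fun z : E3 × E3 × ℝ => identityKernel u₁ u₂ z.1 z.2.1 z.2.2)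
        kernelRegion := by
  obtain ⟨V₁, hV₁⟩ := exists_isProfile hq₁ hs₁
  obtain ⟨V₂, hV₂⟩ := exists_isProfile hq₂ hs₂
  refine ⟨wave V₁, wave V₂, fun ω hω => ⟨?_, ?_⟩, fun ω hω s => ⟨?_, ?_⟩, fun ω hω τ => ?_, ?_⟩
  · exact ⟨fun x t h => wave_of_lt h, contDiffOn_wave hV₁.smooth hV₁.even ω,
      hV₁.repr hq₁ hs₁ hω (hU₁ ω hω)⟩
  · exact ⟨fun x t h => wave_of_lt h, contDiffOn_wave hV₂.smooth hV₂.even ω,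
      hV₂.repr hq₂ hs₂ hω (hU₂ ω hω)⟩
  · exact hV₁.backscatteringDefined hs₁ hω s
  · exact hV₂.backscatteringDefined hs₂ hω s
  · exact backscattering_identity hV₁ hV₂ hq₁.continuous hq₂.continuous hs₁ hs₂ τ hω
  · exact contDiffOn_identityKernel hV₁.smooth hV₂.smooth hV₁.even hV₂.even
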